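/- **Setting.** Use the stereographic coordinate $\zeta=e^{i\phi}\cot(\theta/2)\in\mathbb C\cup\{\infty\}$ on the unit sphere, $P=\tfrac12(1+\zeta\bar\zeta)$, so that the sphere metric is $q=P^{-2}d\zeta\,d\bar\zeta$. For a quantity $\eta$ of spin weight $s$ (component relative to $m=\sqrt2P\,\partial_\zeta$) put $\eth\eta=2P^{1-s}\partial_\zeta(P^s\eta)$. If $S$ has spin weight $2$ and $S=\eth^2\xi$ with $\xi$ a smooth complex function on the sphere, its electric part is $S_e=\eth^2\,\mathrm{Re}\,\xi$. Let a space-time be asymptotically flat: in coordinates $(u,r,x^A)$ its metric is $$g=e^{2\beta}\tfrac Vr du^2+2e^{2\beta}du\,dr-r^2h_{AB}(dx^A-U^Adu)(dx^B-U^Bdu),\qquad \det h_{AB}=\det q_{AB},$$ with $V/r,\beta,U^A,h_{AB}$ smooth in $(u,1/r,x^A)$ up to $r=\infty$ over the whole sphere and $V=r-2M+O(r^{-1})$, $h_{AB}=q_{AB}+c_{AB}/r+O(r^{-2})$, $\beta=-c^{AB}c_{AB}/(32r^2)+O(r^{-3})$, $U^A=-D_Bc^{AB}/(2r^2)+O(r^{-3})$.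 Null infinity is $\{r=\infty\}\cong\mathbb R\times S^2$. The asymptotic shear $\tilde\sigma^0(u,\zeta)$ is the value at null infinity of $m^am^b\nabla_al_b$, with $\nabla$ the Levi-Civita connection of the unphysical metric $r^{-2}g$, $l=du$ and $m=\sqrt2P\,\partial_\zeta$. A BMS transformation is a map $(u,p)\mapsto(u',p')=(K(p)[u+\alpha(p)],f(p))$ of $\mathbb R\times S^2$, where $f$ is an orientation preserving conformal diffeomorphism of the sphere with conformal factor $K>0$ (so $f^*q=K^2q$) and $\alpha$ is a smooth real function on the sphere; it is a supertranslation if $f=\mathrm{id}$ (so $K=1$). The transformed shear $\tilde\sigma^{0}{}'(u,\zeta)$ is $m'^am'^b\nabla'_al'_b$ at the point $(u,\zeta)$ of null infinity, for the unphysical metric $K^2r^{-2}g$, where $l'$ is the null covector whose restriction to null infinity is $du'$, and $m'$ is tangent to the cut $u'=\mathrm{const}$ and projects to the vector of the sphere that $f$ maps to $\sqrt2P\,\partial_{\zeta'}$ at $\zeta'=f(\zeta)$. **Theorem.** 1. For every BMS transformation, at all points with $\zeta,f(\zeta)\ne\infty$, $$\tilde\sigma^{0}{}'=K^{-1}e^{2i\psi}\left[\tilde\sigma^0+\tfrac12\eth^2\alpha\right],$$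 where $\psi$ is the angle for which the projection of $m'$ to the sphere is $K^{-1}e^{i\psi}\sqrt2P\,\partial_\zeta$. Suppose moreover that $\tilde\sigma^0(u,\cdot)\to S$ pointwise as $u\to-\infty$, where $S$ is a smooth quantity of spin weight $2$ on the sphere. Say that the coordinate system obtained by a BMS transformation $b$ satisfies $S_e=0$ at $u=-\infty$ if the limit as $u\to-\infty$ of its asymptotic shear is a smooth quantity of spin weight $2$ on the transformed sphere (a function of $\zeta'$) whose electric part is $0$. 2. There is a supertranslation such that the transformed coordinate system satisfies $S_e=0$ at $u=-\infty$. 3. Let $b_0$ be any BMS transformation whose coordinate system satisfies $S_e=0$ at $u=-\infty$ (for instance the identity, if $S_e=0$). The BMS transformations $b$ that preserve this condition, i.e. for which the coordinate system of $b\circ b_0$ satisfies it as well, form a group. It consists of exactly the BMS transformations with $\eth^2\alpha=0$, equivalently of those for which $\alpha$ is a translation, $\alpha=\epsilon_0+\epsilon_1\sin\theta\cos\phi+\epsilon_2\sin\theta\sin\phi+\epsilon_3\cos\theta$ with real $\epsilon_i$. This group is isomorphic to the Poincaré group $\mathbb R^4\rtimes L_+^\uparrow$, where $L_+^\uparrow$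 is the connected component of the Lorentz group. -/

import Mathlib

open scoped ContDiff Topology Matrix
open Complex

noncomputable section

namespace BondiSachs

/-! ## The sphere `ℂ ∪ {∞}` of null directions, in the stereographic coordinate `ζ = e^{iφ} cot(θ/2)` -/

/-- The two holomorphic charts of the sphere: `ζ`, and `w = 1/ζ` around `ζ = ∞`. -/
def chart : Bool → ℂ → OnePoint ℂ
  | false, z => (z : OnePoint ℂ)
  | true, w => if w = 0 then OnePoint.infty else ((w⁻¹ : ℂ) : OnePoint ℂ)

/-- Smooth functions on the sphere. -/
def SmoothOnSphere {E : Type*} [NormedAddCommGroup E] [NormedSpace ℝ E]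
    (α : OnePoint ℂ → E) : Prop :=
  ∀ i, ContDiff ℝ ∞ (fun z => α (chart i z))

/-- `P = (1 + ζ ζ̄) / 2`. The unit sphere metric `dθ² + sin² θ dφ²` is `P⁻² dζ dζ̄`;
it has the same form in the coordinate `w = 1/ζ`. -/
def P (z : ℂ) : ℝ := (1 + ‖z‖ ^ 2) / 2

/-- The value of the coordinate `ζ` (junk value `0` at `ζ = ∞`). -/
def coord (p : OnePoint ℂ) : ℂ := p.elim 0 id

/-- The direction `(sin θ cos φ, sin θ sin φ, cos θ)` of a point of the sphere. -/
def direction (p : OnePoint ℂ) : Fin 3 → ℝ :=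
  p.elim ![0, 0, 1] fun z =>
    ![2 * z.re / (1 + ‖z‖ ^ 2), 2 * z.im / (1 + ‖z‖ ^ 2), (‖z‖ ^ 2 - 1) / (1 + ‖z‖ ^ 2)]

/-- `α = ε₀ + ε₁ sin θ cos φ + ε₂ sin θ sin φ + ε₃ cos θ`. -/
def IsTranslation (α : OnePoint ℂ → ℝ) : Prop :=
  ∃ (ε₀ : ℝ) (ε : Fin 3 → ℝ), ∀ p, α p = ε₀ + ∑ i, ε i * direction p i

/-- `f` is an orientation preserving conformal diffeomorphism of the unit sphere with conformal
factor `K > 0`, i.e. `dθ'² + sin² θ' dφ'² = K² (dθ² + sin² θ dφ²)` and the Jacobian is positive.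
(Since `K > 0`, the inverse of the bijection `f` is smooth as well.) -/
def IsConformal (f : Equiv.Perm (OnePoint ℂ)) (K : OnePoint ℂ → ℝ) : Prop :=
  (∀ p, 0 < K p) ∧
  ∀ (i j : Bool) (z w : ℂ), f (chart i z) = chart j w →
    ∃ g : ℂ → ℂ, (∀ᶠ y in 𝓝 z, f (chart i y) = chart j (g y)) ∧ ContDiffAt ℝ ∞ g z ∧
      (∀ v : ℂ, ‖fderiv ℝ g z v‖ / P w = K (chart i z) * (‖v‖ / P z)) ∧
      0 < (fderiv ℝ g z).det

/-! ## The operator `ð` and spin weighted functions -/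

/-- `∂/∂ζ = (∂/∂x - i ∂/∂y) / 2` for `ζ = x + i y`. -/
def dzeta (η : ℂ → ℂ) (z : ℂ) : ℂ := (fderiv ℝ η z 1 - I * fderiv ℝ η z I) / 2

/-- `ð η = 2 P^{1-s} ∂(P^s η)/∂ζ` on the components `η` of a quantity of spin weight `s`,
relative to the complex null vector `m = √2 P ∂/∂ζ`. -/
def eth (s : ℤ) (η : ℂ → ℂ) (z : ℂ) : ℂ :=
  2 * (P z : ℂ) ^ (1 - s) * dzeta (fun y => (P y : ℂ) ^ s * η y) z

/-- `ð² ξ` for a function `ξ` (spin weight `0`) on the sphere. -/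
def ethSq (ξ : OnePoint ℂ → ℂ) : ℂ → ℂ := eth 1 (eth 0 fun z => ξ (z : OnePoint ℂ))

/-- `S : ℂ → ℂ` is the `ζ`-component of a smooth quantity of spin weight `2` on the whole sphere:
at `ζ = ∞` its component relative to `√2 P ∂/∂w`, `w = 1/ζ`, extends smoothly. -/
def IsSpinTwo (S : ℂ → ℂ) : Prop :=
  ContDiff ℝ ∞ S ∧ ∃ T : ℂ → ℂ, ContDiff ℝ ∞ T ∧
    ∀ w, w ≠ 0 → T w = ((starRingEnd ℂ) w / w) ^ 2 * S w⁻¹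

/-- `Sₑ` is the electric part of the spin weight `2` quantity `S`:
`S = ð² ξ` and `Sₑ = ð² Re ξ`. -/
def IsElectricPart (S Sₑ : ℂ → ℂ) : Prop :=
  ∃ ξ : OnePoint ℂ → ℂ, SmoothOnSphere ξ ∧ S = ethSq ξ ∧ Sₑ = ethSq fun p => ((ξ p).re : ℂ)

/-! ## Asymptotically flat space-times -/

/-- The coordinates `(u, ℓ, x, y)` with `ℓ = 1/r` and `ζ = x + i y`; null infinity is `ℓ = 0`. -/
def pt (u ℓ : ℝ) (z : ℂ) : Fin 4 → ℝ := ![u, ℓ, z.re, z.im]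

/-- The coordinate `ζ` of a point. -/
def zeta (X : Fin 4 → ℝ) : ℂ := ⟨X 2, X 3⟩

/-- The half-space `ℓ ≥ 0`. -/
def halfSpace : Set (Fin 4 → ℝ) := {X | 0 ≤ X 1}

/-- The partial derivative `∂F/∂x^a` on `D`, one-sided at boundary points of `D`. -/
def pd {ι : Type*} [Fintype ι] [DecidableEq ι] (D : Set (ι → ℝ)) (F : (ι → ℝ) → ℝ) (a : ι)
    (X : ι → ℝ) : ℝ :=
  fderivWithin ℝ F D X (Pi.single a 1)

/-- The Christoffel symbols `Γ^c_{ab}` of the Levi-Civita connection of `g` on `D`. -/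
def christoffel {ι : Type*} [Fintype ι] [DecidableEq ι] (D : Set (ι → ℝ))
    (g : (ι → ℝ) → Matrix ι ι ℝ) (c a b : ι) (X : ι → ℝ) : ℝ :=
  (1 / 2) * ∑ d, (g X)⁻¹ c d *
    (pd D (fun Y => g Y b d) a X + pd D (fun Y => g Y a d) b X - pd D (fun Y => g Y a b) d X)

/-- The coordinate range `u₀ < u < u₁`, `1/ε < r ≤ ∞`. -/
def slab (u₀ u₁ ε : ℝ) : Set (Fin 4 → ℝ) :=
  {X | X 0 ∈ Set.Ioo u₀ u₁ ∧ X 1 ∈ Set.Ico 0 ε}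

/-- For every `u₀ < u₁` there is `r₀` such that the function is smooth in `(u, 1/r, x, y)` on
`u₀ < u < u₁`, `r₀ < r ≤ ∞`, up to and including `r = ∞`. -/
def SmoothNearScri (F : (Fin 4 → ℝ) → ℝ) : Prop :=
  ∀ u₀ u₁ : ℝ, ∃ ε > 0, ContDiffOn ℝ ∞ F (slab u₀ u₁ ε)

/-- The unit sphere metric `q_{AB}` in the coordinates `x, y`. -/
def roundMetric (x : Fin 2 → ℝ) : Matrix (Fin 2) (Fin 2) ℝ :=
  ((P ⟨x 0, x 1⟩) ^ 2)⁻¹ • 1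

/-- The tensor `c^{AB}`, the indices of `c_{AB}` being raised with `q_{AB}`. -/
def raised (c : (Fin 2 → ℝ) → Matrix (Fin 2) (Fin 2) ℝ) (A B : Fin 2) (x : Fin 2 → ℝ) : ℝ :=
  ((roundMetric x)⁻¹ * c x * (roundMetric x)⁻¹) A B

/-- The covariant divergence `D_B c^{AB}` on the unit sphere. -/
def sphereDiv (c : (Fin 2 → ℝ) → Matrix (Fin 2) (Fin 2) ℝ) (A : Fin 2) (x : Fin 2 → ℝ) : ℝ :=
  ∑ B, (pd Set.univ (raised c A B) B x +
    ∑ C, (christoffel Set.univ roundMetric A B C x * raised c C B x +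
      christoffel Set.univ roundMetric B B C x * raised c A C x))

/-- The functions in the Bondi-Sachs form
`e^{2β} (V/r) du² + 2 e^{2β} du dr - r² h_{AB} (dx^A - U^A du) (dx^B - U^B du)`
of the metric in one chart of the sphere, as functions of `(u, ℓ = 1/r, x, y)`;
`W` stands for `V/r`. -/
structure BondiFunctions where
  W : (Fin 4 → ℝ) → ℝ
  β : (Fin 4 → ℝ) → ℝ
  U : (Fin 4 → ℝ) → Fin 2 → ℝ
  h : (Fin 4 → ℝ) → Matrix (Fin 2) (Fin 2) ℝ

/-- The Bondi-Sachs functions have the asymptotic form of a flat metric: they are smooth in `1/r`,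
`det h_{AB} = det q_{AB}`, and `V = r - 2M + O(r⁻¹)`, `h_{AB} = q_{AB} + c_{AB}/r + O(r⁻²)`,
`β = - c^{AB} c_{AB} / (32 r²) + O(r⁻³)`, `U^A = - D_B c^{AB} / (2 r²) + O(r⁻³)`
for some functions `M`, `c_{AB}` of `(u, x, y)`. -/
structure BondiFunctions.IsAsymptoticallyFlat (D : BondiFunctions) : Prop where
  smooth_W : SmoothNearScri D.W
  smooth_β : SmoothNearScri D.β
  smooth_U : ∀ A, SmoothNearScri fun X => D.U X A
  smooth_h : ∀ A B, SmoothNearScri fun X => D.h X A B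
  symm_det : ∀ u₀ u₁ : ℝ, ∃ ε > 0, ∀ X ∈ slab u₀ u₁ ε,
    (D.h X).IsSymm ∧ (D.h X).det = (roundMetric ![X 2, X 3]).det
  expansion : ∃ (M : ℝ → (Fin 2 → ℝ) → ℝ) (c : ℝ → (Fin 2 → ℝ) → Matrix (Fin 2) (Fin 2) ℝ),
    ∀ (u : ℝ) (x : Fin 2 → ℝ),
      ((fun ℓ : ℝ => D.W ![u, ℓ, x 0, x 1] - (1 - 2 * M u x * ℓ))
        =O[𝓝[>] 0] fun ℓ => ℓ ^ 2) ∧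
      (∀ A B, (fun ℓ : ℝ => D.h ![u, ℓ, x 0, x 1] A B - (roundMetric x A B + c u x A B * ℓ))
        =O[𝓝[>] 0] fun ℓ => ℓ ^ 2) ∧
      ((fun ℓ : ℝ => D.β ![u, ℓ, x 0, x 1] +
          (∑ A, ∑ B, raised (c u) A B x * c u x A B) / 32 * ℓ ^ 2)
        =O[𝓝[>] 0] fun ℓ => ℓ ^ 3) ∧
      (∀ A, (fun ℓ : ℝ => D.U ![u, ℓ, x 0, x 1] A + sphereDiv (c u) A x / 2 * ℓ ^ 2)
        =O[𝓝[>] 0] fun ℓ => ℓ ^ 3)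

/-- Multiplication by the complex number `c` as a real matrix. -/
def mulMatrix (c : ℂ) : Matrix (Fin 2) (Fin 2) ℝ := !![c.re, -c.im; c.im, c.re]

/-- An asymptotically flat space-time near future null infinity: Bondi-Sachs metric functions in
the charts `ζ` and `w = 1/ζ` of the sphere of null rays, which are related by the tensor
transformation law (`dw = - w² dζ`) on the overlap near null infinity. -/
structure SpaceTime where
  north : BondiFunctions
  south : BondiFunctions
  flat_north : north.IsAsymptoticallyFlat
  flat_south : south.IsAsymptoticallyFlat
  overlap : ∀ u₀ u₁ : ℝ, ∃ ε > 0, ∀ u ∈ Set.Ioo u₀ u₁, ∀ ℓ ∈ Set.Ico 0 ε, ∀ w : ℂ, w ≠ 0 →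
    south.W (pt u ℓ w) = north.W (pt u ℓ w⁻¹) ∧
    south.β (pt u ℓ w) = north.β (pt u ℓ w⁻¹) ∧
    south.U (pt u ℓ w) = mulMatrix (-w ^ 2) *ᵥ north.U (pt u ℓ w⁻¹) ∧
    north.h (pt u ℓ w⁻¹) = (mulMatrix (-w ^ 2))ᵀ * south.h (pt u ℓ w) * mulMatrix (-w ^ 2)

/-- The unphysical metric `r⁻² g` in the coordinates `(u, ℓ = 1/r, x, y)` (so `dr = - ℓ⁻² dℓ`):
`ℓ² e^{2β} (V/r) du² - 2 e^{2β} du dℓ - h_{AB} (dx^A - U^A du) (dx^B - U^B du)`,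
extended to null infinity `ℓ = 0`. -/
def SpaceTime.unphysicalMetric (M : SpaceTime) (X : Fin 4 → ℝ) : Matrix (Fin 4) (Fin 4) ℝ :=
  let D := M.north
  let e := Real.exp (2 * D.β X)
  let h := D.h X
  let U := D.U X
  let hU := h *ᵥ U
  !![X 1 ^ 2 * e * D.W X - U ⬝ᵥ hU, -e, hU 0, hU 1;
     -e, 0, 0, 0;
     hU 0, 0, -h 0 0, -h 0 1;
     hU 1, 0, -h 1 0, -h 1 1]

/-! ## Shear of cuts of null infinity -/

/-- The complex shear `σ = m^a m^b ∇_a l_b`, with respect to the metric `g`. -/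
def shear (g : (Fin 4 → ℝ) → Matrix (Fin 4) (Fin 4) ℝ) (l : (Fin 4 → ℝ) → Fin 4 → ℝ)
    (m : Fin 4 → ℂ) (X : Fin 4 → ℝ) : ℂ :=
  ∑ a, ∑ b, m a * m b * ((pd halfSpace (fun Y => l Y b) a X -
    ∑ c, christoffel halfSpace g c a b X * l X c : ℝ) : ℂ)

/-- The asymptotic shear `σ⁰(u, ζ)` of the hypersurfaces `u = const`: the shear at null infinity of
the null covector `l = du`, with `m = √2 P ∂/∂ζ`. -/
def SpaceTime.asymptoticShear (M : SpaceTime) (u : ℝ) (z : ℂ) : ℂ :=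
  shear M.unphysicalMetric (fun _ => ![1, 0, 0, 0])
    ![0, 0, √2 * P z / 2, -I * (√2 * P z / 2)] (pt u 0 z)

/-! ## BMS transformations -/

/-- A BMS transformation `p' = f(p)`, `u' = K (u + α)` of null infinity, with `f` an orientation
preserving conformal transformation of the sphere with conformal factor `K` and `α` a smooth
real function on the sphere. -/
structure BMS where
  f : Equiv.Perm (OnePoint ℂ)
  K : OnePoint ℂ → ℝ
  α : OnePoint ℂ → ℝ
  conformal : IsConformal f K
  smooth : SmoothOnSphere α

/-- A BMS transformation as a bijection of null infinity `ℝ × S²` onto itself. -/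
def BMS.toPerm (b : BMS) : Equiv.Perm (ℝ × OnePoint ℂ) where
  toFun q := (b.K q.2 * (q.1 + b.α q.2), b.f q.2)
  invFun q := (q.1 / b.K (b.f.symm q.2) - b.α (b.f.symm q.2), b.f.symm q.2)
  left_inv q := by
    have h := (b.conformal.1 q.2).ne'
    ext
    · simp [h]
    · simp
  right_inv q := by
    have h := (b.conformal.1 (b.f.symm q.2)).ne'
    ext
    · simp [mul_div_cancel₀, h]
    · simp

/-- A supertranslation: `u' = u + α`, the points of the sphere being fixed. -/
def BMS.IsSupertranslation (b : BMS) : Prop := b.f = 1 ∧ ∀ p, b.K p = 1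

/-- The transformed retarded time `u' = K (u + α)`. -/
def BMS.newTime (b : BMS) (X : Fin 4 → ℝ) : ℝ := b.K (zeta X) * (X 0 + b.α (zeta X))

/-- The null covector `l'` at null infinity whose restriction to null infinity is `du'`; its
`dℓ`-component is fixed by `l'_a l'^a = 0`. -/
def BMS.newCovector (b : BMS) (X : Fin 4 → ℝ) : Fin 4 → ℝ :=
  let d := fun a => pd Set.univ b.newTime a X
  ![d 0, -(P (zeta X) ^ 2 * (d 2 ^ 2 + d 3 ^ 2)) / (2 * d 0), d 2, d 3]

/-- The tangent vector `√2 P ∂/∂ζ'` of the sphere at `ζ' = f(ζ)` is the image under `f` of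
`(newFrame ζ) ∂/∂ζ`. To be used only where `ζ` and `ζ'` are finite. -/
def BMS.newFrame (b : BMS) (z : ℂ) : ℂ :=
  √2 * P (coord (b.f z)) / deriv (fun y : ℂ => coord (b.f y)) z

/-- The complex vector `m'` tangent to the cut `u' = const`, i.e. `m'(u') = 0`, whose projection to
the sphere is `(newFrame ζ) ∂/∂ζ`. -/
def BMS.newVector (b : BMS) (X : Fin 4 → ℝ) : Fin 4 → ℂ :=
  let k := b.newFrame (zeta X)
  let d := fun a => pd Set.univ b.newTime a X
  ![-(k / 2 * (d 2 - I * d 3)) / d 0, 0, k / 2, -I * (k / 2)]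

/-- The asymptotic shear `σ⁰'` of the hypersurfaces `u' = const` of the transformed coordinate
system, evaluated at the point `(u, ζ)` of null infinity. The unphysical metric of the transformed
system is `K²` times the original one, so that it again induces the unit sphere metric
`dθ'² + sin² θ' dφ'²` on null infinity. -/
def SpaceTime.transformedShear (M : SpaceTime) (b : BMS) (u : ℝ) (z : ℂ) : ℂ :=
  shear (fun X => b.K (zeta X) ^ 2 • M.unphysicalMetric X) b.newCovector
    (b.newVector (pt u 0 z)) (pt u 0 z)

/-- As `u → -∞` the asymptotic shear of the transformed system tends to the smooth spin weight `2`
quantity `S'`, a function of the transformed coordinate `ζ'`. -/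
def SpaceTime.IsPastShear (M : SpaceTime) (b : BMS) (S' : ℂ → ℂ) : Prop :=
  IsSpinTwo S' ∧ ∀ z z' : ℂ, b.f z = z' →
    Filter.Tendsto (fun u => M.transformedShear b u z) Filter.atBot (𝓝 (S' z'))

/-- The condition `Sₑ = 0` at `u = -∞` in the coordinate system obtained by the BMS
transformation `b`. -/
def SpaceTime.ElectricFree (M : SpaceTime) (b : BMS) : Prop :=
  ∃ S', M.IsPastShear b S' ∧ IsElectricPart S' 0

/-! ## The Poincaré group -/

/-- The Minkowski metric. -/
def minkowski : Matrix (Fin 4) (Fin 4) ℝ := Matrix.diagonal ![1, -1, -1, -1]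

theorem minkowski_mul_self : minkowski * minkowski = 1 := by
  rw [minkowski, Matrix.diagonal_mul_diagonal, ← Matrix.diagonal_one]
  congr 1
  ext i
  fin_cases i <;> simp

theorem lorentz_left_inv {A : Matrix (Fin 4) (Fin 4) ℝ} (h : Aᵀ * minkowski * A = minkowski) :
    minkowski * Aᵀ * minkowski * A = 1 := by
  rw [Matrix.mul_assoc, Matrix.mul_assoc, ← Matrix.mul_assoc Aᵀ, h, minkowski_mul_self]

theorem lorentz_transpose {A : Matrix (Fin 4) (Fin 4) ℝ} (h : Aᵀ * minkowski * A = minkowski) :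
    A * minkowski * Aᵀ = minkowski := by
  have h1 := mul_eq_one_comm.mp (lorentz_left_inv h)
  calc A * minkowski * Aᵀ
      = A * (minkowski * Aᵀ * minkowski) * minkowski := by
        simp only [Matrix.mul_assoc, minkowski_mul_self, Matrix.mul_one]
    _ = minkowski := by rw [h1, Matrix.one_mul]

/-- The connected component `L₊↑` of the Lorentz group: the Lorentz matrices with determinant `1`
and positive time-time component. -/
def lorentzGroup : Subgroup (Matrix.SpecialLinearGroup (Fin 4) ℝ) where
  carrier := {Λ | (Λ : Matrix (Fin 4) (Fin 4) ℝ)ᵀ * minkowski * Λ = minkowski ∧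
    0 < (Λ : Matrix (Fin 4) (Fin 4) ℝ) 0 0}
  one_mem' := by simp
  mul_mem' := by
    rintro A B ⟨hA, hA0⟩ ⟨hB, hB0⟩
    refine ⟨?_, ?_⟩
    · rw [Matrix.SpecialLinearGroup.coe_mul, Matrix.transpose_mul]
      calc _ = (B : Matrix (Fin 4) (Fin 4) ℝ)ᵀ * ((A : Matrix (Fin 4) (Fin 4) ℝ)ᵀ * minkowski * A)
            * B := by simp only [Matrix.mul_assoc]
        _ = minkowski := by rw [hA, hB]
    · have h1 := congrFun (congrFun (lorentz_transpose hA) 0) 0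
      have h2 := congrFun (congrFun hB 0) 0
      simp [minkowski, Matrix.mul_apply, Fin.sum_univ_four, Matrix.diagonal] at h1 h2
      simp only [Matrix.SpecialLinearGroup.coe_mul, Matrix.mul_apply, Fin.sum_univ_four]
      generalize (A : Matrix (Fin 4) (Fin 4) ℝ) = A at *
      generalize (B : Matrix (Fin 4) (Fin 4) ℝ) = B at *
      set t := A 0 1 * B 1 0 + A 0 2 * B 2 0 + A 0 3 * B 3 0 with ht
      have hcs : t ^ 2 ≤ (A 0 0 ^ 2 - 1) * (B 0 0 ^ 2 - 1) := by
        have e1 : A 0 0 ^ 2 - 1 = A 0 1 ^ 2 + A 0 2 ^ 2 + A 0 3 ^ 2 := by linarith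
        have e2 : B 0 0 ^ 2 - 1 = B 1 0 ^ 2 + B 2 0 ^ 2 + B 3 0 ^ 2 := by linarith
        rw [e1, e2, ht]
        nlinarith [sq_nonneg (A 0 1 * B 2 0 - A 0 2 * B 1 0),
          sq_nonneg (A 0 1 * B 3 0 - A 0 3 * B 1 0), sq_nonneg (A 0 2 * B 3 0 - A 0 3 * B 2 0)]
      have hA1 : 1 ≤ A 0 0 ^ 2 := by nlinarith [sq_nonneg (A 0 1), sq_nonneg (A 0 2), sq_nonneg (A 0 3)]
      have hB1 : 1 ≤ B 0 0 ^ 2 := by nlinarith [sq_nonneg (B 1 0), sq_nonneg (B 2 0), sq_nonneg (B 3 0)]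
      have hlt : t ^ 2 < (A 0 0 * B 0 0) ^ 2 := by nlinarith
      have := abs_lt_of_sq_lt_sq hlt (mul_pos hA0 hB0).le
      have := (abs_lt.mp this).1
      linarith
  inv_mem' := by
    rintro A ⟨hA, hA0⟩
    have hinv : ((A⁻¹ : Matrix.SpecialLinearGroup (Fin 4) ℝ) : Matrix (Fin 4) (Fin 4) ℝ) =
        minkowski * (A : Matrix (Fin 4) (Fin 4) ℝ)ᵀ * minkowski := by
      have h := lorentz_left_inv hA
      have h' : (A : Matrix (Fin 4) (Fin 4) ℝ) *
          ((A⁻¹ : Matrix.SpecialLinearGroup (Fin 4) ℝ) : Matrix (Fin 4) (Fin 4) ℝ) = 1 := by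
        rw [← Matrix.SpecialLinearGroup.coe_mul, mul_inv_cancel, Matrix.SpecialLinearGroup.coe_one]
      exact (left_inv_eq_right_inv h h').symm
    have hm : minkowskiᵀ = minkowski := by simp [minkowski]
    refine ⟨?_, ?_⟩
    · rw [hinv]
      simp only [Matrix.transpose_mul, hm, Matrix.transpose_transpose]
      have := lorentz_transpose hA
      calc _ = minkowski * ((A : Matrix (Fin 4) (Fin 4) ℝ) * (minkowski * minkowski) * minkowski *
            (A : Matrix (Fin 4) (Fin 4) ℝ)ᵀ) * minkowski := by simp only [Matrix.mul_assoc]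
        _ = minkowski := by
          rw [minkowski_mul_self, Matrix.mul_one, this, minkowski_mul_self, Matrix.one_mul]
    · rw [hinv]
      simpa [minkowski, Matrix.mul_apply, Fin.sum_univ_four, Matrix.diagonal] using hA0

/-- The natural action of Lorentz transformations on translation vectors. -/
def lorentzAction : lorentzGroup →* MulAut (Multiplicative (Fin 4 → ℝ)) where
  toFun Λ := AddEquiv.toMultiplicative
    (Matrix.SpecialLinearGroup.toLin' (Λ : Matrix.SpecialLinearGroup (Fin 4) ℝ)).toAddEquiv
  map_one' := by ext; simp
  map_mul' A B := by ext; simp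

/-- The Poincaré group `ℝ⁴ ⋊ L₊↑`. -/
abbrev PoincareGroup : Type := Multiplicative (Fin 4 → ℝ) ⋊[lorentzAction] lorentzGroup

end BondiSachs

end

/-! Everything rests on the operator `ð²` acting on conformal densities of weight 1 on the sphere.
It has three properties. Its kernel consists of the spherical harmonics of degree at most one
(`exists_sesq_of_ethSq_eq_zero`): if `ð² ξ = 0`, then `P² ∂ξ/∂ζ` is antiholomorphic of quadratic
growth, hence a quadratic polynomial in `ζ̄`. It maps onto the smooth quantities of spin weight 2
(`IsSpinTwo.exists_ethSq_eq`), by two applications of the Cauchy transform. It is covariant under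
Möbius transformations (`ethSq_pullback`), and every orientation preserving conformal diffeomorphism
is one of these (`IsConformal.exists_mobius`).

Transformation law. On null infinity the unphysical metric has universal boundary values, and only
the `ℓ`-derivative of `h_{AB}` distinguishes space-times. In the shear of the cut `u' = const`, the
terms proportional to `u + α` multiply `ð²(1/K)`. This vanishes because `1/K` is a Hermitian form in
`(1, ζ)` divided by `1 + ζζ̄`, so a harmonic of degree at most one. The terms free of `u` give `σ⁰ +
½ ð² α`, and the frame contributes the phase.

Past limit. Write `S = ð² ξ`. In the system of a BMS transformation the limit of the shear is `ð²`
of the pull-back of `ξ + α/2` under `f⁻¹`. Pull-back divides by a real factor and preserves the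
kernel, so the electric part vanishes exactly when `Re ξ + α/2` is a translation
(`SpaceTime.electricFree_iff`). The choice `α = -2 Re ξ` therefore works. In `b ∘ b₀` the
supertranslation part is `α₀ + (α ∘ f₀)/K₀`, so `b` preserves the condition exactly when `(α ∘
f₀)/K₀`, equivalently `α`, is a translation.

Poincaré group. A translation is `p ↦ ⟨v, n(p)⟩` with `n(p)` the null vector in the direction `p`,
and `n(f p) = K(p) Λ n(p)` for the Lorentz transformation `Λ` of `f`. Hence `ℝ⁴ ⋊ SL(2, ℂ)` acts on
null infinity with exactly the required image. The kernel of this action is also the kernel of the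
surjection onto `ℝ⁴ ⋊ L₊↑`, so image and Poincaré group are the same quotient. -/

namespace BondiSachs

/-! ## Calculus of `∂/∂ζ` -/

/-- `η` is real differentiable at `z` and `∂η/∂ζ = η'` there. -/
def HasDz (η : ℂ → ℂ) (η' : ℂ) (z : ℂ) : Prop :=
  DifferentiableAt ℝ η z ∧ dzeta η z = η'

theorem hasDz_dzeta {η : ℂ → ℂ} {z : ℂ} (h : DifferentiableAt ℝ η z) : HasDz η (dzeta η z) z :=
  ⟨h, rfl⟩

theorem dzeta_congr {η θ : ℂ → ℂ} {z : ℂ} (h : η =ᶠ[𝓝 z] θ) : dzeta η z = dzeta θ z := by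
  simp only [dzeta, h.fderiv_eq]

theorem HasDz.congr {η θ : ℂ → ℂ} {η' z : ℂ} (h : HasDz η η' z) (e : θ =ᶠ[𝓝 z] η) :
    HasDz θ η' z :=
  ⟨h.1.congr_of_eventuallyEq e, (dzeta_congr e).trans h.2⟩

theorem HasDz.congr_deriv {η : ℂ → ℂ} {η' η'' z : ℂ} (h : HasDz η η' z) (e : η' = η'') :
    HasDz η η'' z := e ▸ h

theorem hasDz_const (c z : ℂ) : HasDz (fun _ => c) 0 z :=
  ⟨differentiableAt_const c, by simp [dzeta]⟩

theorem HasDz.add {η θ : ℂ → ℂ} {η' θ' z : ℂ} (h : HasDz η η' z) (k : HasDz θ θ' z) :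
    HasDz (fun y => η y + θ y) (η' + θ') z := by
  refine ⟨h.1.add k.1, ?_⟩
  rw [← h.2, ← k.2]
  simp only [dzeta, fderiv_fun_add h.1 k.1, _root_.add_apply]
  ring

theorem HasDz.sub {η θ : ℂ → ℂ} {η' θ' z : ℂ} (h : HasDz η η' z) (k : HasDz θ θ' z) :
    HasDz (fun y => η y - θ y) (η' - θ') z := by
  refine ⟨h.1.sub k.1, ?_⟩
  rw [← h.2, ← k.2]
  simp only [dzeta, fderiv_fun_sub h.1 k.1, _root_.sub_apply]
  ring

theorem HasDz.mul {η θ : ℂ → ℂ} {η' θ' z : ℂ} (h : HasDz η η' z) (k : HasDz θ θ' z) :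
    HasDz (fun y => η y * θ y) (η' * θ z + η z * θ') z := by
  refine ⟨h.1.mul k.1, ?_⟩
  rw [← h.2, ← k.2]
  simp only [dzeta, fderiv_fun_mul h.1 k.1, _root_.add_apply,
    _root_.smul_apply, smul_eq_mul]
  ring

theorem HasDz.const_mul {η : ℂ → ℂ} {η' z : ℂ} (c : ℂ) (h : HasDz η η' z) :
    HasDz (fun y => c * η y) (c * η') z :=
  ((hasDz_const c z).mul h).congr_deriv (by ring)

/-- The chain rule for `∂/∂ζ` has a second term, `∂η/∂ζ̄` times `∂h̄/∂ζ`; it vanishes because `h` is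
holomorphic. -/
theorem HasDz.comp_holomorphic {η h : ℂ → ℂ} {η' h' z : ℂ} (k : HasDz η η' (h z))
    (hh : HasDerivAt h h' z) : HasDz (fun y => η (h y)) (η' * h') z := by
  have hr := hh.hasFDerivAt.restrictScalars ℝ
  have hc := k.1.hasFDerivAt.comp z hr
  refine ⟨hc.differentiableAt, ?_⟩
  rw [← k.2]
  have e : fderiv ℝ (fun y => η (h y)) z = _ := hc.fderiv
  simp only [dzeta, e]
  have key : ∀ v : ℂ, fderiv ℝ η (h z) v =
      v.re * fderiv ℝ η (h z) 1 + v.im * fderiv ℝ η (h z) I := by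
    intro v
    have : v = v.re • (1 : ℂ) + v.im • I := by simp [Complex.re_add_im]
    conv_lhs => rw [this, map_add, map_smul, map_smul]
    simp
  have e1 : ∀ w : ℂ, ((fderiv ℝ η (h z)).comp
      (ContinuousLinearMap.restrictScalars ℝ (ContinuousLinearMap.toSpanSingleton ℂ h'))) w =
      fderiv ℝ η (h z) (w * h') := by intro w; simp
  rw [e1, e1, key (1 * h'), key (I * h')]
  have hi : (h' : ℂ) = h'.re + h'.im * I := (Complex.re_add_im h').symm
  simp
  linear_combination (h'.im * fderiv ℝ η (h z) I / 2) * Complex.I_mul_I -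
    ((fderiv ℝ η (h z) 1 - I * fderiv ℝ η (h z) I) / 2) * hi

theorem hasDz_id (z : ℂ) : HasDz (fun y => y) 1 z := by
  refine ⟨differentiableAt_id, ?_⟩
  have := Complex.I_mul_I
  simp [dzeta]

theorem hasDz_holomorphic {h : ℂ → ℂ} {h' z : ℂ} (hh : HasDerivAt h h' z) : HasDz h h' z :=
  ((hasDz_id (h z)).comp_holomorphic hh).congr_deriv (one_mul _)

theorem hasDz_conj (z : ℂ) : HasDz (fun y => (starRingEnd ℂ) y) 0 z := by
  refine ⟨Complex.conjCLE.differentiableAt, ?_⟩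
  have : fderiv ℝ (fun y => (starRingEnd ℂ) y) z = (Complex.conjCLE : ℂ →L[ℝ] ℂ) :=
    Complex.conjCLE.hasFDerivAt.fderiv
  simp [dzeta, this]

theorem hasDz_conj_holomorphic {h : ℂ → ℂ} {h' z : ℂ} (hh : HasDerivAt h h' z) :
    HasDz (fun y => (starRingEnd ℂ) (h y)) 0 z :=
  ((hasDz_conj (h z)).comp_holomorphic hh).congr_deriv (zero_mul _)

theorem HasDz.inv {η : ℂ → ℂ} {η' z : ℂ} (h : HasDz η η' z) (h0 : η z ≠ 0) :
    HasDz (fun y => (η y)⁻¹) (-η' / η z ^ 2) z := by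
  have hi : HasFDerivAt (fun y => (η y)⁻¹) _ z :=
    ((hasDerivAt_inv h0).hasFDerivAt.restrictScalars ℝ).comp z h.1.hasFDerivAt
  refine ⟨hi.differentiableAt, ?_⟩
  rw [← h.2]
  simp only [dzeta, hi.fderiv]
  simp
  field_simp
  ring

theorem HasDz.div {η θ : ℂ → ℂ} {η' θ' z : ℂ} (h : HasDz η η' z) (k : HasDz θ θ' z)
    (h0 : θ z ≠ 0) :
    HasDz (fun y => η y / θ y) ((η' * θ z - η z * θ') / θ z ^ 2) z := by
  simp only [div_eq_mul_inv]
  refine (h.mul (k.inv h0)).congr_deriv ?_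
  field_simp
  ring

theorem HasDz.pow {η : ℂ → ℂ} {η' z : ℂ} (h : HasDz η η' z) :
    HasDz (fun y => η y ^ 2) (2 * η z * η') z := by
  simp only [pow_two]
  exact (h.mul h).congr_deriv (by ring)

/-! ### The function `P` -/

theorem one_add_mul_conj_ne_zero (z : ℂ) : 1 + z * (starRingEnd ℂ) z ≠ 0 := by
  rw [Complex.mul_conj]
  norm_cast
  have := Complex.normSq_nonneg z
  positivity

theorem P_eq (z : ℂ) : (P z : ℂ) = (1 + z * (starRingEnd ℂ) z) / 2 := by
  rw [P, Complex.mul_conj, Complex.normSq_eq_norm_sq]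
  push_cast
  rfl

theorem P_pos (z : ℂ) : 0 < P z := by
  unfold P; positivity

theorem hasDz_one_add_mul_conj (z : ℂ) :
    HasDz (fun y => 1 + y * (starRingEnd ℂ) y) ((starRingEnd ℂ) z) z :=
  ((hasDz_const 1 z).add ((hasDz_id z).mul (hasDz_conj z))).congr_deriv (by ring)

theorem hasDz_P (z : ℂ) : HasDz (fun y => (P y : ℂ)) ((starRingEnd ℂ) z / 2) z := by
  simp only [P_eq]
  exact ((hasDz_one_add_mul_conj z).div (hasDz_const 2 z) two_ne_zero).congr_deriv (by ring)

theorem contDiff_P : ContDiff ℝ ∞ (fun y => (P y : ℂ)) := by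
  simp only [P_eq]
  exact (contDiff_const.add (contDiff_id.mul Complex.conjCLE.contDiff)).div_const 2

theorem ContDiffAt.dzeta {η : ℂ → ℂ} {z : ℂ} (h : ContDiffAt ℝ ∞ η z) :
    ContDiffAt ℝ ∞ (BondiSachs.dzeta η) z := by
  have h1 : ContDiffAt ℝ ∞ (fderiv ℝ η) z := h.fderiv_right (by simp)
  unfold BondiSachs.dzeta
  exact ((h1.clm_apply contDiffAt_const).sub
    (contDiffAt_const.mul (h1.clm_apply contDiffAt_const))).div_const _

theorem ContDiff.dzeta {η : ℂ → ℂ} (h : ContDiff ℝ ∞ η) : ContDiff ℝ ∞ (BondiSachs.dzeta η) :=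
  contDiff_iff_contDiffAt.2 fun _ => ContDiffAt.dzeta h.contDiffAt

/-! ### `ð²` in coordinates and its conformal covariance -/

/-- The operator `ð²` on functions of `ζ`. -/
noncomputable def edthTwo (η : ℂ → ℂ) (z : ℂ) : ℂ :=
  4 * dzeta (fun y => (P y : ℂ) ^ 2 * dzeta η y) z

/-- Differentiability is not needed: for `c ≠ 0` the functions `η` and `c η` are differentiable
together, and otherwise both derivatives have the default value `0`. -/
theorem dzeta_const_mul (c : ℂ) (η : ℂ → ℂ) (z : ℂ) :
    dzeta (fun y => c * η y) z = c * dzeta η z := by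
  by_cases hc : c = 0
  · subst hc
    simpa using (hasDz_const 0 z).2
  · by_cases h : DifferentiableAt ℝ η z
    · exact ((hasDz_dzeta h).const_mul c).2
    · have h' : ¬ DifferentiableAt ℝ (fun y => c * η y) z := by
        intro h'
        apply h
        have := h'.const_mul c⁻¹
        simpa [hc] using this
      simp [dzeta, fderiv_zero_of_not_differentiableAt h, fderiv_zero_of_not_differentiableAt h']

theorem ethSq_eq_edthTwo (ξ : OnePoint ℂ → ℂ) : ethSq ξ = edthTwo fun z => ξ (z : OnePoint ℂ) := by
  funext z
  simp only [ethSq, eth, edthTwo]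
  norm_num
  have : ∀ y : ℂ, (P y : ℂ) * (2 * (P y : ℂ) * dzeta (fun x : ℂ => ξ x) y) =
      2 * ((P y : ℂ) ^ 2 * dzeta (fun x : ℂ => ξ x) y) := fun y => by ring
  simp only [this, dzeta_const_mul]
  ring

theorem edthTwo_congr {η θ : ℂ → ℂ} {z : ℂ} (h : η =ᶠ[𝓝 z] θ) : edthTwo η z = edthTwo θ z := by
  unfold edthTwo
  congr 1
  apply dzeta_congr
  filter_upwards [h.eventuallyEq_nhds] with y hy
  rw [dzeta_congr hy]

theorem edthTwo_eq {η θ : ℂ → ℂ} {θ' z : ℂ} (h : ∀ᶠ y in 𝓝 z, HasDz η (θ y) y)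
    (h' : HasDz (fun y => (P y : ℂ) ^ 2 * θ y) θ' z) : edthTwo η z = 4 * θ' := by
  unfold edthTwo
  rw [← h'.2]
  congr 1
  apply dzeta_congr
  filter_upwards [h] with y hy
  rw [hy.2]

theorem edthTwo_expand {η : ℂ → ℂ} {z : ℂ} (h : ContDiffAt ℝ ∞ η z) :
    edthTwo η z = 4 * ((P z : ℂ) * (starRingEnd ℂ) z * dzeta η z +
      (P z : ℂ) ^ 2 * dzeta (dzeta η) z) := by
  have h1 := hasDz_dzeta ((ContDiffAt.dzeta h).differentiableAt (by simp))
  unfold edthTwo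
  rw [((hasDz_P z).pow.mul h1).2]
  ring

theorem edthTwo_add {η θ : ℂ → ℂ} {z : ℂ} (h : ContDiff ℝ ∞ η) (k : ContDiff ℝ ∞ θ) :
    edthTwo (fun y => η y + θ y) z = edthTwo η z + edthTwo θ z := by
  have a := fun y => hasDz_dzeta (h.differentiable (by simp) y)
  have b := fun y => hasDz_dzeta (k.differentiable (by simp) y)
  have a' := fun y => hasDz_dzeta ((ContDiff.dzeta h).differentiable (by simp) y)
  have b' := fun y => hasDz_dzeta ((ContDiff.dzeta k).differentiable (by simp) y)
  rw [edthTwo_eq (.of_forall fun y => (a y).add (b y))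
    ((hasDz_P z).pow.mul ((a' z).add (b' z))), edthTwo_expand h.contDiffAt,
    edthTwo_expand k.contDiffAt]
  ring

theorem edthTwo_const_mul (c : ℂ) (η : ℂ → ℂ) (z : ℂ) :
    edthTwo (fun y => c * η y) z = c * edthTwo η z := by
  unfold edthTwo
  simp only [dzeta_const_mul]
  have : ∀ y : ℂ, (P y : ℂ) ^ 2 * (c * dzeta η y) = c * ((P y : ℂ) ^ 2 * dzeta η y) :=
    fun y => by ring
  simp only [this, dzeta_const_mul]
  ring

theorem contDiffAt_edthTwo {η : ℂ → ℂ} {z : ℂ} (h : ContDiffAt ℝ ∞ η z) :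
    ContDiffAt ℝ ∞ (edthTwo η) z := by
  unfold edthTwo
  exact contDiffAt_const.mul (ContDiffAt.dzeta
    ((contDiff_P.contDiffAt.pow 2).mul (ContDiffAt.dzeta h)))

/-- Conformal covariance of `ð²` under a Möbius transformation. -/
theorem edthTwo_mobius {a b c d : ℂ} (hdet : a * d - b * c = 1) {η : ℂ → ℂ} {z : ℂ}
    (hq : c * z + d ≠ 0) (hη : ContDiffAt ℝ ∞ η ((a * z + b) / (c * z + d))) :
    (((a * z + b) * (starRingEnd ℂ) (a * z + b) + (c * z + d) * (starRingEnd ℂ) (c * z + d)) /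
        (1 + z * (starRingEnd ℂ) z)) * ((c * z + d) / (starRingEnd ℂ) (c * z + d)) ^ 2 *
      edthTwo (fun y => ((a * y + b) * (starRingEnd ℂ) (a * y + b) +
        (c * y + d) * (starRingEnd ℂ) (c * y + d)) / (1 + y * (starRingEnd ℂ) y) *
          η ((a * y + b) / (c * y + d))) z =
      edthTwo η ((a * z + b) / (c * z + d)) := by
  set κ := starRingEnd ℂ with hκ
  have hA : ∀ y, HasDerivAt (fun y : ℂ => a * y + b) a y := fun y => by
    simpa using ((hasDerivAt_id y).const_mul a).add_const b
  have hQ : ∀ y, HasDerivAt (fun y : ℂ => c * y + d) c y := fun y => by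
    simpa using ((hasDerivAt_id y).const_mul c).add_const d
  have hh : ∀ y, c * y + d ≠ 0 →
      HasDerivAt (fun y : ℂ => (a * y + b) / (c * y + d)) (1 / (c * y + d) ^ 2) y := by
    intro y hy
    refine ((hA y).div (hQ y) hy).congr_deriv ?_
    rw [← hdet]
    ring
  have hN : ∀ y, HasDz (fun y => (a * y + b) * κ (a * y + b) + (c * y + d) * κ (c * y + d))
      (a * κ (a * y + b) + c * κ (c * y + d)) y := fun y =>
    (((hasDz_holomorphic (hA y)).mul (hasDz_conj_holomorphic (hA y))).add
      ((hasDz_holomorphic (hQ y)).mul (hasDz_conj_holomorphic (hQ y)))).congr_deriv (by ring)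
  have hq' : ∀ᶠ y in 𝓝 z, c * y + d ≠ 0 :=
    (hQ z).continuousAt.eventually_ne hq
  have hη' : ∀ᶠ y in 𝓝 z, DifferentiableAt ℝ η ((a * y + b) / (c * y + d)) := by
    have : ∀ᶠ y in 𝓝 ((a * z + b) / (c * z + d)), ContDiffAt ℝ 1 η y :=
      (hη.of_le (by simp)).eventually (by simp)
    filter_upwards [(hh z hq).continuousAt.eventually this] with y hy
    exact hy.differentiableAt (by simp)
  have h1 : ∀ᶠ y in 𝓝 z, HasDz (fun y => ((a * y + b) * κ (a * y + b) +
        (c * y + d) * κ (c * y + d)) / (1 + y * κ y) * η ((a * y + b) / (c * y + d)))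
        (((a * κ (a * y + b) + c * κ (c * y + d)) * (1 + y * κ y) - ((a * y + b) * κ (a * y + b) +
          (c * y + d) * κ (c * y + d)) * κ y) / (1 + y * κ y) ^ 2 * η ((a * y + b) / (c * y + d)) +
          ((a * y + b) * κ (a * y + b) + (c * y + d) * κ (c * y + d)) / (1 + y * κ y) *
          (dzeta η ((a * y + b) / (c * y + d)) * (1 / (c * y + d) ^ 2))) y := by
    filter_upwards [hq', hη'] with y hy1 hy2
    exact ((hN y).div (hasDz_one_add_mul_conj y) (one_add_mul_conj_ne_zero y)).mul
      (HasDz.comp_holomorphic (h := fun y : ℂ => (a * y + b) / (c * y + d)) (hasDz_dzeta hy2)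
        (hh y hy1))
  -- Multiplication by `P²` cancels the denominator `(1 + yȳ)²`. The coefficient of `η` becomes
  -- antiholomorphic in `y`, so its own derivative vanishes and `η` itself drops out.
  have h2 : HasDz (fun y => ((a - b * κ y) * κ (a * y + b) + (c - d * κ y) * κ (c * y + d)) / 4 *
      η ((a * y + b) / (c * y + d)) + (1 + y * κ y) * ((a * y + b) * κ (a * y + b) +
        (c * y + d) * κ (c * y + d)) / 4 * (dzeta η ((a * y + b) / (c * y + d)) *
          (1 / (c * y + d) ^ 2))) _ z :=
    ((((((hasDz_const a z).sub ((hasDz_conj z).const_mul b)).mul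
      (hasDz_conj_holomorphic (hA z))).add
      (((hasDz_const c z).sub ((hasDz_conj z).const_mul d)).mul
      (hasDz_conj_holomorphic (hQ z)))).div (hasDz_const 4 z) (by norm_num)).mul
      (HasDz.comp_holomorphic (h := fun y : ℂ => (a * y + b) / (c * y + d))
        (hasDz_dzeta hη'.self_of_nhds) (hh z hq))).add
    ((((hasDz_one_add_mul_conj z).mul (hN z)).div (hasDz_const 4 z) (by norm_num)).mul
      ((HasDz.comp_holomorphic (h := fun y : ℂ => (a * y + b) / (c * y + d))
        (hasDz_dzeta ((ContDiffAt.dzeta hη).differentiableAt (by simp))) (hh z hq)).mul ((hasDz_const 1 z).div (hasDz_holomorphic (hQ z)).pow (pow_ne_zero 2 hq))))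
  rw [edthTwo_eq h1 (h2.congr ?_), edthTwo_expand hη, P_eq]
  · have hq2 : κ (c * z + d) ≠ 0 := (map_ne_zero _).2 hq
    have h0 := one_add_mul_conj_ne_zero z
    rw [← hκ] at h0 ⊢
    rw [map_div₀]
    generalize dzeta (dzeta η) ((a * z + b) / (c * z + d)) = η₂
    generalize dzeta η ((a * z + b) / (c * z + d)) = η₁
    generalize η ((a * z + b) / (c * z + d)) = η₀
    generalize κ (a * z + b) = A' at *
    generalize κ (c * z + d) = Q' at *
    generalize κ z = z' at *
    -- With `A = az + b` and `Q = cz + d` as variables in place of `b` and `d`, the determinant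
    -- condition becomes `aQ - Ac = 1`.
    obtain ⟨A, hA⟩ : ∃ A, a * z + b = A := ⟨_, rfl⟩
    obtain ⟨Q, hQ⟩ : ∃ Q, c * z + d = Q := ⟨_, rfl⟩
    obtain rfl : b = A - a * z := by rw [← hA]; ring
    obtain rfl : d = Q - c * z := by rw [← hQ]; ring
    rw [hQ] at hq
    simp only [hA, hQ]
    clear * - h0 hq hq2 hdet
    have e : a * Q - A * c = 1 := by rw [← hdet]; ring
    linear_combination (norm := (field_simp; ring)) (2 * A' * (A * A' + Q * Q') / (Q * Q' ^ 2) * η₁) * e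
  · filter_upwards [hq'] with y hy
    have h0 := one_add_mul_conj_ne_zero y
    rw [← hκ] at h0
    rw [P_eq, ← hκ]
    field_simp
    ring

/-! ## Functions spanned by the spherical harmonics of degree at most one -/

@[simp] theorem chart_false (z : ℂ) : chart false z = (z : OnePoint ℂ) := rfl

@[simp] theorem chart_true_zero : chart true 0 = OnePoint.infty := by simp [chart]

theorem chart_true_of_ne {w : ℂ} (hw : w ≠ 0) : chart true w = ((w⁻¹ : ℂ) : OnePoint ℂ) := by
  simp [chart, hw]

theorem SmoothOnSphere.coe {E : Type*} [NormedAddCommGroup E] [NormedSpace ℝ E]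
    {α : OnePoint ℂ → E} (h : SmoothOnSphere α) : ContDiff ℝ ∞ fun z : ℂ => α z := h false

/-- The functions on the sphere that are given by sesquilinear forms in `(1, ζ)`, divided by
`1 + ζ ζ̄`. -/
noncomputable def sesq (a b c d : ℂ) (p : OnePoint ℂ) : ℂ :=
  p.elim d fun z => (a + b * z + c * (starRingEnd ℂ) z + d * (z * (starRingEnd ℂ) z)) /
    (1 + z * (starRingEnd ℂ) z)

theorem sesq_coe (a b c d z : ℂ) : sesq a b c d (z : OnePoint ℂ) =
    (a + b * z + c * (starRingEnd ℂ) z + d * (z * (starRingEnd ℂ) z)) /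
    (1 + z * (starRingEnd ℂ) z) := rfl

@[simp] theorem sesq_infty (a b c d : ℂ) : sesq a b c d OnePoint.infty = d := rfl

/-- Inversion exchanges the entries of `(1, ζ)` up to scale, which reverses the list of
coefficients. Smoothness at `∞` thus reduces to smoothness in the finite chart. -/
theorem sesq_chart_true (a b c d w : ℂ) :
    sesq a b c d (chart true w) = sesq d c b a (w : OnePoint ℂ) := by
  by_cases hw : w = 0
  · subst hw
    simp [sesq_coe]
  · rw [chart_true_of_ne hw, sesq_coe, sesq_coe, map_inv₀]
    have h0 := one_add_mul_conj_ne_zero w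
    have h1 := one_add_mul_conj_ne_zero w⁻¹
    rw [map_inv₀] at h1
    have hw' : (starRingEnd ℂ) w ≠ 0 := (map_ne_zero _).2 hw
    have h2 : 1 + w⁻¹ * ((starRingEnd ℂ) w)⁻¹ =
      (1 + w * (starRingEnd ℂ) w) / (w * (starRingEnd ℂ) w) := by
      field_simp
      ring
    rw [h2]
    field_simp
    ring

theorem smoothOnSphere_sesq (a b c d : ℂ) : SmoothOnSphere (sesq a b c d) := by
  have key : ∀ a b c d : ℂ, ContDiff ℝ ∞ fun z : ℂ => sesq a b c d (z : OnePoint ℂ) := by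
    intro a b c d
    simp only [sesq_coe]
    have hc : ContDiff ℝ ∞ (fun z : ℂ => (starRingEnd ℂ) z) := Complex.conjCLE.contDiff
    simp only [div_eq_mul_inv]
    refine ContDiff.mul ?_ ((contDiff_const.add (contDiff_id.mul hc)).inv one_add_mul_conj_ne_zero)
    exact ((contDiff_const.add (contDiff_const.mul contDiff_id)).add (contDiff_const.mul hc)).add
      (contDiff_const.mul (contDiff_id.mul hc))
  rintro (_ | _)
  · exact key a b c d
  · simp only [sesq_chart_true]
    exact key d c b a

theorem hasDz_sesq (a b c d z : ℂ) : HasDz (fun z : ℂ => sesq a b c d z)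
    ((b + (d - a) * (starRingEnd ℂ) z - c * (starRingEnd ℂ) z ^ 2) /
      (1 + z * (starRingEnd ℂ) z) ^ 2) z := by
  simp only [sesq_coe]
  refine (HasDz.div (((HasDz.add (hasDz_const a z) ((hasDz_id z).const_mul b)).add
    ((hasDz_conj z).const_mul c)).add (((hasDz_id z).mul (hasDz_conj z)).const_mul d))
    (hasDz_one_add_mul_conj z) (one_add_mul_conj_ne_zero z)).congr_deriv ?_
  ring

theorem hasDz_conj_quadratic (a b c z : ℂ) :
    HasDz (fun z => a + b * (starRingEnd ℂ) z + c * (starRingEnd ℂ) z ^ 2) 0 z :=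
  (((hasDz_const a z).add ((hasDz_conj z).const_mul b)).add
    ((hasDz_conj z).pow.const_mul c)).congr_deriv (by ring)

/-- The factor `P²` cancels the denominator of the first derivative and leaves a quadratic
polynomial in `ζ̄`, which `∂/∂ζ` annihilates. -/
theorem ethSq_sesq (a b c d z : ℂ) : ethSq (sesq a b c d) z = 0 := by
  rw [ethSq_eq_edthTwo, edthTwo_eq (.of_forall (hasDz_sesq a b c d))
    ((hasDz_conj_quadratic (b / 4) ((d - a) / 4) (-c / 4) z).congr (.of_forall fun y => ?_)),
    mul_zero]
  have := one_add_mul_conj_ne_zero y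
  simp only [P_eq]
  field_simp
  ring

theorem ofReal_direction_sum (ε₀ : ℝ) (ε : Fin 3 → ℝ) (p : OnePoint ℂ) :
    ((ε₀ + ∑ i, ε i * direction p i : ℝ) : ℂ) =
      sesq (ε₀ - ε 2) (ε 0 - ε 1 * I) (ε 0 + ε 1 * I) (ε₀ + ε 2) p := by
  induction p using OnePoint.rec with
  | infty => simp [direction, Fin.sum_univ_three]
  | coe z =>
    rw [sesq_coe]
    have h0 := one_add_mul_conj_ne_zero z
    have h1 : (1 + ‖z‖ ^ 2 : ℝ) ≠ 0 := by positivity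
    have h2 : ((1 + ‖z‖ ^ 2 : ℝ) : ℂ) = 1 + z * (starRingEnd ℂ) z := by
      rw [Complex.mul_conj, Complex.normSq_eq_norm_sq]; push_cast; rfl
    have h3 : ((‖z‖ ^ 2 - 1 : ℝ) : ℂ) = z * (starRingEnd ℂ) z - 1 := by
      rw [Complex.mul_conj, Complex.normSq_eq_norm_sq]; push_cast; rfl
    have h4 : (z.re : ℂ) = (z + (starRingEnd ℂ) z) / 2 := by
      rw [Complex.add_conj]; push_cast; ring
    have h5 : (z.im : ℂ) = -I * (z - (starRingEnd ℂ) z) / 2 := by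
      rw [Complex.sub_conj]; push_cast
      linear_combination (z.im : ℂ) * Complex.I_mul_I
    have hd : direction (z : OnePoint ℂ) = ![2 * z.re / (1 + ‖z‖ ^ 2), 2 * z.im / (1 + ‖z‖ ^ 2),
      (‖z‖ ^ 2 - 1) / (1 + ‖z‖ ^ 2)] := rfl
    rw [hd]
    simp only [Fin.sum_univ_three, Matrix.cons_val_zero, Matrix.cons_val_one, Matrix.cons_val]
    rw [Complex.ofReal_add, Complex.ofReal_add, Complex.ofReal_add, Complex.ofReal_mul,
      Complex.ofReal_mul, Complex.ofReal_mul, Complex.ofReal_div, Complex.ofReal_div,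
      Complex.ofReal_div, h2, h3, Complex.ofReal_mul, Complex.ofReal_mul, h4, h5]
    push_cast
    field_simp
    ring

theorem IsTranslation.exists_sesq {α : OnePoint ℂ → ℝ} (h : IsTranslation α) :
    ∃ a b c d, ∀ p, (α p : ℂ) = sesq a b c d p := by
  obtain ⟨ε₀, ε, h⟩ := h
  exact ⟨_, _, _, _, fun p => by rw [h, ofReal_direction_sum]⟩

theorem isTranslation_re_sesq (a b c d : ℂ) : IsTranslation fun p => (sesq a b c d p).re := by
  refine ⟨(a.re + d.re) / 2, ![(b.re + c.re) / 2, (c.im - b.im) / 2, (d.re - a.re) / 2],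
    fun p => ?_⟩
  apply Complex.ofReal_injective
  rw [ofReal_direction_sum]
  have hre : ∀ x : ℂ, (x.re : ℂ) = (x + (starRingEnd ℂ) x) / 2 := fun x => by
    rw [Complex.add_conj]; push_cast; ring
  have him : ∀ x : ℂ, (x.im : ℂ) = -I * (x - (starRingEnd ℂ) x) / 2 := fun x => by
    rw [Complex.sub_conj]; push_cast
    linear_combination (x.im : ℂ) * Complex.I_mul_I
  induction p using OnePoint.rec with
  | infty => simp; ring
  | coe z =>
    have h0 := one_add_mul_conj_ne_zero z
    rw [hre, sesq_coe, sesq_coe, map_div₀]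
    simp only [map_add, map_mul, map_one, Complex.conj_conj, Matrix.cons_val_zero,
      Matrix.cons_val_one, Matrix.cons_val]
    push_cast
    rw [hre, hre, hre, hre, him, him, mul_comm ((starRingEnd ℂ) z) z]
    field_simp
    linear_combination (norm := ring_nf) (0 : ℂ) * Complex.I_sq
    simp only [Complex.I_sq]
    ring

theorem IsTranslation.smooth {α : OnePoint ℂ → ℝ} (h : IsTranslation α) : SmoothOnSphere α := by
  obtain ⟨a, b, c, d, h⟩ := h.exists_sesq
  intro i
  have : (fun z => α (chart i z)) = fun z => (sesq a b c d (chart i z)).re := by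
    funext z; rw [← h, Complex.ofReal_re]
  rw [this]
  exact Complex.reCLM.contDiff.comp (smoothOnSphere_sesq a b c d i)

theorem IsTranslation.ethSq_eq_zero {α : OnePoint ℂ → ℝ} (h : IsTranslation α) (z : ℂ) :
    ethSq (fun p => (α p : ℂ)) z = 0 := by
  obtain ⟨a, b, c, d, h⟩ := h.exists_sesq
  rw [show (fun p => (α p : ℂ)) = sesq a b c d from funext h, ethSq_sesq]

/-! ## The kernel of `ð²` -/

/-- The closed unit discs of the two charts are compact and cover the sphere. -/
theorem SmoothOnSphere.bounded {E : Type*} [NormedAddCommGroup E] [NormedSpace ℝ E]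
    {α : OnePoint ℂ → E} (h : SmoothOnSphere α) : ∃ C, ∀ p, ‖α p‖ ≤ C := by
  have hc : ∀ i, ∃ C, ∀ z ∈ Metric.closedBall (0 : ℂ) 1, ‖α (chart i z)‖ ≤ C := fun i =>
    (isCompact_closedBall (0 : ℂ) 1).exists_bound_of_continuousOn (h i).continuous.continuousOn
  obtain ⟨C₁, h₁⟩ := hc false
  obtain ⟨C₂, h₂⟩ := hc true
  refine ⟨max C₁ C₂, fun p => ?_⟩
  induction p using OnePoint.rec with
  | infty =>
    have := h₂ 0 (by simp)
    rw [chart_true_zero] at this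
    exact this.trans (le_max_right _ _)
  | coe z =>
    rcases le_total ‖z‖ 1 with hz | hz
    · exact (h₁ z (by simpa using hz)).trans (le_max_left _ _)
    · have hz0 : z ≠ 0 := by rintro rfl; norm_num at hz
      have := h₂ z⁻¹ (by simpa using inv_le_one_of_one_le₀ hz)
      rw [chart_true_of_ne (inv_ne_zero hz0), inv_inv] at this
      exact this.trans (le_max_right _ _)

/-- An entire function of polynomial growth is a polynomial. -/
theorem exists_polynomial_of_growth (n : ℕ) : ∀ {F : ℂ → ℂ}, Differentiable ℂ F → ∀ {C : ℝ},
    (∀ z, 1 ≤ ‖z‖ → ‖F z‖ ≤ C * ‖z‖ ^ n) →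
    ∃ p : Polynomial ℂ, p.natDegree ≤ n ∧ ∀ z, F z = p.eval z := by
  induction n with
  | zero =>
    intro F hF C hC
    obtain ⟨D, hD⟩ := (isCompact_closedBall (0 : ℂ) 1).exists_bound_of_continuousOn
      hF.continuous.continuousOn
    obtain ⟨c, hc⟩ := hF.exists_const_forall_eq_of_bounded (isBounded_iff_forall_norm_le.2
      ⟨max C D, by
        rintro _ ⟨z, rfl⟩
        rcases le_total ‖z‖ 1 with hz | hz
        · exact (hD z (by simpa using hz)).trans (le_max_right _ _)
        · exact (by simpa using hC z hz : ‖F z‖ ≤ C).trans (le_max_left _ _)⟩)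
    exact ⟨.C c, by simp, by simpa using hc⟩
  | succ n ih =>
    intro F hF C hC
    -- The quotient `(F z - F 0) / z`, with its removable singularity filled in by `dslope`, grows
    -- with exponent one lower.
    have hd : Differentiable ℂ (dslope F 0) := by
      rw [← differentiableOn_univ, Complex.differentiableOn_dslope Filter.univ_mem]
      exact hF.differentiableOn
    obtain ⟨p, hp, hpe⟩ := ih hd (C := C + ‖F 0‖) (by
      intro z hz
      have hz0 : z ≠ 0 := by rintro rfl; norm_num at hz
      have hzp : 0 < ‖z‖ := by positivity
      rw [dslope_of_ne _ hz0, slope_def_field, norm_div, sub_zero, div_le_iff₀ hzp]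
      have h1 : 1 ≤ ‖z‖ ^ (n + 1) := one_le_pow₀ hz
      calc ‖F z - F 0‖ ≤ ‖F z‖ + ‖F 0‖ := norm_sub_le _ _
        _ ≤ C * ‖z‖ ^ (n + 1) + ‖F 0‖ * ‖z‖ ^ (n + 1) := by
          gcongr
          · exact hC z hz
          · nlinarith [norm_nonneg (F 0)]
        _ = _ := by ring)
    refine ⟨.X * p + .C (F 0), ?_, fun z => ?_⟩
    · refine (Polynomial.natDegree_add_C (a := F 0)).le.trans ?_
      refine Polynomial.natDegree_mul_le.trans ?_
      have := Polynomial.natDegree_X_le (R := ℂ)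
      omega
    · have := sub_smul_dslope F 0 z
      simp only [sub_zero, smul_eq_mul, hpe] at this
      simp only [Polynomial.eval_add, Polynomial.eval_mul, Polynomial.eval_X, Polynomial.eval_C]
      linear_combination -this

/-- The equation `∂η/∂ζ = 0` is the Cauchy-Riemann equation for the conjugate of `η`. This gives
access to Liouville's theorem and to removable singularities. -/
theorem differentiableAt_conj_of_dzeta_eq_zero {η : ℂ → ℂ} {z : ℂ} (h : HasDz η 0 z) :
    DifferentiableAt ℂ (fun y => (starRingEnd ℂ) (η y)) z := by
  rw [differentiableAt_complex_iff_differentiableAt_real]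
  have h1 : HasFDerivAt (fun y => (starRingEnd ℂ) (η y)) _ z :=
    Complex.conjCLE.hasFDerivAt.comp z h.1.hasFDerivAt
  refine ⟨h1.differentiableAt, ?_⟩
  rw [h1.fderiv]
  have h2 : fderiv ℝ η z 1 = I * fderiv ℝ η z I := by
    have := h.2
    rw [dzeta, div_eq_zero_iff, sub_eq_zero] at this
    simpa using this
  have h3 : fderiv ℝ η z I = -I * fderiv ℝ η z 1 := by
    rw [h2]; linear_combination (fderiv ℝ η z I) * Complex.I_mul_I
  simp [h3]

/-- `ð² ξ = 0` on the whole sphere only for spherical harmonics of degree at most one. -/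
theorem exists_sesq_of_ethSq_eq_zero {ξ : OnePoint ℂ → ℂ} (hξ : SmoothOnSphere ξ)
    (h : ∀ z, ethSq ξ z = 0) : ∃ a b c d, ∀ p, ξ p = sesq a b c d p := by
  set η : ℂ → ℂ := fun z => ξ z with hη
  have hs : ContDiff ℝ ∞ η := hξ.coe
  set B : ℂ → ℂ := fun y => (P y : ℂ) ^ 2 * dzeta η y with hB
  have hBs : ContDiff ℝ ∞ B := (contDiff_P.pow 2).mul (ContDiff.dzeta hs)
  have hB0 : ∀ z, HasDz B 0 z := fun z => ⟨hBs.differentiable (by simp) z, by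
    have := h z
    rw [ethSq_eq_edthTwo, edthTwo] at this
    simpa using this⟩
  have hent : Differentiable ℂ (fun y => (starRingEnd ℂ) (B y)) := fun z =>
    differentiableAt_conj_of_dzeta_eq_zero (hB0 z)
  set θ : ℂ → ℂ := fun w => ξ (chart true w) with hθ
  have hθs : ContDiff ℝ ∞ θ := hξ true
  obtain ⟨C, hC⟩ := (isCompact_closedBall (0 : ℂ) 1).exists_bound_of_continuousOn
    (ContDiff.dzeta hθs).continuous.continuousOn
  -- Smoothness at `∞` in the coordinate `1/ζ` makes `∂η/∂ζ` of order `|ζ|⁻²`, while `P²` has order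
  -- `|ζ|⁴`; so `B` grows at most quadratically.
  obtain ⟨p, hp, hpe⟩ := exists_polynomial_of_growth 2 hent (C := C) (by
    intro z hz
    have hz0 : z ≠ 0 := by rintro rfl; norm_num at hz
    have h1 : HasDz η (dzeta θ z⁻¹ * (-(z ^ 2)⁻¹)) z := by
      refine ((hasDz_dzeta (hθs.differentiable (by simp) z⁻¹)).comp_holomorphic
        (hasDerivAt_inv hz0)).congr ?_
      filter_upwards [isOpen_ne.mem_nhds hz0] with y hy
      simp [hη, hθ, chart_true_of_ne (inv_ne_zero hy)]
    have h2 := hC z⁻¹ (by simpa using inv_le_one_of_one_le₀ hz)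
    have hPz : P z ≤ ‖z‖ ^ 2 := by
      unfold P; nlinarith
    have hP0 := P_pos z
    have hzp : 0 < ‖z‖ := by positivity
    rw [RCLike.norm_conj, hB]
    simp only [h1.2, norm_mul, norm_pow, norm_neg, norm_inv, Complex.norm_real, Real.norm_eq_abs,
      abs_of_pos hP0]
    calc P z ^ 2 * (‖dzeta θ z⁻¹‖ * (‖z‖ ^ 2)⁻¹) ≤ (‖z‖ ^ 2) ^ 2 * (C * (‖z‖ ^ 2)⁻¹) := by gcongr
      _ = C * ‖z‖ ^ 2 := by field_simp)
  obtain ⟨a, b, c, habc⟩ : ∃ a b c : ℂ, ∀ z, B z =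
      a + b * (starRingEnd ℂ) z + c * (starRingEnd ℂ) z ^ 2 := by
    refine ⟨(starRingEnd ℂ) (p.coeff 0), (starRingEnd ℂ) (p.coeff 1), (starRingEnd ℂ) (p.coeff 2),
      fun z => ?_⟩
    have e := congrArg (starRingEnd ℂ) (hpe z)
    rw [Complex.conj_conj, Polynomial.eval_eq_sum_range' (n := 3) (by omega)] at e
    rw [e]
    simp [Finset.sum_range_succ]
  -- These coefficients give a function with the same `∂/∂ζ` as `η`, by `hasDz_sesq`. The difference
  -- is antiholomorphic and bounded, hence constant, and the constant can be absorbed into the first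
  -- and last coefficients.
  have hD : ∀ z, HasDz (fun z : ℂ => η z - sesq 0 (4 * a) (-(4 * c)) (4 * b) z) 0 z := by
    intro z
    refine ((hasDz_dzeta (hs.differentiable (by simp) z)).sub (hasDz_sesq _ _ _ _ z)).congr_deriv ?_
    have e := habc z
    have h0 := one_add_mul_conj_ne_zero z
    simp only [hB, P_eq] at e
    have e' : dzeta η z = 4 * (a + b * (starRingEnd ℂ) z + c * (starRingEnd ℂ) z ^ 2) /
        (1 + z * (starRingEnd ℂ) z) ^ 2 := by
      rw [← e]; field_simp; norm_num
    rw [e']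
    ring
  obtain ⟨C₁, h₁⟩ := hξ.bounded
  obtain ⟨C₂, h₂⟩ := (smoothOnSphere_sesq 0 (4 * a) (-(4 * c)) (4 * b)).bounded
  obtain ⟨k, hk⟩ := Differentiable.exists_const_forall_eq_of_bounded
    (fun z => differentiableAt_conj_of_dzeta_eq_zero (hD z))
    (isBounded_iff_forall_norm_le.2 ⟨C₁ + C₂, by
      rintro _ ⟨z, rfl⟩
      rw [RCLike.norm_conj]
      exact (norm_sub_le _ _).trans (add_le_add (h₁ _) (h₂ _))⟩)
  have hcoe : ∀ z : ℂ, ξ z = sesq ((starRingEnd ℂ) k) (4 * a) (-(4 * c))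
      (4 * b + (starRingEnd ℂ) k) z := by
    intro z
    have e := congrArg (starRingEnd ℂ) (hk z)
    rw [Complex.conj_conj, sub_eq_iff_eq_add] at e
    have h0 := one_add_mul_conj_ne_zero z
    rw [show ξ z = η z from rfl, e, sesq_coe, sesq_coe]
    field_simp
    ring
  refine ⟨(starRingEnd ℂ) k, 4 * a, -(4 * c), 4 * b + (starRingEnd ℂ) k, fun p => ?_⟩
  induction p using OnePoint.rec with
  | coe z => exact hcoe z
  | infty =>
    -- The value at `∞` follows by continuity in the chart `w = 1/ζ`.
    have h1 := (hξ true).continuous.continuousAt (x := 0)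
    have h2 := (smoothOnSphere_sesq ((starRingEnd ℂ) k) (4 * a) (-(4 * c))
      (4 * b + (starRingEnd ℂ) k) true).continuous.continuousAt (x := 0)
    rw [← chart_true_zero]
    refine tendsto_nhds_unique (h1.tendsto.mono_left (nhdsWithin_le_nhds (s := {0}ᶜ)))
      ((h2.tendsto.mono_left nhdsWithin_le_nhds).congr' ?_)
    filter_upwards [self_mem_nhdsWithin] with w hw
    simp only [chart_true_of_ne (show w ≠ 0 from hw), hcoe]

/-- The real smooth functions with `ð² α = 0` are the translations. -/
theorem isTranslation_iff_ethSq_eq_zero {α : OnePoint ℂ → ℝ} (hα : SmoothOnSphere α) :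
    IsTranslation α ↔ ∀ z, ethSq (fun p => (α p : ℂ)) z = 0 := by
  refine ⟨IsTranslation.ethSq_eq_zero, fun h => ?_⟩
  obtain ⟨a, b, c, d, e⟩ := exists_sesq_of_ethSq_eq_zero
    (fun i => Complex.ofRealCLM.contDiff.comp (hα i)) h
  have := isTranslation_re_sesq a b c d
  simp only [← e, Complex.ofReal_re] at this
  exact this

/-! ## Solution of `∂u/∂ζ = A` with compactly supported `A` -/

open MeasureTheory in
/-- The convolution of `A` with the fundamental solution `1 / (π ζ̄)` of `∂/∂ζ`. -/
noncomputable def cauchyTransform (A : ℂ → ℂ) (z : ℂ) : ℂ :=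
  (Real.pi : ℂ)⁻¹ * ∫ t, ((starRingEnd ℂ) t)⁻¹ * A (z - t)

open MeasureTheory in
-- The singularity `|t|⁻¹` is integrable in real dimension two.
theorem locallyIntegrable_inv_conj :
    LocallyIntegrable (fun t : ℂ => ((starRingEnd ℂ) t)⁻¹) volume := by
  refine locallyIntegrable_of_norm_le_rpow (C := 1) (α := 1) ?_ ?_ (.of_forall fun x => ?_) ?_
  · simp [Complex.finrank_real_complex]
  · simp [Complex.finrank_real_complex]
  · rw [norm_inv, RCLike.norm_conj, one_mul, Real.rpow_neg_one]
  · exact (Complex.continuous_conj.measurable.inv).aestronglyMeasurable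

open MeasureTheory in
-- Away from `0` the integrand is `∂g/∂t` divided by `t̄`. Times the area factor `r` it equals `½
-- (∂_r - (i/r) ∂_θ) g`. The radial part integrates to `-g 0` along each ray and the angular part to
-- `0` by periodicity. This is the statement that `1/(π t̄)` is a fundamental solution.
theorem integral_polar_dzeta {g : ℂ → ℂ} (hg : ContDiff ℝ ∞ g) (hc : HasCompactSupport g) :
    ∫ t, (t)⁻¹ * (t / (starRingEnd ℂ) t * dzeta g t) = -(Real.pi : ℂ) * g 0 := by
  rw [← Complex.integral_comp_polarCoord_symm, polarCoord_target]
  obtain ⟨R, hR⟩ := hc.isCompact.isBounded.subset_closedBall 0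
  have hgR : ∀ t : ℂ, R < ‖t‖ → fderiv ℝ g t = 0 := fun t ht => by
    by_contra hne
    have := hR (support_fderiv_subset ℝ hne)
    rw [mem_closedBall_zero_iff] at this
    exact absurd ht this.not_gt
  have hgR' : ∀ t : ℂ, R < ‖t‖ → g t = 0 := fun t ht => by
    by_contra hne
    have := hR (subset_tsupport g hne)
    rw [mem_closedBall_zero_iff] at this
    exact absurd ht this.not_gt
  set q : ℝ × ℝ → ℂ := fun p => p.1 * cexp (p.2 * I) with hq
  have hqc : Continuous q := by fun_prop
  have hqn : ∀ p, ‖q p‖ = |p.1| := fun p => by simp [hq, Complex.norm_exp_ofReal_mul_I]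
  have hdc : Continuous (fderiv ℝ g) := hg.continuous_fderiv (by simp)
  set F₁ : ℝ × ℝ → ℂ := fun p => fderiv ℝ g (q p) (cexp (p.2 * I)) with hF₁
  set F₂ : ℝ × ℝ → ℂ := fun p => fderiv ℝ g (q p) (I * cexp (p.2 * I)) with hF₂
  have hF₁c : Continuous F₁ := (hdc.comp hqc).clm_apply (by fun_prop)
  have hF₂c : Continuous F₂ := (hdc.comp hqc).clm_apply (by fun_prop)
  have hF₁0 : ∀ p, R < |p.1| → F₁ p = 0 := fun p hp => by
    simp [hF₁, hgR (q p) (by rwa [hqn])]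
  have hF₂0 : ∀ p, R < |p.1| → F₂ p = 0 := fun p hp => by
    simp [hF₂, hgR (q p) (by rwa [hqn])]
  -- The integrands are continuous and vanish for `r > R`, so integrability is needed only on a
  -- compact rectangle.
  have hint : ∀ F : ℝ × ℝ → ℂ, Continuous F → (∀ p, R < |p.1| → F p = 0) →
      IntegrableOn F (Set.Ioi 0 ×ˢ Set.Ioo (-Real.pi) Real.pi) := by
    intro F hF h0
    have h1 : IntegrableOn F (Set.Icc (-R) R ×ˢ Set.Icc (-Real.pi) Real.pi) :=
      hF.continuousOn.integrableOn_compact (isCompact_Icc.prod isCompact_Icc)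
    refine h1.of_forall_sdiff_eq_zero (measurableSet_Ioi.prod measurableSet_Ioo) ?_
    rintro ⟨r, θ⟩ ⟨⟨_, h3⟩, h4⟩
    apply h0
    by_contra h5
    exact h4 ⟨abs_le.1 (not_lt.1 h5), Set.Ioo_subset_Icc_self h3⟩
  have e1 : ∀ p ∈ Set.Ioi (0 : ℝ) ×ˢ Set.Ioo (-Real.pi) Real.pi,
      p.1 • ((Complex.polarCoord.symm p)⁻¹ * (Complex.polarCoord.symm p /
        (starRingEnd ℂ) (Complex.polarCoord.symm p) * dzeta g (Complex.polarCoord.symm p))) =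
      (F₁ p - I * F₂ p) / 2 := by
    rintro ⟨r, θ⟩ ⟨hr, _⟩
    have hr0 : (r : ℂ) ≠ 0 := by exact_mod_cast (show (0 : ℝ) < r from hr).ne'
    have e0 : Complex.polarCoord.symm (r, θ) = q (r, θ) := by
      simp [hq, Complex.exp_mul_I]
    have e2 : (starRingEnd ℂ) (q (r, θ)) = r * (cexp (θ * I))⁻¹ := by
      simp only [hq, map_mul, Complex.conj_ofReal, ← Complex.exp_conj, Complex.conj_I,
        ← Complex.exp_neg, mul_neg]
    have hex := Complex.exp_ne_zero (θ * I)
    have hq0 : q (r, θ) ≠ 0 := mul_ne_zero hr0 hex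
    have key : ∀ v : ℂ, fderiv ℝ g (q (r, θ)) v =
        v.re * fderiv ℝ g (q (r, θ)) 1 + v.im * fderiv ℝ g (q (r, θ)) I := by
      intro v
      have : v = v.re • (1 : ℂ) + v.im • I := by simp [Complex.re_add_im]
      conv_lhs => rw [this, map_add, map_smul, map_smul]
      simp
    rw [e0, e2]
    have e3 : (r : ℝ) • ((q (r, θ))⁻¹ * (q (r, θ) / (r * (cexp (θ * I))⁻¹) * dzeta g (q (r, θ)))) =
        cexp (θ * I) * dzeta g (q (r, θ)) := by
      rw [Complex.real_smul]
      field_simp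
    rw [e3, hF₁, hF₂]
    simp only
    rw [key (cexp (θ * I)), key (I * cexp (θ * I)), dzeta]
    have e4 : ((cexp (θ * I)).re : ℂ) + (cexp (θ * I)).im * I = cexp (θ * I) :=
      Complex.re_add_im _
    simp
    rw [Complex.exp_mul_I]
    linear_combination (-fderiv ℝ g (q (r, θ)) I * Complex.sin θ / 2) * Complex.I_sq
  rw [setIntegral_congr_fun (measurableSet_Ioi.prod measurableSet_Ioo) e1, integral_div,
    integral_sub (hint _ hF₁c hF₁0) ((hint _ hF₂c hF₂0).const_mul I), integral_const_mul]
  have hq1 : ∀ r θ : ℝ, HasDerivAt (fun r : ℝ => g (q (r, θ))) (F₁ (r, θ)) r := by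
    intro r θ
    have h1 : HasDerivAt (fun r : ℝ => q (r, θ)) (cexp (θ * I)) r := by
      simpa using (Complex.ofRealCLM.hasDerivAt (x := r)).mul_const (cexp (θ * I))
    exact (hg.differentiable (by simp) (q (r, θ))).hasFDerivAt.comp_hasDerivAt r h1
  have hq2 : ∀ r θ : ℝ, HasDerivAt (fun θ : ℝ => g (q (r, θ))) (r * F₂ (r, θ)) θ := by
    intro r θ
    have h1 : HasDerivAt (fun θ : ℝ => q (r, θ)) (r • (I * cexp (θ * I))) θ := by
      have := (((Complex.ofRealCLM.hasDerivAt (x := θ)).mul_const I).cexp).const_mul (r : ℂ)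
      simpa [hq, mul_comm] using this
    have h2 := (hg.differentiable (by simp) (q (r, θ))).hasFDerivAt.comp_hasDerivAt θ h1
    rw [map_smul, Complex.real_smul] at h2
    exact h2
  have i1 : ∫ p in Set.Ioi 0 ×ˢ Set.Ioo (-Real.pi) Real.pi, F₁ p = -(2 * Real.pi) * g 0 := by
    rw [Measure.volume_eq_prod, ← setIntegral_prod_swap, setIntegral_prod]
    · have : ∀ θ : ℝ, ∫ r in Set.Ioi (0 : ℝ), F₁ (θ, r).swap = -g 0 := by
        intro θ
        have h1 : ContDiff ℝ 1 (fun r : ℝ => g (q (r, θ))) := by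
          refine (hg.of_le (by simp)).comp ?_
          exact (Complex.ofRealCLM.contDiff (n := 1)).mul
            (contDiff_const (c := cexp (θ * I)))
        have h2 : HasCompactSupport (fun r : ℝ => g (q (r, θ))) := by
          refine HasCompactSupport.intro (K := Set.Icc (-R) R) isCompact_Icc fun r hr => ?_
          apply hgR'
          rw [hqn]
          by_contra h5
          exact hr (abs_le.1 (not_lt.1 h5))
        have h3 := h2.integral_Ioi_deriv_eq h1 0
        simp only [fun r => (hq1 r θ).deriv] at h3
        simpa [hq] using h3
      simp only [this, setIntegral_const]
      simp
      left
      rw [max_eq_left (by positivity)]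
      push_cast
      ring
    · have := hint _ hF₁c hF₁0
      rw [Measure.volume_eq_prod] at this
      exact this.swap
  have i2 : ∫ p in Set.Ioi 0 ×ˢ Set.Ioo (-Real.pi) Real.pi, F₂ p = 0 := by
    rw [Measure.volume_eq_prod, setIntegral_prod]
    · refine setIntegral_eq_zero_of_forall_eq_zero fun r hr => ?_
      have hr0 : (r : ℂ) ≠ 0 := by exact_mod_cast (show (0 : ℝ) < r from hr).ne'
      have h1 : ∫ θ in (-Real.pi)..Real.pi, (r : ℂ) * F₂ (r, θ) =
          g (q (r, Real.pi)) - g (q (r, -Real.pi)) :=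
        intervalIntegral.integral_eq_sub_of_hasDerivAt (fun θ _ => hq2 r θ)
          ((continuous_const.mul (hF₂c.comp (by fun_prop))).intervalIntegrable _ _)
      have h2 : q (r, -Real.pi) = q (r, Real.pi) := by
        simp [hq, Complex.exp_neg]
      rw [h2, sub_self, intervalIntegral.integral_const_mul,
        intervalIntegral.integral_of_le (by linarith [Real.pi_pos]),
        integral_Ioc_eq_integral_Ioo] at h1
      simpa [hr0] using h1
    · have := hint _ hF₂c hF₂0
      rwa [Measure.volume_eq_prod] at this
  rw [i1, i2]
  ring

open MeasureTheory in
theorem cauchyTransform_eq_convolution (A : ℂ → ℂ) : cauchyTransform A = fun z => (Real.pi : ℂ)⁻¹ *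
    (convolution (fun t : ℂ => ((starRingEnd ℂ) t)⁻¹) A (ContinuousLinearMap.mul ℝ ℂ) volume) z :=
  rfl

theorem contDiff_cauchyTransform {A : ℂ → ℂ} (hA : ContDiff ℝ ∞ A) (hc : HasCompactSupport A) :
    ContDiff ℝ ∞ (cauchyTransform A) := by
  rw [cauchyTransform_eq_convolution]
  exact contDiff_const.mul (hc.contDiff_convolution_right _ locallyIntegrable_inv_conj hA)

open MeasureTheory in
/-- The Cauchy transform solves `∂u/∂ζ = A`. -/
theorem hasDz_cauchyTransform {A : ℂ → ℂ} (hA : ContDiff ℝ ∞ A) (hc : HasCompactSupport A)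
    (z : ℂ) : HasDz (cauchyTransform A) (A z) z := by
  refine ⟨(contDiff_cauchyTransform hA hc).differentiable (by simp) z, ?_⟩
  have h1 := hc.hasFDerivAt_convolution_right (ContinuousLinearMap.mul ℝ ℂ)
    locallyIntegrable_inv_conj (hA.of_le (by simp)) z
  rw [cauchyTransform_eq_convolution, dzeta_const_mul, dzeta, h1.fderiv,
    convolution_precompR_apply _ locallyIntegrable_inv_conj (hc.fderiv ℝ)
      (hA.continuous_fderiv (by simp)),
    convolution_precompR_apply _ locallyIntegrable_inv_conj (hc.fderiv ℝ)
      (hA.continuous_fderiv (by simp))]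
  have hI : ∀ v : ℂ, Integrable fun t => ((starRingEnd ℂ) t)⁻¹ * fderiv ℝ A (z - t) v := by
    intro v
    have hc' : HasCompactSupport fun t => fderiv ℝ A t v :=
      (hc.fderiv ℝ).comp_left (g := fun L : ℂ →L[ℝ] ℂ => L v) (by simp)
    exact (hc'.convolutionExists_right (ContinuousLinearMap.mul ℝ ℂ) locallyIntegrable_inv_conj
      ((hA.continuous_fderiv (by simp)).clm_apply continuous_const)) z
  simp only [convolution_def, ContinuousLinearMap.mul_apply']
  rw [← integral_const_mul, ← integral_sub (hI 1) ((hI I).const_mul I), ← integral_div]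
  -- The polar integral is applied to `t ↦ A (z - t)`, whose value at `0` is `A z`; the reflection
  -- supplies the sign that turns `-π` into `π`.
  have hs : HasCompactSupport fun t => A (z - t) := hc.comp_homeomorph (Homeomorph.subLeft z)
  have hd : ∀ t, dzeta (fun t => A (z - t)) t = -dzeta A (z - t) := fun t =>
    (((hasDz_dzeta (hA.differentiable (by simp) (z - t))).comp_holomorphic
      (((hasDerivAt_id t).const_sub z)))).2.trans (by ring)
  have e := integral_polar_dzeta (hA.comp (contDiff_const.sub contDiff_id)) hs
  have hne : ∀ᵐ t : ℂ, t ≠ 0 := by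
    simp [ae_iff, measure_singleton]
  have e2 : ∫ t, (((starRingEnd ℂ) t)⁻¹ * fderiv ℝ A (z - t) 1 -
      I * (((starRingEnd ℂ) t)⁻¹ * fderiv ℝ A (z - t) I)) / 2 =
      -∫ t, (t)⁻¹ * (t / (starRingEnd ℂ) t * dzeta (fun t => A (z - t)) t) := by
    rw [← integral_neg]
    refine integral_congr_ae ?_
    filter_upwards [hne] with t ht
    rw [hd, dzeta]
    field_simp
  rw [e2]
  have e3 : (A ∘ fun t => z - id t) = fun t => A (z - t) := rfl
  rw [← e3, e]
  have : (Real.pi : ℂ) ≠ 0 := by exact_mod_cast Real.pi_ne_zero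
  simp

open MeasureTheory in
/-- Near `ζ = ∞` the Cauchy transform is antiholomorphic in `1 / ζ`. -/
theorem exists_cauchyTransform_inv {A : ℂ → ℂ} (hA : ContDiff ℝ ∞ A) (hc : HasCompactSupport A) :
    ∃ V : ℂ → ℂ, ContDiffAt ℝ ∞ V 0 ∧ ∀ᶠ w in 𝓝[≠] 0, cauchyTransform A w⁻¹ = V w := by
  obtain ⟨R₀, hR₀⟩ := hc.isCompact.isBounded.subset_closedBall 0
  set R := max R₀ 1 with hRdef
  have hR1 : 1 ≤ R := le_max_right _ _
  have hAR : ∀ t : ℂ, R < ‖t‖ → A t = 0 := fun t ht => by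
    by_contra hne
    have := hR₀ (subset_tsupport A hne)
    rw [mem_closedBall_zero_iff] at this
    exact absurd ht (this.trans (le_max_left _ _)).not_gt
  -- For `|ζ| > 2R` every `t` with `A (ζ - t) ≠ 0` satisfies `|t| ≥ R ≥ 1`, so the kernel is bounded
  -- by `1` there.
  set s : Set ℂ := Metric.ball 0 (2 * R)⁻¹ with hs
  have hs0 : s ∈ 𝓝 (0 : ℂ) := Metric.ball_mem_nhds _ (by positivity)
  have hbig : ∀ w ∈ s \ {0}, 2 * R < ‖w⁻¹‖ := by
    rintro w ⟨hw, hw0⟩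
    rw [hs, mem_ball_zero_iff] at hw
    rw [norm_inv]
    have : 0 < ‖w‖ := norm_pos_iff.2 hw0
    exact (lt_inv_comm₀ this (by positivity)).1 hw
  set H : ℂ → ℂ := fun w => (starRingEnd ℂ) (cauchyTransform A w⁻¹) with hH
  have hd : DifferentiableOn ℂ H (s \ {0}) := by
    intro w hw
    have h1 : HasDz (cauchyTransform A) 0 w⁻¹ := by
      rw [← hAR w⁻¹ (by have := hbig w hw; linarith)]
      exact hasDz_cauchyTransform hA hc _
    exact ((differentiableAt_conj_of_dzeta_eq_zero h1).comp w
      (differentiableAt_inv hw.2)).differentiableWithinAt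
  have hb : BddAbove (norm ∘ H '' (s \ {0})) := by
    refine ⟨Real.pi⁻¹ * ∫ t, ‖A t‖, ?_⟩
    rintro _ ⟨w, hw, rfl⟩
    have hw1 := hbig w hw
    simp only [Function.comp, hH, RCLike.norm_conj, cauchyTransform, norm_mul, norm_inv,
      Complex.norm_real, Real.norm_eq_abs, abs_of_pos Real.pi_pos]
    gcongr
    rw [← integral_sub_left_eq_self (fun t => ‖A t‖) volume w⁻¹]
    refine norm_integral_le_of_norm_le ?_ (.of_forall fun t => ?_)
    · exact ((hA.continuous.norm).integrable_of_hasCompactSupport hc.norm).comp_sub_left w⁻¹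
    · rw [norm_mul, norm_inv, RCLike.norm_conj]
      by_cases hA0 : A (w⁻¹ - t) = 0
      · simp [hA0]
      · have h1 : ‖w⁻¹ - t‖ ≤ R := by
          by_contra h2
          exact hA0 (hAR _ (not_le.1 h2))
        have h2 : ‖w⁻¹‖ ≤ ‖w⁻¹ - t‖ + ‖t‖ := by
          simpa using norm_add_le (w⁻¹ - t) t
        have h3 : 1 ≤ ‖t‖ := by linarith
        exact mul_le_of_le_one_left (norm_nonneg _) (inv_le_one_of_one_le₀ h3)
  -- Riemann's theorem removes the singularity at `w = 0`: `H` is holomorphic and bounded on the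
  -- punctured disc.
  have hV := Complex.differentiableOn_update_limUnder_of_bddAbove hs0 hd hb
  have hVa : AnalyticAt ℂ (Function.update H 0 (Filter.limUnder (𝓝[≠] 0) H)) 0 :=
    hV.analyticAt hs0
  refine ⟨fun w => (starRingEnd ℂ) (Function.update H 0 (Filter.limUnder (𝓝[≠] 0) H) w), ?_, ?_⟩
  · exact Complex.conjCLE.contDiff.contDiffAt.comp 0 (hVa.contDiffAt.restrict_scalars ℝ)
  · filter_upwards [self_mem_nhdsWithin] with w hw
    rw [Function.update_of_ne hw, hH]
    simp

/-! ## Surjectivity of `ð²` -/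

theorem tendsto_inv_nhdsNE_zero_of_eventually {p : ℂ → Prop} (h : ∀ᶠ w in 𝓝[≠] (0 : ℂ), p w⁻¹) :
    ∃ R > 0, ∀ z : ℂ, R < ‖z‖ → p z := by
  obtain ⟨ε, hε, h⟩ := Metric.eventually_nhds_iff.1 (eventually_nhdsWithin_iff.1 h)
  refine ⟨ε⁻¹, by positivity, fun z hz => ?_⟩
  have hz0 : 0 < ‖z‖ := lt_trans (by positivity) hz
  have := h (y := z⁻¹) (by rw [dist_zero_right, norm_inv]; exact inv_lt_of_inv_lt₀ hε hz)
    (inv_ne_zero (norm_pos_iff.1 hz0))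
  rwa [inv_inv] at this

/-- A smooth function of `ζ` which is smooth in `1/ζ` near `ζ = ∞` extends smoothly to the
sphere. -/
theorem exists_smoothOnSphere {η θ : ℂ → ℂ} (hη : ContDiff ℝ ∞ η) (hθ : ContDiffAt ℝ ∞ θ 0)
    (h : ∀ᶠ w in 𝓝[≠] 0, η w⁻¹ = θ w) :
    ∃ ξ : OnePoint ℂ → ℂ, SmoothOnSphere ξ ∧ ∀ z : ℂ, ξ z = η z := by
  refine ⟨fun p => p.elim (θ 0) η, ?_, fun z => rfl⟩
  rintro (_ | _)
  · exact hη
  · rw [contDiff_iff_contDiffAt]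
    intro w
    by_cases hw : w = 0
    · subst hw
      refine hθ.congr_of_eventuallyEq ?_
      filter_upwards [eventually_nhdsWithin_iff.1 h] with y hy
      by_cases hy0 : y = 0
      · subst hy0
        simp
      · rw [chart_true_of_ne hy0, ← hy hy0]
        rfl
    · have h1 : ContDiffAt ℝ ∞ (fun y => η y⁻¹) w :=
        hη.contDiffAt.comp w ((contDiffAt_inv ℂ hw).restrict_scalars ℝ)
      refine h1.congr_of_eventuallyEq ?_
      filter_upwards [isOpen_ne.mem_nhds hw] with y hy
      rw [chart_true_of_ne hy]
      rfl

/-- The inversion `ζ ↦ 1/ζ`, which exchanges the two charts. -/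
noncomputable def inversion (p : OnePoint ℂ) : OnePoint ℂ := p.elim ((0 : ℂ) : OnePoint ℂ) (chart true)

theorem inversion_chart (i : Bool) (z : ℂ) : inversion (chart i z) = chart (!i) z := by
  cases i
  · rfl
  · by_cases hz : z = 0
    · subst hz
      simp [inversion]
    · rw [chart_true_of_ne hz]
      change chart true z⁻¹ = _
      rw [chart_true_of_ne (inv_ne_zero hz), inv_inv]
      rfl

theorem SmoothOnSphere.comp_inversion {E : Type*} [NormedAddCommGroup E] [NormedSpace ℝ E]
    {α : OnePoint ℂ → E} (h : SmoothOnSphere α) : SmoothOnSphere fun p => α (inversion p) := by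
  intro i
  simp only [inversion_chart]
  exact h _

/-- The inversion is the Möbius transformation with matrix `(0, i; i, 0)` of determinant `1`. It is
an isometry, so its conformal factor is `1` and only the phase remains. -/
theorem edthTwo_inversion {η θ : ℂ → ℂ} (hη : ContDiff ℝ ∞ η) {z : ℂ} (hz : z ≠ 0)
    (h : ∀ y, y ≠ 0 → θ y = η y⁻¹) :
    edthTwo η z⁻¹ = (z / (starRingEnd ℂ) z) ^ 2 * edthTwo θ z := by
  have h1 := edthTwo_mobius (a := 0) (b := I) (c := I) (d := 0) (by simp) (η := η) (z := z)
    (by simpa using hz) hη.contDiffAt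
  have hI : ∀ y : ℂ, I / (I * y) = y⁻¹ := fun y => by
    rw [div_mul_eq_div_div, div_self Complex.I_ne_zero, one_div]
  have h2 : edthTwo θ z = edthTwo (fun y => ((0 * y + I) * (starRingEnd ℂ) (0 * y + I) +
      (I * y + 0) * (starRingEnd ℂ) (I * y + 0)) / (1 + y * (starRingEnd ℂ) y) *
          η ((0 * y + I) / (I * y + 0))) z := by
    apply edthTwo_congr
    filter_upwards [isOpen_ne.mem_nhds hz] with y hy
    have h0 := one_add_mul_conj_ne_zero y
    have e : (0 * y + I) * (starRingEnd ℂ) (0 * y + I) +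
      (I * y + 0) * (starRingEnd ℂ) (I * y + 0) = 1 + y * (starRingEnd ℂ) y := by
      simp
      linear_combination (-y * (starRingEnd ℂ) y) * Complex.I_sq
    rw [e, div_self h0, h y hy]
    simp [hI]
  rw [h2]
  have h0 := one_add_mul_conj_ne_zero z
  have e : (0 * z + I) * (starRingEnd ℂ) (0 * z + I) +
      (I * z + 0) * (starRingEnd ℂ) (I * z + 0) = 1 + z * (starRingEnd ℂ) z := by
      simp
      linear_combination (-z * (starRingEnd ℂ) z) * Complex.I_sq
  rw [e, div_self h0] at h1
  have e2 : ((I * z + 0) / (starRingEnd ℂ) (I * z + 0)) ^ 2 = (z / (starRingEnd ℂ) z) ^ 2 := by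
    have hz' : (starRingEnd ℂ) z ≠ 0 := (map_ne_zero _).2 hz
    simp only [add_zero, map_mul, Complex.conj_I]
    have := Complex.I_ne_zero
    field_simp
  have e3 : (0 * z + I) / (I * z + 0) = z⁻¹ := by simp [hI]
  rw [e2, e3, one_mul] at h1
  exact h1.symm

theorem inv_ratio_sq (w : ℂ) (hw : w ≠ 0) :
    ((starRingEnd ℂ) w / w) ^ 2 * (w / (starRingEnd ℂ) w) ^ 2 = 1 := by
  have hz' : (starRingEnd ℂ) w ≠ 0 := (map_ne_zero _).2 hw
  field_simp

theorem ethSq_inversion {ξ : OnePoint ℂ → ℂ} (hξ : SmoothOnSphere ξ) {w : ℂ} (hw : w ≠ 0) :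
    ethSq (fun p => ξ (inversion p)) w = ((starRingEnd ℂ) w / w) ^ 2 * ethSq ξ w⁻¹ := by
  rw [ethSq_eq_edthTwo, ethSq_eq_edthTwo, edthTwo_inversion hξ.coe hw (θ := fun z : ℂ =>
    ξ (inversion z)), ← mul_assoc, inv_ratio_sq w hw, one_mul]
  intro y hy
  rw [← chart_false, inversion_chart, Bool.not_false, chart_true_of_ne hy]

theorem contDiff_ethSq {ξ : OnePoint ℂ → ℂ} (hξ : SmoothOnSphere ξ) : ContDiff ℝ ∞ (ethSq ξ) := by
  rw [ethSq_eq_edthTwo, contDiff_iff_contDiffAt]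
  exact fun z => contDiffAt_edthTwo hξ.coe.contDiffAt

theorem isSpinTwo_ethSq {ξ : OnePoint ℂ → ℂ} (hξ : SmoothOnSphere ξ) : IsSpinTwo (ethSq ξ) :=
  ⟨contDiff_ethSq hξ, ethSq fun p => ξ (inversion p), contDiff_ethSq hξ.comp_inversion,
    fun _ hw => ethSq_inversion hξ hw⟩

theorem ethSq_add {ξ χ : OnePoint ℂ → ℂ} (hξ : SmoothOnSphere ξ) (hχ : SmoothOnSphere χ) (z : ℂ) :
    ethSq (fun p => ξ p + χ p) z = ethSq ξ z + ethSq χ z := by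
  simp only [ethSq_eq_edthTwo]
  exact edthTwo_add hξ.coe hχ.coe

theorem ethSq_const_mul (c : ℂ) (ξ : OnePoint ℂ → ℂ) (z : ℂ) :
    ethSq (fun p => c * ξ p) z = c * ethSq ξ z := by
  simp only [ethSq_eq_edthTwo]
  exact edthTwo_const_mul c _ z

/-- The equation splits into `∂B/∂ζ = A/4` and `P² ∂ξ/∂ζ = B`. A Cauchy transform solves the first.
For the second, `B/P²` has a tail at `∞`, but there `B` is antiholomorphic and the tail has an
explicit primitive. After a cut-off of the primitive, the remaining source has compact support and a
second Cauchy transform finishes. -/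
theorem exists_ethSq_eq_of_hasCompactSupport {A : ℂ → ℂ} (hA : ContDiff ℝ ∞ A)
    (hc : HasCompactSupport A) : ∃ ξ : OnePoint ℂ → ℂ, SmoothOnSphere ξ ∧ ∀ z, ethSq ξ z = A z := by
  set A' : ℂ → ℂ := fun z => A z / 4 with hA'
  have hA's : ContDiff ℝ ∞ A' := hA.div_const 4
  have hA'c : HasCompactSupport A' := hc.comp_left (g := fun z => z / 4) (by simp)
  set B := cauchyTransform A' with hB
  have hBs : ContDiff ℝ ∞ B := contDiff_cauchyTransform hA's hA'c
  obtain ⟨V, hV, hVB⟩ := exists_cauchyTransform_inv hA's hA'c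
  obtain ⟨R, hR⟩ := hc.isCompact.isBounded.subset_closedBall 0
  have hAR : ∀ t : ℂ, R < ‖t‖ → A t = 0 := fun t ht => by
    by_contra hne
    have := hR (subset_tsupport A hne)
    rw [mem_closedBall_zero_iff] at this
    exact absurd ht this.not_gt
  let χ : ContDiffBump (0 : ℂ) := ⟨1, 2, by norm_num, by norm_num⟩
  set c : ℂ → ℂ := fun z => (starRingEnd ℂ) z with hcdef
  have hcs : ContDiff ℝ ∞ c := Complex.conjCLE.contDiff
  -- Where `B` is antiholomorphic, `∂G/∂ζ = 4B/(1 + ζζ̄)² = B/P²`. The cut-off in `E` removes the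
  -- pole of `G` at `ζ = 0`.
  set G : ℂ → ℂ := fun z => -4 * B z / (c z * (1 + z * c z)) with hG
  have hGs : ∀ z, z ≠ 0 → ContDiffAt ℝ ∞ G z := by
    intro z hz
    simp only [hG, div_eq_mul_inv]
    have hne : c z * (1 + z * c z) ≠ 0 :=
      mul_ne_zero ((map_ne_zero _).2 hz) (one_add_mul_conj_ne_zero z)
    exact (contDiff_const.mul hBs).contDiffAt.mul
      ((hcs.mul (contDiff_const.add (contDiff_id.mul hcs))).contDiffAt.inv hne)
  set E : ℂ → ℂ := fun z => (1 - (χ z : ℂ)) * G z with hE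
  have hEs : ContDiff ℝ ∞ E := by
    rw [contDiff_iff_contDiffAt]
    intro z
    by_cases hz : z = 0
    · subst hz
      refine (contDiffAt_const (c := (0 : ℂ))).congr_of_eventuallyEq ?_
      filter_upwards [χ.eventuallyEq_one] with y hy
      simp [hE, hy]
    · exact (contDiffAt_const.sub (Complex.ofRealCLM.contDiff.contDiffAt.comp z
        χ.contDiffAt)).mul (hGs z hz)
  have hE2 : ∀ z : ℂ, 2 ≤ ‖z‖ → E z = G z := by
    intro z hz
    have : χ z = 0 := χ.zero_of_le_dist (by simpa using hz)
    simp [hE, this]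
  set N : ℂ → ℂ := fun z => 4 * B z * ((1 + z * c z)⁻¹) ^ 2 - dzeta E z with hN
  have hNs : ContDiff ℝ ∞ N :=
    ((contDiff_const.mul hBs).mul (((contDiff_const.add (contDiff_id.mul hcs)).inv
      one_add_mul_conj_ne_zero).pow 2)).sub (ContDiff.dzeta hEs)
  have hNc : HasCompactSupport N := by
    refine HasCompactSupport.intro (K := Metric.closedBall 0 (max R 2))
      (isCompact_closedBall _ _) fun z hz => ?_
    rw [mem_closedBall_zero_iff, not_le, max_lt_iff] at hz
    have hz0 : z ≠ 0 := by rintro rfl; norm_num at hz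
    have hcz : c z ≠ 0 := (map_ne_zero _).2 hz0
    have h0 : 1 + z * c z ≠ 0 := one_add_mul_conj_ne_zero z
    have h1 : HasDz B 0 z := by
      exact (hasDz_cauchyTransform hA's hA'c z).congr_deriv (by simp [hA', hAR z hz.1])
    have h2 : HasDz G (4 * B z * ((1 + z * c z)⁻¹) ^ 2) z := by
      refine ((h1.const_mul (-4)).div ((hasDz_conj z).mul (hasDz_one_add_mul_conj z))
        (mul_ne_zero hcz h0)).congr_deriv ?_
      change (-4 * 0 * (c z * (1 + z * c z)) - -4 * B z * (0 * (1 + z * c z) + c z * c z)) /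
        (c z * (1 + z * c z)) ^ 2 = _
      field_simp
      ring
    have h3 : HasDz E (4 * B z * ((1 + z * c z)⁻¹) ^ 2) z := by
      refine h2.congr ?_
      filter_upwards [(isOpen_lt continuous_const continuous_norm).mem_nhds hz.2] with y hy
      exact hE2 y (le_of_lt hy)
    simp only [hN, h3.2, sub_self]
  obtain ⟨V', hV', hVF⟩ := exists_cauchyTransform_inv hNs hNc
  -- This is `E` plus the second transform in the coordinate `w = 1/ζ`: near `∞` one has `E = G`,
  -- and `G` becomes `-4 V w̄ (w w̄)/(1 + w w̄)`, smooth at `w = 0`.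
  obtain ⟨ξ, hξ, hξe⟩ := exists_smoothOnSphere (η := fun z => E z + cauchyTransform N z)
    (θ := fun w => -4 * V w * c w * (w * c w) * (1 + w * c w)⁻¹ + V' w)
    (hEs.add (contDiff_cauchyTransform hNs hNc))
    (((((contDiffAt_const.mul hV).mul hcs.contDiffAt).mul (contDiff_id.mul hcs).contDiffAt).mul
      (((contDiff_const.add (contDiff_id.mul hcs)).inv one_add_mul_conj_ne_zero).contDiffAt)).add
      hV') (by
      have hsmall : ∀ᶠ w in 𝓝[≠] (0 : ℂ), ‖w‖ < 1 / 2 :=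
        nhdsWithin_le_nhds (by
          simpa [Metric.ball, dist_zero_right] using Metric.ball_mem_nhds (0 : ℂ)
            (by norm_num : (0 : ℝ) < 1 / 2))
      filter_upwards [hVB, hVF, hsmall, self_mem_nhdsWithin] with w h1 h2 h3 h4
      have hw0 : w ≠ 0 := h4
      have hcw : c w ≠ 0 := (map_ne_zero _).2 hw0
      have h0 : 1 + w * c w ≠ 0 := one_add_mul_conj_ne_zero w
      have h5 : 2 ≤ ‖w⁻¹‖ := by
        rw [norm_inv]
        have : 0 < ‖w‖ := norm_pos_iff.2 hw0
        rw [le_inv_comm₀ (by norm_num) this]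
        linarith
      have h6 : 1 + w⁻¹ * c w⁻¹ = (1 + w * c w) / (w * c w) := by
        simp only [hcdef, map_inv₀] at *
        field_simp
        ring
      have h7 : c w⁻¹ = (c w)⁻¹ := map_inv₀ _ _
      rw [h2, hE2 _ h5, hG]
      simp only
      rw [h6, h7, hB, h1]
      field_simp)
  refine ⟨ξ, hξ, fun z => ?_⟩
  have hd : ∀ y, HasDz (fun z : ℂ => ξ z) (4 * B y * ((1 + y * c y)⁻¹) ^ 2) y := by
    intro y
    simp only [hξe]
    refine ((hasDz_dzeta (hEs.differentiable (by simp) y)).add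
      (hasDz_cauchyTransform hNs hNc y)).congr_deriv ?_
    simp only [hN]
    ring
  rw [ethSq_eq_edthTwo, edthTwo_eq (.of_forall hd)
    ((hasDz_cauchyTransform hA's hA'c z).congr (.of_forall fun y => ?_))]
  · simp only [hA']
    ring
  · have h0 : 1 + y * c y ≠ 0 := one_add_mul_conj_ne_zero y
    simp only [P_eq]
    change ((1 + y * c y) / 2) ^ 2 * (4 * B y * ((1 + y * c y)⁻¹) ^ 2) = B y
    field_simp
    norm_num

/-- Every smooth quantity of spin weight `2` on the sphere is `ð² ξ` for a smooth function `ξ`. -/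
theorem IsSpinTwo.exists_ethSq_eq {S : ℂ → ℂ} (hS : IsSpinTwo S) :
    ∃ ξ : OnePoint ℂ → ℂ, SmoothOnSphere ξ ∧ S = ethSq ξ := by
  obtain ⟨hSs, T, hT, hTS⟩ := hS
  let χ : ContDiffBump (0 : ℂ) := ⟨1, 2, by norm_num, by norm_num⟩
  have hχT : ContDiff ℝ ∞ fun w => (χ w : ℂ) * T w :=
    (Complex.ofRealCLM.contDiff.comp χ.contDiff).mul hT
  have hχc : HasCompactSupport fun w => (χ w : ℂ) * T w :=
    HasCompactSupport.mul_right (χ.hasCompactSupport.comp_left (g := fun x : ℝ => (x : ℂ)) rfl)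
  -- The equation is solved first near `∞`, in the chart `w` with a cut-off source. What is left of
  -- `S` then vanishes for `|ζ| > 1` and so has compact support in `ζ`.
  obtain ⟨ξ₂, hξ₂, h₂⟩ := exists_ethSq_eq_of_hasCompactSupport hχT hχc
  have hξ₂' := hξ₂.comp_inversion
  obtain ⟨ξ₁, hξ₁, h₁⟩ := exists_ethSq_eq_of_hasCompactSupport
    (A := fun z => S z - ethSq (fun p => ξ₂ (inversion p)) z) (hSs.sub (contDiff_ethSq hξ₂')) (by
      refine HasCompactSupport.intro (K := Metric.closedBall 0 1) (isCompact_closedBall _ _)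
        fun z hz => ?_
      rw [mem_closedBall_zero_iff, not_le] at hz
      have hz0 : z ≠ 0 := by rintro rfl; norm_num at hz
      have h3 : χ z⁻¹ = 1 := χ.one_of_mem_closedBall (by
        rw [mem_closedBall_zero_iff, norm_inv]
        exact inv_le_one_of_one_le₀ hz.le)
      rw [ethSq_inversion hξ₂ hz0, h₂, h3, hTS _ (inv_ne_zero hz0), inv_inv, map_inv₀]
      have hz' : (starRingEnd ℂ) z ≠ 0 := (map_ne_zero _).2 hz0
      simp
      field_simp
      ring)
  refine ⟨fun p => ξ₁ p + ξ₂ (inversion p), fun i => (hξ₁ i).add (hξ₂' i), ?_⟩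
  funext z
  rw [ethSq_add hξ₁ hξ₂', h₁]
  ring

/-! ## Möbius transformations and conformal diffeomorphisms of the sphere -/

theorem chart_injective (i : Bool) : Function.Injective (chart i) := by
  intro x y h
  cases i
  · exact OnePoint.coe_injective h
  · by_cases hx : x = 0 <;> by_cases hy : y = 0
    · rw [hx, hy]
    · subst hx
      rw [chart_true_zero, chart_true_of_ne hy] at h
      exact (OnePoint.infty_ne_coe _ h).elim
    · subst hy
      rw [chart_true_zero, chart_true_of_ne hx] at h
      exact (OnePoint.coe_ne_infty _ h).elim
    · rw [chart_true_of_ne hx, chart_true_of_ne hy] at h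
      exact inv_injective (OnePoint.coe_injective h)

theorem exists_chart (p : OnePoint ℂ) : ∃ i z, chart i z = p := by
  induction p using OnePoint.rec with
  | infty => exact ⟨true, 0, chart_true_zero⟩
  | coe z => exact ⟨false, z, rfl⟩

/-! ### Homogeneous coordinates and the action of `SL(2, ℂ)` -/

/-- The point of the sphere with homogeneous coordinates `(x, y)`. -/
noncomputable def homPoint (x y : ℂ) : OnePoint ℂ :=
  if y = 0 then OnePoint.infty else ((x / y : ℂ) : OnePoint ℂ)

/-- The homogeneous coordinates of the points of a chart. -/
def chartVec : Bool → ℂ → ℂ × ℂ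
  | false, z => (z, 1)
  | true, w => (1, w)

theorem chartVec_ne_zero (i : Bool) (z : ℂ) : (chartVec i z).1 ≠ 0 ∨ (chartVec i z).2 ≠ 0 := by
  cases i <;> simp [chartVec]

theorem chart_eq_homPoint (i : Bool) (z : ℂ) :
    chart i z = homPoint (chartVec i z).1 (chartVec i z).2 := by
  cases i
  · simp [chartVec, homPoint]
  · simp [chartVec, homPoint, chart]

theorem homPoint_eq_chart_false {x y : ℂ} (hy : y ≠ 0) : homPoint x y = chart false (x / y) := by
  simp [homPoint, hy]

theorem homPoint_eq_chart_true {x y : ℂ} (hx : x ≠ 0) : homPoint x y = chart true (y / x) := by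
  by_cases hy : y = 0
  · simp [homPoint, hy]
  · rw [homPoint, if_neg hy, chart_true_of_ne (div_ne_zero hy hx), inv_div]

theorem ne_zero_of_homPoint_eq_chart_true {x y w : ℂ} (h0 : x ≠ 0 ∨ y ≠ 0)
    (h : homPoint x y = chart true w) : x ≠ 0 := by
  rintro rfl
  have hy : y ≠ 0 := by simpa using h0
  rw [homPoint_eq_chart_false hy, zero_div] at h
  by_cases hw : w = 0
  · subst hw
    rw [chart_true_zero] at h
    exact OnePoint.coe_ne_infty _ h
  · rw [chart_true_of_ne hw] at h
    exact inv_ne_zero hw (OnePoint.coe_injective h).symm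

theorem ne_zero_of_homPoint_eq_chart_false {x y w : ℂ} (h : homPoint x y = chart false w) :
    y ≠ 0 := by
  rintro rfl
  simp [homPoint] at h

/-- The group `SL(2, ℂ)`. -/
abbrev SL2C : Type := Matrix.SpecialLinearGroup (Fin 2) ℂ

/-- The action of `SL(2, ℂ)` on the sphere by Möbius transformations. -/
noncomputable def mobius : SL2C →* Equiv.Perm (OnePoint ℂ) :=
  (MulAction.toPermHom (Matrix.GeneralLinearGroup (Fin 2) ℂ) (OnePoint ℂ)).comp
    Matrix.SpecialLinearGroup.toGL

theorem SL2C.det_eq (g : SL2C) : g 0 0 * g 1 1 - g 0 1 * g 1 0 = 1 := by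
  have := g.det_coe
  rwa [Matrix.det_fin_two] at this

theorem exists_SL2C {a b c d : ℂ} (h : a * d - b * c = 1) :
    ∃ g : SL2C, g 0 0 = a ∧ g 0 1 = b ∧ g 1 0 = c ∧ g 1 1 = d :=
  ⟨⟨!![a, b; c, d], by rw [Matrix.det_fin_two_of, h]⟩, rfl, rfl, rfl, rfl⟩

theorem mobius_coe (g : SL2C) (z : ℂ) :
    mobius g z = homPoint (g 0 0 * z + g 0 1) (g 1 0 * z + g 1 1) :=
  OnePoint.smul_some_eq_ite

theorem mobius_infty (g : SL2C) : mobius g OnePoint.infty = homPoint (g 0 0) (g 1 0) :=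
  OnePoint.smul_infty_eq_ite _

theorem SL2C.image_ne_zero (g : SL2C) {x y : ℂ} (h : x ≠ 0 ∨ y ≠ 0) :
    g 0 0 * x + g 0 1 * y ≠ 0 ∨ g 1 0 * x + g 1 1 * y ≠ 0 := by
  by_contra! h'
  have hd := g.det_eq
  have hx : x = 0 := by linear_combination g 1 1 * h'.1 - g 0 1 * h'.2 - x * hd
  have hy : y = 0 := by linear_combination g 0 0 * h'.2 - g 1 0 * h'.1 - y * hd
  simp [hx, hy] at h

theorem mobius_homPoint (g : SL2C) {x y : ℂ} (h : x ≠ 0 ∨ y ≠ 0) :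
    mobius g (homPoint x y) = homPoint (g 0 0 * x + g 0 1 * y) (g 1 0 * x + g 1 1 * y) := by
  by_cases hy : y = 0
  · subst hy
    have hx : x ≠ 0 := by simpa using h
    have : homPoint x 0 = OnePoint.infty := by simp [homPoint]
    rw [this, mobius_infty]
    simp only [homPoint, mul_zero, add_zero, mul_eq_zero, hx, or_false]
    rw [mul_div_mul_right _ _ hx]
  · have : homPoint x y = ((x / y : ℂ) : OnePoint ℂ) := by simp [homPoint, hy]
    rw [this, mobius_coe]
    have e1 : g 1 0 * (x / y) + g 1 1 = (g 1 0 * x + g 1 1 * y) / y := by field_simp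
    have e2 : g 0 0 * (x / y) + g 0 1 = (g 0 0 * x + g 0 1 * y) / y := by field_simp
    simp only [homPoint, e1, e2, div_eq_zero_iff, hy, or_false, div_div_div_cancel_right₀ hy]

/-- The conformal factor of a Möbius transformation. -/
noncomputable def mobiusFactor (g : SL2C) (p : OnePoint ℂ) : ℝ :=
  p.elim (1 / (‖g 0 0‖ ^ 2 + ‖g 1 0‖ ^ 2)) fun z =>
    (1 + ‖z‖ ^ 2) / (‖g 0 0 * z + g 0 1‖ ^ 2 + ‖g 1 0 * z + g 1 1‖ ^ 2)

theorem norm_sq_add_norm_sq_pos {x y : ℂ} (h : x ≠ 0 ∨ y ≠ 0) : 0 < ‖x‖ ^ 2 + ‖y‖ ^ 2 := by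
  rcases h with h | h
  · have : 0 < ‖x‖ := norm_pos_iff.2 h
    positivity
  · have : 0 < ‖y‖ := norm_pos_iff.2 h
    positivity

/-- The factor is `|v|²/|gv|²` for any representative `v` of the point, since both norms scale
alike. In this form `∞` is no longer special. -/
theorem mobiusFactor_homPoint (g : SL2C) {x y : ℂ} (h : x ≠ 0 ∨ y ≠ 0) :
    mobiusFactor g (homPoint x y) = (‖x‖ ^ 2 + ‖y‖ ^ 2) /
      (‖g 0 0 * x + g 0 1 * y‖ ^ 2 + ‖g 1 0 * x + g 1 1 * y‖ ^ 2) := by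
  by_cases hy : y = 0
  · subst hy
    have hx : ‖x‖ ≠ 0 := by simpa using h
    have : homPoint x 0 = OnePoint.infty := by simp [homPoint]
    rw [this]
    simp only [mobiusFactor, OnePoint.elim_infty, mul_zero, add_zero, norm_mul, norm_zero]
    field_simp
    norm_num
  · have : homPoint x y = ((x / y : ℂ) : OnePoint ℂ) := by simp [homPoint, hy]
    rw [this]
    have hy' : ‖y‖ ≠ 0 := by simpa using hy
    have e1 : g 1 0 * (x / y) + g 1 1 = (g 1 0 * x + g 1 1 * y) / y := by field_simp
    have e2 : g 0 0 * (x / y) + g 0 1 = (g 0 0 * x + g 0 1 * y) / y := by field_simp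
    simp only [mobiusFactor, OnePoint.elim_some, e1, e2, norm_div]
    have h1 := (norm_sq_add_norm_sq_pos (g.image_ne_zero h)).ne'
    field_simp
    rw [add_comm]

theorem mobiusFactor_pos (g : SL2C) (p : OnePoint ℂ) : 0 < mobiusFactor g p := by
  obtain ⟨i, z, rfl⟩ := exists_chart p
  rw [chart_eq_homPoint, mobiusFactor_homPoint g (chartVec_ne_zero i z)]
  exact div_pos (norm_sq_add_norm_sq_pos (chartVec_ne_zero i z))
    (norm_sq_add_norm_sq_pos (g.image_ne_zero (chartVec_ne_zero i z)))

/-- In any two charts a Möbius transformation is a fractional linear map. -/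
theorem mobius_chart (g : SL2C) {i j : Bool} {z w : ℂ} (h : mobius g (chart i z) = chart j w) :
    ∃ a b c d : ℂ, ‖a * d - b * c‖ = 1 ∧ c * z + d ≠ 0 ∧ w = (a * z + b) / (c * z + d) ∧
      (∀ y, c * y + d ≠ 0 → mobius g (chart i y) = chart j ((a * y + b) / (c * y + d))) ∧
      ∀ y, mobiusFactor g (chart i y) =
        (1 + ‖y‖ ^ 2) / (‖a * y + b‖ ^ 2 + ‖c * y + d‖ ^ 2) := by
  have key : ∀ y, mobius g (chart i y) = homPoint (g 0 0 * (chartVec i y).1 + g 0 1 *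
      (chartVec i y).2) (g 1 0 * (chartVec i y).1 + g 1 1 * (chartVec i y).2) := fun y => by
    rw [chart_eq_homPoint, mobius_homPoint g (chartVec_ne_zero i y)]
  have keyK : ∀ y, mobiusFactor g (chart i y) = _ := fun y => by
    rw [chart_eq_homPoint, mobiusFactor_homPoint g (chartVec_ne_zero i y)]
  have hdet := g.det_eq
  have hne := g.image_ne_zero (chartVec_ne_zero i z)
  rw [key] at h
  simp only [key, keyK]
  -- Switching one of the two charts interchanges rows or columns of the matrix and changes the sign
  -- of the determinant, so only its norm is `1` in general.
  cases i <;> cases j <;> simp only [chartVec, mul_one] at *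
  · have h1 := ne_zero_of_homPoint_eq_chart_false h
    refine ⟨g 0 0, g 0 1, g 1 0, g 1 1, by rw [hdet, norm_one], h1, ?_,
      fun y hy => homPoint_eq_chart_false hy, fun y => by simp [add_comm]⟩
    rw [homPoint_eq_chart_false h1] at h
    exact (chart_injective _ h).symm
  · have h1 := ne_zero_of_homPoint_eq_chart_true hne h
    refine ⟨g 1 0, g 1 1, g 0 0, g 0 1, ?_, h1, ?_,
      fun y hy => homPoint_eq_chart_true hy, fun y => by simp [add_comm]⟩
    · rw [show g 1 0 * g 0 1 - g 1 1 * g 0 0 = -(1 : ℂ) by linear_combination -hdet]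
      simp
    rw [homPoint_eq_chart_true h1] at h
    exact (chart_injective _ h).symm
  · have h1 := ne_zero_of_homPoint_eq_chart_false h
    refine ⟨g 0 1, g 0 0, g 1 1, g 1 0, ?_, by rwa [add_comm], ?_,
      fun y hy => ?_, fun y => by simp [add_comm]⟩
    · rw [show g 0 1 * g 1 0 - g 0 0 * g 1 1 = -(1 : ℂ) by linear_combination -hdet]
      simp
    · rw [homPoint_eq_chart_false h1] at h
      rw [add_comm (g 0 1 * z), add_comm (g 1 1 * z)]
      exact (chart_injective _ h).symm
    · rw [add_comm] at hy
      rw [add_comm (g 0 1 * y), add_comm (g 1 1 * y), homPoint_eq_chart_false hy]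
  · have h1 := ne_zero_of_homPoint_eq_chart_true hne h
    refine ⟨g 1 1, g 1 0, g 0 1, g 0 0, ?_, by rwa [add_comm], ?_,
      fun y hy => ?_, fun y => by simp [add_comm]⟩
    · rw [show g 1 1 * g 0 0 - g 1 0 * g 0 1 = (1 : ℂ) by linear_combination hdet]
      simp
    · rw [homPoint_eq_chart_true h1] at h
      rw [add_comm (g 0 1 * z), add_comm (g 1 1 * z)]
      exact (chart_injective _ h).symm
    · rw [add_comm] at hy
      rw [add_comm (g 0 1 * y), add_comm (g 1 1 * y), homPoint_eq_chart_true hy]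

theorem hasDerivAt_fractional (a b : ℂ) {c d z : ℂ} (hz : c * z + d ≠ 0) :
    HasDerivAt (fun y => (a * y + b) / (c * y + d)) ((a * d - b * c) / (c * z + d) ^ 2) z := by
  have hA : HasDerivAt (fun y : ℂ => a * y + b) a z := by
    simpa using ((hasDerivAt_id z).const_mul a).add_const b
  have hQ : HasDerivAt (fun y : ℂ => c * y + d) c z := by
    simpa using ((hasDerivAt_id z).const_mul c).add_const d
  refine (hA.div hQ hz).congr_deriv ?_
  ring

/-- The determinant of multiplication by a complex number, as a real linear map, is its field norm.
-/
theorem det_real_of_complex_deriv {h : ℂ → ℂ} {h' z : ℂ} (hh : HasDerivAt h h' z) :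
    (fderiv ℝ h z).det = Complex.normSq h' := by
  rw [(hh.hasFDerivAt.restrictScalars ℝ).fderiv, ← Algebra.norm_complex_apply, Algebra.norm_apply]
  unfold ContinuousLinearMap.det
  congr 1
  ext x
  simp [mul_comm]

theorem isConformal_mobius (g : SL2C) : IsConformal (mobius g) (mobiusFactor g) := by
  refine ⟨mobiusFactor_pos g, fun i j z w h => ?_⟩
  obtain ⟨a, b, c, d, hdet, hz, hw, hloc, hK⟩ := mobius_chart g h
  have hd := hasDerivAt_fractional a b hz
  have hne : ∀ᶠ y in 𝓝 z, c * y + d ≠ 0 :=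
    (Continuous.continuousAt (by fun_prop)).eventually_ne hz
  refine ⟨fun y => (a * y + b) / (c * y + d), hne.mono hloc, ?_, ?_, ?_⟩
  · have h1 : AnalyticAt ℂ (fun y => (a * y + b) / (c * y + d)) z :=
      AnalyticAt.div (by fun_prop) (by fun_prop) hz
    exact h1.contDiffAt.restrict_scalars ℝ
  · intro v
    have hz' : ‖c * z + d‖ ≠ 0 := norm_ne_zero_iff.2 hz
    rw [(hd.hasFDerivAt.restrictScalars ℝ).fderiv, hK]
    simp [hdet]
    rw [hw, P, P, norm_div]
    have h1 : ‖a * z + b‖ ^ 2 + ‖c * z + d‖ ^ 2 ≠ 0 := by positivity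
    have h2 : 1 + ‖z‖ ^ 2 ≠ 0 := by positivity
    field_simp
    ring
  · rw [det_real_of_complex_deriv hd, Complex.normSq_pos]
    refine div_ne_zero ?_ (pow_ne_zero 2 hz)
    rw [← norm_ne_zero_iff, hdet]
    exact one_ne_zero

/-! ### Conformal diffeomorphisms are holomorphic, hence Möbius -/

theorem clm_det_complex (L : ℂ →L[ℝ] ℂ) : L.det = (L 1).re * (L I).im - (L I).re * (L 1).im := by
  unfold ContinuousLinearMap.det
  rw [← LinearMap.det_toMatrix Complex.basisOneI, Matrix.det_fin_two]
  simp [LinearMap.toMatrix_apply]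

/-- An orientation preserving conformal real linear map of `ℂ` is complex linear. -/
theorem apply_I_of_conformal {L : ℂ →L[ℝ] ℂ} {k : ℝ} (h : ∀ v, ‖L v‖ = k * ‖v‖) (hd : 0 < L.det) :
    L I = I * L 1 := by
  rw [clm_det_complex] at hd
  have h1 := congrArg (· ^ 2) (h 1)
  have h2 := congrArg (· ^ 2) (h I)
  have h3 := congrArg (· ^ 2) (h (1 + I))
  have e : ‖(1 + I : ℂ)‖ ^ 2 = 2 := by
    rw [← Complex.normSq_eq_norm_sq, Complex.normSq_apply]; simp; norm_num
  simp only [mul_pow, e] at h1 h2 h3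
  rw [map_add] at h3
  simp only [← Complex.normSq_eq_norm_sq, Complex.normSq_apply] at h1 h2 h3
  simp at h1 h2 h3
  generalize L 1 = p at *
  generalize L I = q at *
  -- The norms at `1`, `I` and `1 + I` show that `p` and `q` are orthogonal of length `|k|`, so the
  -- determinant is `± k²` and its sign selects `+`. Then `|q - i p|² = 0`.
  have h4 : (p.re * q.im - q.re * p.im) = k ^ 2 := by
    have h5 : p.re * q.re + p.im * q.im = 0 := by linarith
    have h6 : (p.re * q.im - q.re * p.im) ^ 2 = (k ^ 2) ^ 2 := by
      have : (p.re * q.im - q.re * p.im) ^ 2 = (p.re * p.re + p.im * p.im) *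
        (q.re * q.re + q.im * q.im) - (p.re * q.re + p.im * q.im) ^ 2 := by ring
      rw [this, h1, h2, h5]; ring
    exact (pow_left_inj₀ hd.le (sq_nonneg k) two_ne_zero).1 h6
  have h7 : (q.re + p.im) ^ 2 + (q.im - p.re) ^ 2 = 0 := by
    linear_combination h1 + h2 - 2 * h4
  have h8 : q.re + p.im = 0 := by nlinarith [sq_nonneg (q.re + p.im), sq_nonneg (q.im - p.re)]
  have h9 : q.im - p.re = 0 := by nlinarith [sq_nonneg (q.re + p.im), sq_nonneg (q.im - p.re)]
  apply Complex.ext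
  · simp; linarith
  · simp; linarith

/-- The real differential is complex linear by `apply_I_of_conformal`, so the local expression
satisfies the Cauchy-Riemann equations, and `K` is read off from the modulus of its derivative. -/
theorem IsConformal.exists_holomorphic {f : Equiv.Perm (OnePoint ℂ)} {K : OnePoint ℂ → ℝ}
    (hf : IsConformal f K) {i j : Bool} {z w : ℂ} (h : f (chart i z) = chart j w) :
    ∃ (g : ℂ → ℂ) (g' : ℂ), (∀ᶠ y in 𝓝 z, f (chart i y) = chart j (g y)) ∧ g z = w ∧
      HasDerivAt g g' z ∧ g' ≠ 0 ∧ ‖g'‖ / P w = K (chart i z) / P z := by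
  obtain ⟨g, hg, hs, hn, hd⟩ := hf.2 i j z w h
  have hgz : g z = w := chart_injective j (hg.self_of_nhds.symm.trans h)
  have hn' : ∀ v, ‖fderiv ℝ g z v‖ = (K (chart i z) * P w / P z) * ‖v‖ := fun v => by
    have h1 := hn v
    have := (P_pos w).ne'
    field_simp at h1
    rw [h1]
    ring
  have hD : DifferentiableAt ℂ g z := by
    rw [differentiableAt_complex_iff_differentiableAt_real]
    exact ⟨hs.differentiableAt (by simp), apply_I_of_conformal hn' hd⟩
  have hn1 : ‖deriv g z‖ = K (chart i z) * P w / P z := by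
    have h1 := hn' 1
    rw [(hD.hasDerivAt.hasFDerivAt.restrictScalars ℝ).fderiv] at h1
    simpa using h1
  refine ⟨g, deriv g z, hg, hgz, hD.hasDerivAt, ?_, ?_⟩
  · rw [← norm_ne_zero_iff, hn1]
    have := hf.1 (chart i z)
    have := P_pos w
    have := P_pos z
    positivity
  · have := (P_pos w).ne'
    rw [hn1]
    field_simp

/-- Two local expressions of `f` in the same charts agree near the point, so they have the same
derivative, which determines `K`. -/
theorem IsConformal.factor_unique {f : Equiv.Perm (OnePoint ℂ)} {K K' : OnePoint ℂ → ℝ}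
    (h : IsConformal f K) (h' : IsConformal f K') : K = K' := by
  funext p
  obtain ⟨i, z, rfl⟩ := exists_chart p
  obtain ⟨j, w, hw⟩ := exists_chart (f (chart i z))
  obtain ⟨g, g', h1, -, h3, -, h5⟩ := h.exists_holomorphic hw.symm
  obtain ⟨k, k', h1', -, h3', -, h5'⟩ := h'.exists_holomorphic hw.symm
  have e : g =ᶠ[𝓝 z] k := by
    filter_upwards [h1, h1'] with y hy hy'
    exact chart_injective j (hy.symm.trans hy')
  have e' : g' = k' := h3.unique (h3'.congr_of_eventuallyEq e)
  rw [← e', h5] at h5'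
  have := (P_pos z).ne'
  field_simp at h5'
  exact h5'

theorem IsConformal.comp {f f' : Equiv.Perm (OnePoint ℂ)} {K K' : OnePoint ℂ → ℝ}
    (h' : IsConformal f' K') (h : IsConformal f K) :
    IsConformal (f' * f) (fun p => K' (f p) * K p) := by
  refine ⟨fun p => mul_pos (h'.1 _) (h.1 _), fun i k z w hw => ?_⟩
  obtain ⟨j, y, hy⟩ := exists_chart (f (chart i z))
  obtain ⟨g, hg, hs, hn, hd⟩ := h.2 i j z y hy.symm
  have hgz : g z = y := chart_injective j (hg.self_of_nhds.symm.trans hy.symm)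
  rw [Equiv.Perm.mul_apply, ← hy] at hw
  obtain ⟨g', hg', hs', hn', hd'⟩ := h'.2 j k y w hw
  subst hgz
  have hc := (hs'.differentiableAt (by simp)).hasFDerivAt.comp z
    (hs.differentiableAt (by simp)).hasFDerivAt
  refine ⟨g' ∘ g, ?_, hs'.comp z hs, fun v => ?_, ?_⟩
  · filter_upwards [hg, hs.continuousAt.eventually hg'] with x hx hx'
    rw [Equiv.Perm.mul_apply, hx, hx']
    rfl
  · rw [hc.fderiv, ContinuousLinearMap.comp_apply, hn', hn]
    simp only [← hy]
    ring
  · rw [hc.fderiv, ContinuousLinearMap.det, ContinuousLinearMap.toLinearMap_comp, LinearMap.det_comp]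
    exact mul_pos hd' hd

/-- On the finite plane `f` is an entire function. Its derivative at `∞` in the coordinate `1/ζ` is
nonzero, which gives linear growth, so `f` is affine. -/
theorem exists_mobius_of_fix_infty {f : Equiv.Perm (OnePoint ℂ)} {K : OnePoint ℂ → ℝ}
    (hf : IsConformal f K) (hinf : f OnePoint.infty = OnePoint.infty) : ∃ g : SL2C, f = mobius g := by
  have hfin : ∀ z : ℂ, ∃ w : ℂ, f z = w := fun z => by
    have : f z ≠ OnePoint.infty := by
      rw [← hinf]
      exact f.injective.ne (OnePoint.coe_ne_infty z)
    obtain ⟨w, hw⟩ := OnePoint.ne_infty_iff_exists.1 this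
    exact ⟨w, hw.symm⟩
  choose F hF using hfin
  have hFd : Differentiable ℂ F := fun z => by
    obtain ⟨g, g', h1, -, h3, -, -⟩ := hf.exists_holomorphic (i := false) (j := false) (hF z)
    have e : F =ᶠ[𝓝 z] g := by
      filter_upwards [h1] with y hy
      exact chart_injective false ((hF y).symm.trans hy)
    exact (h3.congr_of_eventuallyEq e).differentiableAt
  obtain ⟨g, g', h1, h2, h3, h4, -⟩ := hf.exists_holomorphic (i := true) (j := true) (z := 0)
    (w := 0) (by rw [chart_true_zero, hinf])
  -- A nonzero derivative bounds `|w|` by a multiple of `|g w|`; inverted, this bounds `|F ζ|` by a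
  -- multiple of `|ζ|`.
  have hO := HasDerivAtFilter.isTheta_sub h3 h4
  obtain ⟨c, hc⟩ := hO.isBigO_symm.bound
  have hgrow : ∀ᶠ w in 𝓝[≠] (0 : ℂ), ‖F w⁻¹‖ ≤ c * ‖w⁻¹‖ := by
    have hc' : ∀ᶠ w in 𝓝 (0 : ℂ), ‖w‖ ≤ c * ‖g w‖ := by
      have := (Filter.tendsto_id.prodMk (Filter.tendsto_const_pure (b := (0 : ℂ)))).eventually hc
      simpa [h2] using this
    filter_upwards [nhdsWithin_le_nhds h1, nhdsWithin_le_nhds hc', self_mem_nhdsWithin]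
      with w hw1 hw2 hw0
    have hg0 : g w ≠ 0 := by
      intro h0
      rw [h0, chart_true_zero, ← hinf] at hw1
      have := f.injective hw1
      rw [← chart_true_zero] at this
      exact hw0 (chart_injective true this)
    rw [chart_true_of_ne hw0, chart_true_of_ne hg0, hF] at hw1
    rw [OnePoint.coe_injective hw1, norm_inv, norm_inv]
    have hw0' : 0 < ‖w‖ := norm_pos_iff.2 hw0
    have hg0' : 0 < ‖g w‖ := norm_pos_iff.2 hg0
    rw [← div_eq_mul_inv, inv_le_comm₀ hg0' (by
      have : 0 < c := by
        by_contra hneg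
        nlinarith [not_lt.1 hneg]
      positivity), inv_div, div_le_iff₀ (by
        by_contra hneg
        nlinarith [not_lt.1 hneg])]
    linarith
  obtain ⟨R, hR, hFR⟩ := tendsto_inv_nhdsNE_zero_of_eventually
    (p := fun z => ‖F z‖ ≤ c * ‖z‖) hgrow
  obtain ⟨D, hD⟩ := (isCompact_closedBall (0 : ℂ) R).exists_bound_of_continuousOn
    hFd.continuous.continuousOn
  obtain ⟨p, hp, hpe⟩ := exists_polynomial_of_growth 1 hFd (C := max c D) (by
    intro z hz
    rw [pow_one]
    rcases le_or_gt ‖z‖ R with hz' | hz'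
    · have h5 := hD z (by simpa using hz')
      have h6 : 0 ≤ D := (norm_nonneg _).trans h5
      calc ‖F z‖ ≤ D := h5
        _ ≤ D * ‖z‖ := le_mul_of_one_le_right h6 hz
        _ ≤ _ := by gcongr; exact le_max_right _ _
    · refine (hFR z hz').trans ?_
      gcongr
      exact le_max_left _ _)
  have hpe' : ∀ z, F z = p.coeff 0 + p.coeff 1 * z := fun z => by
    rw [hpe, Polynomial.eval_eq_sum_range' (n := 2) (by omega)]
    simp [Finset.sum_range_succ]
  have hp1 : p.coeff 1 ≠ 0 := by
    intro h0
    have e : F 0 = F 1 := by rw [hpe', hpe', h0]; ring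
    have := f.injective ((hF 0).trans ((congrArg _ e).trans (hF 1).symm))
    exact zero_ne_one (OnePoint.coe_injective this)
  -- A square root of the slope normalises the matrix of the affine map to determinant `1`.
  obtain ⟨s, hs⟩ := IsAlgClosed.exists_pow_nat_eq (p.coeff 1) (n := 2) (by norm_num)
  have hs0 : s ≠ 0 := by rintro rfl; apply hp1; rw [← hs]; simp
  obtain ⟨g, ha, hb, hc, hd⟩ := exists_SL2C (a := s) (b := p.coeff 0 / s) (c := 0) (d := 1 / s)
    (by field_simp; simp)
  refine ⟨g, ?_⟩
  ext q
  induction q using OnePoint.rec with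
  | infty => rw [hinf, mobius_infty, hc]; simp [homPoint]
  | coe z =>
    rw [hF, mobius_coe, hpe', ha, hb, hc, hd]
    simp [homPoint, hs0]
    rw [← hs]
    field_simp
    ring

/-- The orientation preserving conformal diffeomorphisms of the sphere are the Möbius
transformations. -/
theorem IsConformal.exists_mobius {f : Equiv.Perm (OnePoint ℂ)} {K : OnePoint ℂ → ℝ}
    (hf : IsConformal f K) : ∃ g : SL2C, f = mobius g ∧ K = mobiusFactor g := by
  -- If `f(∞) = c` is finite, `ζ ↦ -1/(ζ - c)` brings it back to `∞`.
  obtain ⟨g₀, hg₀⟩ : ∃ g₀ : SL2C, mobius g₀ (f OnePoint.infty) = OnePoint.infty := by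
    induction hq : f OnePoint.infty using OnePoint.rec with
    | infty => exact ⟨1, by simp⟩
    | coe c =>
      obtain ⟨g, -, -, h1, h2⟩ := exists_SL2C (a := 0) (b := -1) (c := 1) (d := -c) (by ring)
      refine ⟨g, ?_⟩
      rw [mobius_coe, h1, h2]
      simp [homPoint]
  obtain ⟨g₁, hg₁⟩ := exists_mobius_of_fix_infty ((isConformal_mobius g₀).comp hf) hg₀
  have e : f = mobius (g₀⁻¹ * g₁) := by
    rw [map_mul, map_inv, ← hg₁]
    simp
  exact ⟨_, e, (e ▸ hf).factor_unique (isConformal_mobius _)⟩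

/-! ## One-sided partial derivatives at null infinity -/

theorem uniqueDiffOn_halfSpace : UniqueDiffOn ℝ halfSpace := by
  apply uniqueDiffOn_convex
  · exact (convex_Ici (0 : ℝ)).linear_preimage (LinearMap.proj (R := ℝ) (φ := fun _ : Fin 4 => ℝ) 1)
  · refine ⟨fun _ => 1, mem_interior.2 ⟨{X | 0 < X 1}, fun X (hX : 0 < X 1) => hX.le, ?_, by simp⟩⟩
    exact isOpen_lt continuous_const (continuous_apply 1)

/-- `F` is differentiable at `X` within the half-space, with partial derivative `F'` in the
direction `a`. -/
def HasPd (F : (Fin 4 → ℝ) → ℝ) (a : Fin 4) (F' : ℝ) (X : Fin 4 → ℝ) : Prop :=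
  DifferentiableWithinAt ℝ F halfSpace X ∧ (X ∈ halfSpace → pd halfSpace F a X = F')

theorem hasPd_of_hasFDerivWithinAt {F : (Fin 4 → ℝ) → ℝ} {L : (Fin 4 → ℝ) →L[ℝ] ℝ}
    {X : Fin 4 → ℝ} (h : HasFDerivWithinAt F L halfSpace X) (a : Fin 4) :
    HasPd F a (L (Pi.single a 1)) X :=
  ⟨h.differentiableWithinAt, fun hX => by
    rw [pd, h.fderivWithin (uniqueDiffOn_halfSpace X hX)]⟩

theorem HasPd.hasFDerivWithinAt {F : (Fin 4 → ℝ) → ℝ} {a : Fin 4} {F' : ℝ} {X : Fin 4 → ℝ}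
    (h : HasPd F a F' X) : HasFDerivWithinAt F (fderivWithin ℝ F halfSpace X) halfSpace X :=
  h.1.hasFDerivWithinAt

theorem HasPd.congr_deriv {F : (Fin 4 → ℝ) → ℝ} {a : Fin 4} {F' F'' : ℝ} {X : Fin 4 → ℝ}
    (h : HasPd F a F' X) (e : F' = F'') : HasPd F a F'' X := e ▸ h

theorem hasPd_const (c : ℝ) (a : Fin 4) (X : Fin 4 → ℝ) : HasPd (fun _ => c) a 0 X :=
  hasPd_of_hasFDerivWithinAt (hasFDerivWithinAt_const c X halfSpace) a

theorem HasPd.add {F G : (Fin 4 → ℝ) → ℝ} {a : Fin 4} {F' G' : ℝ} {X : Fin 4 → ℝ}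
    (h : HasPd F a F' X) (k : HasPd G a G' X) : HasPd (fun Y => F Y + G Y) a (F' + G') X :=
  ⟨h.1.add k.1, fun hX =>
    ((hasPd_of_hasFDerivWithinAt (h.hasFDerivWithinAt.add k.hasFDerivWithinAt) a).2 hX).trans (by
      rw [← h.2 hX, ← k.2 hX]
      rfl)⟩

theorem HasPd.neg {F : (Fin 4 → ℝ) → ℝ} {a : Fin 4} {F' : ℝ} {X : Fin 4 → ℝ}
    (h : HasPd F a F' X) : HasPd (fun Y => -F Y) a (-F') X :=
  ⟨h.1.neg, fun hX =>
    ((hasPd_of_hasFDerivWithinAt h.hasFDerivWithinAt.neg a).2 hX).trans (by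
      rw [← h.2 hX]
      rfl)⟩

theorem HasPd.sub {F G : (Fin 4 → ℝ) → ℝ} {a : Fin 4} {F' G' : ℝ} {X : Fin 4 → ℝ}
    (h : HasPd F a F' X) (k : HasPd G a G' X) : HasPd (fun Y => F Y - G Y) a (F' - G') X := by
  simpa only [sub_eq_add_neg] using h.add k.neg

theorem HasPd.mul {F G : (Fin 4 → ℝ) → ℝ} {a : Fin 4} {F' G' : ℝ} {X : Fin 4 → ℝ}
    (h : HasPd F a F' X) (k : HasPd G a G' X) :
    HasPd (fun Y => F Y * G Y) a (F' * G X + F X * G') X :=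
  ⟨h.1.mul k.1, fun hX =>
    ((hasPd_of_hasFDerivWithinAt (h.hasFDerivWithinAt.mul k.hasFDerivWithinAt) a).2 hX).trans (by
      rw [← h.2 hX, ← k.2 hX]
      simp [pd]
      ring)⟩

theorem hasPd_coord (i a : Fin 4) (X : Fin 4 → ℝ) :
    HasPd (fun Y => Y i) a (if a = i then 1 else 0) X := by
  refine (hasPd_of_hasFDerivWithinAt (hasFDerivAt_apply i X).hasFDerivWithinAt a).congr_deriv ?_
  simp [Pi.single_apply, eq_comm]

/-- The projection of a space-time point to its coordinate `ζ`, as a linear map. -/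
noncomputable def zetaCLM : (Fin 4 → ℝ) →L[ℝ] ℂ :=
  (ContinuousLinearMap.proj 2).smulRight (1 : ℂ) + (ContinuousLinearMap.proj 3).smulRight I

theorem zetaCLM_apply (X : Fin 4 → ℝ) : zetaCLM X = zeta X := by
  apply Complex.ext <;> simp [zetaCLM, zeta]

/-- The directions of the coordinates `u, ℓ, x, y` in the plane of `ζ = x + i y`. -/
def planeDir : Fin 4 → ℂ := ![0, 0, 1, I]

theorem zeta_single (a : Fin 4) : zeta (Pi.single a 1) = planeDir a := by
  fin_cases a <;> apply Complex.ext <;> simp [zeta, planeDir]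

theorem hasFDerivAt_comp_zeta {φ : ℂ → ℝ} {X : Fin 4 → ℝ} (h : DifferentiableAt ℝ φ (zeta X)) :
    HasFDerivAt (fun Y => φ (zeta Y)) ((fderiv ℝ φ (zeta X)).comp zetaCLM) X := by
  have h1 : HasFDerivAt (fun Y => zeta Y) zetaCLM X := by
    rw [← funext zetaCLM_apply]
    exact zetaCLM.hasFDerivAt
  exact h.hasFDerivAt.comp X h1

theorem hasPd_comp_zeta {φ : ℂ → ℝ} {X : Fin 4 → ℝ} (h : DifferentiableAt ℝ φ (zeta X))
    (a : Fin 4) : HasPd (fun Y => φ (zeta Y)) a (fderiv ℝ φ (zeta X) (planeDir a)) X := by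
  refine (hasPd_of_hasFDerivWithinAt (hasFDerivAt_comp_zeta h).hasFDerivWithinAt a).congr_deriv ?_
  rw [ContinuousLinearMap.comp_apply, zetaCLM_apply, zeta_single]

/-- A tangential derivative at null infinity only depends on the values at null infinity. -/
theorem HasPd.congr_boundary {F G : (Fin 4 → ℝ) → ℝ} {a : Fin 4} {G' : ℝ} {X : Fin 4 → ℝ}
    (hG : HasPd G a G' X) (hF : DifferentiableWithinAt ℝ F halfSpace X) (hX : X 1 = 0)
    (ha : a ≠ 1) (h : ∀ Y : Fin 4 → ℝ, Y 1 = 0 → F Y = G Y) : HasPd F a G' X := by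
  refine ⟨hF, fun hX' => ?_⟩
  rw [← hG.2 hX', pd, pd]
  set s : Set (Fin 4 → ℝ) := {Y | Y 1 = 0}
  have hs : s ⊆ halfSpace := fun Y hY => (show Y 1 = 0 from hY).ge
  have hγ : HasDerivAt (fun t : ℝ => X + t • (Pi.single a 1 : Fin 4 → ℝ)) (Pi.single a 1) 0 := by
    simpa using ((hasDerivAt_id (0 : ℝ)).smul_const (Pi.single a 1 : Fin 4 → ℝ)).const_add X
  have hm : ∀ t : ℝ, X + t • (Pi.single a 1 : Fin 4 → ℝ) ∈ s := fun t => by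
    simp [s, hX, ha.symm]
  have e : ∀ H : (Fin 4 → ℝ) → ℝ, DifferentiableWithinAt ℝ H halfSpace X →
      HasDerivAt (fun t : ℝ => H (X + t • (Pi.single a 1 : Fin 4 → ℝ)))
        (fderivWithin ℝ H halfSpace X (Pi.single a 1)) 0 := fun H hH => by
    rw [← hasDerivWithinAt_univ]
    refine HasFDerivWithinAt.comp_hasDerivWithinAt (t := halfSpace) 0 ?_ hγ.hasDerivWithinAt
      fun t _ => hs (hm t)
    simpa using hH.hasFDerivWithinAt
  refine (e F hF).unique ((e G hG.1).congr_of_eventuallyEq (.of_forall fun t => ?_))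
  exact h _ (hm t)

open Filter Asymptotics in
-- The one-sided derivative is the limit of the difference quotients along `ℓ > 0`, and these are
-- `O(ℓ)`.
theorem hasPd_one_of_isBigO {F : (Fin 4 → ℝ) → ℝ} {X : Fin 4 → ℝ} (hX : X 1 = 0)
    (hF : DifferentiableWithinAt ℝ F halfSpace X) (h0 : F X = 0)
    (h : (fun ℓ : ℝ => F ![X 0, ℓ, X 2, X 3]) =O[𝓝[>] 0] fun ℓ => ℓ ^ 2) : HasPd F 1 0 X := by
  refine ⟨hF, fun _ => ?_⟩
  have hl : ∀ t : ℝ, X + t • (Pi.single 1 1 : Fin 4 → ℝ) = ![X 0, t, X 2, X 3] := fun t => by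
    ext i; fin_cases i <;> simp [hX]
  have hγ : HasDerivAt (fun t : ℝ => X + t • (Pi.single 1 1 : Fin 4 → ℝ)) (Pi.single 1 1) 0 := by
    simpa using ((hasDerivAt_id (0 : ℝ)).smul_const (Pi.single 1 1 : Fin 4 → ℝ)).const_add X
  have h1 : HasDerivWithinAt (fun t : ℝ => F (X + t • (Pi.single 1 1 : Fin 4 → ℝ)))
      (fderivWithin ℝ F halfSpace X (Pi.single 1 1)) (Set.Ioi 0) 0 := by
    refine HasFDerivWithinAt.comp_hasDerivWithinAt (t := halfSpace) 0 ?_ hγ.hasDerivWithinAt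
      fun t ht => ?_
    · simpa using hF.hasFDerivWithinAt
    · simpa [halfSpace, hX] using (show (0 : ℝ) < t from ht).le
  rw [hasDerivWithinAt_iff_tendsto_slope' (by simp)] at h1
  have h2 : Tendsto (fun t : ℝ => t⁻¹ * F ![X 0, t, X 2, X 3]) (𝓝[>] 0) (𝓝 0) := by
    have h3 : (fun t : ℝ => t⁻¹ * F ![X 0, t, X 2, X 3]) =O[𝓝[>] 0] fun t => t := by
      refine ((isBigO_refl (fun t : ℝ => t⁻¹) _).mul h).congr' .rfl ?_
      filter_upwards [self_mem_nhdsWithin] with t ht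
      have : t ≠ 0 := (show (0 : ℝ) < t from ht).ne'
      field_simp
    exact h3.trans_tendsto (tendsto_nhdsWithin_of_tendsto_nhds tendsto_id)
  refine tendsto_nhds_unique h1 (h2.congr fun t => ?_)
  simp [slope_def_field, hl, h0, ← hl 0]
  ring

theorem SmoothNearScri.contDiffWithinAt {F : (Fin 4 → ℝ) → ℝ} (h : SmoothNearScri F)
    {X : Fin 4 → ℝ} (hX : X 1 = 0) : ContDiffWithinAt ℝ ∞ F halfSpace X := by
  obtain ⟨ε, hε, h⟩ := h (X 0 - 1) (X 0 + 1)
  refine (h X ⟨by simp, by simp [hX, hε]⟩).mono_of_mem_nhdsWithin ?_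
  have h1 : {Y : Fin 4 → ℝ | Y 0 ∈ Set.Ioo (X 0 - 1) (X 0 + 1) ∧ Y 1 < ε} ∈ 𝓝 X := by
    refine IsOpen.mem_nhds ?_ ⟨by simp, by simp [hX, hε]⟩
    exact (isOpen_Ioo.preimage (continuous_apply 0)).inter
      (isOpen_lt (continuous_apply 1) continuous_const)
  filter_upwards [nhdsWithin_le_nhds h1, self_mem_nhdsWithin] with Y hY hY'
  exact ⟨hY.1, hY', hY.2⟩

theorem SmoothNearScri.differentiableWithinAt {F : (Fin 4 → ℝ) → ℝ} (h : SmoothNearScri F)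
    {X : Fin 4 → ℝ} (hX : X 1 = 0) : DifferentiableWithinAt ℝ F halfSpace X :=
  (h.contDiffWithinAt hX).differentiableWithinAt (by simp)

open Filter Asymptotics in
-- The expansions are stated for `ℓ > 0` only; continuity up to null infinity carries them to the
-- boundary value.
theorem SmoothNearScri.eq_of_isBigO {F : (Fin 4 → ℝ) → ℝ} (h : SmoothNearScri F)
    {X : Fin 4 → ℝ} (hX : X 1 = 0) {φ : ℝ → ℝ} (hφ : Continuous φ) {n : ℕ} (hn : n ≠ 0)
    (hO : (fun ℓ : ℝ => F ![X 0, ℓ, X 2, X 3] - φ ℓ) =O[𝓝[>] 0] fun ℓ => ℓ ^ n) : F X = φ 0 := by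
  have e : ![X 0, 0, X 2, X 3] = X := by
    ext i; fin_cases i <;> simp [hX]
  have h1 : Tendsto (fun ℓ : ℝ => F ![X 0, ℓ, X 2, X 3]) (𝓝[>] 0) (𝓝 (F X)) := by
    refine (h.contDiffWithinAt hX).continuousWithinAt.tendsto.comp ?_
    refine tendsto_nhdsWithin_of_tendsto_nhds_of_eventually_within _ ?_ ?_
    · have : Continuous fun ℓ : ℝ => (![X 0, ℓ, X 2, X 3] : Fin 4 → ℝ) := by
        refine continuous_pi fun i => ?_
        fin_cases i <;> simp <;> fun_prop
      have := this.tendsto 0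
      rw [e] at this
      exact this.mono_left nhdsWithin_le_nhds
    · filter_upwards [self_mem_nhdsWithin] with t ht
      exact (show (0 : ℝ) < t from ht).le
  have h2 : Tendsto (fun ℓ : ℝ => F ![X 0, ℓ, X 2, X 3] - φ ℓ) (𝓝[>] 0) (𝓝 0) := by
    refine hO.trans_tendsto (tendsto_nhdsWithin_of_tendsto_nhds ?_)
    have := (continuous_pow n).tendsto (0 : ℝ)
    rwa [zero_pow hn] at this
  have h3 := tendsto_nhds_unique h2
    (h1.sub ((hφ.tendsto 0).mono_left nhdsWithin_le_nhds))
  linarith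

namespace BondiFunctions.IsAsymptoticallyFlat

theorem β_eq {D : BondiFunctions} (h : D.IsAsymptoticallyFlat) {X : Fin 4 → ℝ} (hX : X 1 = 0) :
    D.β X = 0 := by
  obtain ⟨M, c, hc⟩ := h.expansion
  have h1 := (hc (X 0) ![X 2, X 3]).2.2.1
  set k := (∑ A, ∑ B, raised (c (X 0)) A B ![X 2, X 3] * c (X 0) ![X 2, X 3] A B) / 32
  rw [h.smooth_β.eq_of_isBigO hX (φ := fun ℓ => -(k * ℓ ^ 2)) (by fun_prop) three_ne_zero
    (by simp only [sub_neg_eq_add]; exact h1)]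
  simp

theorem U_eq {D : BondiFunctions} (h : D.IsAsymptoticallyFlat) {X : Fin 4 → ℝ} (hX : X 1 = 0)
    (A : Fin 2) : D.U X A = 0 := by
  obtain ⟨M, c, hc⟩ := h.expansion
  have h1 := (hc (X 0) ![X 2, X 3]).2.2.2 A
  set k := sphereDiv (c (X 0)) A ![X 2, X 3] / 2
  rw [(h.smooth_U A).eq_of_isBigO hX (φ := fun ℓ => -(k * ℓ ^ 2)) (by fun_prop) three_ne_zero
    (by simp only [sub_neg_eq_add]; exact h1)]
  simp

theorem h_eq {D : BondiFunctions} (h : D.IsAsymptoticallyFlat) {X : Fin 4 → ℝ} (hX : X 1 = 0)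
    (A B : Fin 2) : D.h X A B = if A = B then (P (zeta X) ^ 2)⁻¹ else 0 := by
  obtain ⟨M, c, hc⟩ := h.expansion
  have := (hc (X 0) ![X 2, X 3]).2.1 A B
  have e := (h.smooth_h A B).eq_of_isBigO hX (φ := fun ℓ => roundMetric ![X 2, X 3] A B +
    c (X 0) ![X 2, X 3] A B * ℓ) (by fun_prop) two_ne_zero (by simpa using this)
  rw [e]
  simp [roundMetric, Matrix.one_apply, zeta]

open Asymptotics in
theorem hasPd_U {D : BondiFunctions} (h : D.IsAsymptoticallyFlat) {X : Fin 4 → ℝ} (hX : X 1 = 0)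
    (A : Fin 2) : HasPd (fun Y => D.U Y A) 1 0 X := by
  refine hasPd_one_of_isBigO hX ((h.smooth_U A).differentiableWithinAt hX) (h.U_eq hX A) ?_
  obtain ⟨M, c, hc⟩ := h.expansion
  have h1 := (hc (X 0) ![X 2, X 3]).2.2.2 A
  have h2 : (fun ℓ : ℝ => ℓ ^ 3) =O[𝓝[>] 0] fun ℓ => ℓ ^ 2 :=
    (isLittleO_pow_pow (by norm_num)).isBigO.mono nhdsWithin_le_nhds
  have h3 : (fun ℓ : ℝ => -(sphereDiv (c (X 0)) A ![X 2, X 3] / 2) * ℓ ^ 2) =O[𝓝[>] 0]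
      fun ℓ => ℓ ^ 2 := isBigO_const_mul_self _ _ _
  refine ((h1.trans h2).add h3).congr_left fun ℓ => ?_
  simp

end BondiFunctions.IsAsymptoticallyFlat

/-! ## The unphysical metric at null infinity -/

/-- The first-order coefficients `∂h_{AB}/∂ℓ` at null infinity. -/
noncomputable def SpaceTime.newsPotential (M : SpaceTime) (A B : Fin 2) (X : Fin 4 → ℝ) : ℝ :=
  pd halfSpace (fun Y => M.north.h Y A B) 1 X

/-- The values of the unphysical metric at null infinity. -/
def scriMetric (q : ℝ) : Matrix (Fin 4) (Fin 4) ℝ :=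
  !![0, -1, 0, 0; -1, 0, 0, 0; 0, 0, -q, 0; 0, 0, 0, -q]

theorem SpaceTime.unphysicalMetric_eq (M : SpaceTime) {X : Fin 4 → ℝ} (hX : X 1 = 0) :
    M.unphysicalMetric X = scriMetric (P (zeta X) ^ 2)⁻¹ := by
  have hβ := M.flat_north.β_eq hX
  have hU := M.flat_north.U_eq hX
  have hh := M.flat_north.h_eq hX
  have hU' : M.north.U X = 0 := funext hU
  simp [unphysicalMetric, scriMetric, hβ, hU', hh, hX]

theorem SpaceTime.differentiableWithinAt_unphysicalMetric (M : SpaceTime) {X : Fin 4 → ℝ}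
    (hX : X 1 = 0) (a b : Fin 4) :
    DifferentiableWithinAt ℝ (fun Y => M.unphysicalMetric Y a b) halfSpace X := by
  have hβ := M.flat_north.smooth_β.differentiableWithinAt hX
  have hW := M.flat_north.smooth_W.differentiableWithinAt hX
  have hU := fun A => (M.flat_north.smooth_U A).differentiableWithinAt hX
  have hh := fun A B => (M.flat_north.smooth_h A B).differentiableWithinAt hX
  have hℓ := (hasPd_coord 1 1 X).1
  have he : DifferentiableWithinAt ℝ (fun Y => Real.exp (2 * M.north.β Y)) halfSpace X :=
    (hβ.const_mul 2).exp
  have hhU : ∀ A, DifferentiableWithinAt ℝ (fun Y => M.north.h Y A 0 * M.north.U Y 0 +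
      M.north.h Y A 1 * M.north.U Y 1) halfSpace X := fun A =>
    ((hh A 0).mul (hU 0)).add ((hh A 1).mul (hU 1))
  fin_cases a <;> fin_cases b <;>
    simp [unphysicalMetric, dotProduct, Fin.sum_univ_two, hh, hhU, differentiableWithinAt_const]
  · exact (((hℓ.pow 2).mul he).mul hW).sub (((hU 0).mul (hhU 0)).add ((hU 1).mul (hhU 1)))
  · exact he
  · exact he

/-- At null infinity `g_{uu}` and `g_{uA}` have vanishing `ℓ`-derivative, because of the factor `ℓ²`
and of `U = O(ℓ²)`. Only the derivative of `h_{AB}` survives. Components with an index `ℓ` are not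
needed for vectors tangent to null infinity. -/
theorem SpaceTime.hasPd_one_unphysicalMetric (M : SpaceTime) {X : Fin 4 → ℝ} (hX : X 1 = 0)
    {a b : Fin 4} (ha : a ≠ 1) (hb : b ≠ 1) :
    HasPd (fun Y => M.unphysicalMetric Y a b) 1 ((!![0, 0, 0, 0; 0, 0, 0, 0;
      0, 0, -M.newsPotential 0 0 X, -M.newsPotential 0 1 X;
      0, 0, -M.newsPotential 1 0 X, -M.newsPotential 1 1 X] : Matrix (Fin 4) (Fin 4) ℝ) a b) X := by
  have hU := fun A => M.flat_north.hasPd_U hX A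
  have hU0 := M.flat_north.U_eq hX
  have hh : ∀ A B, HasPd (fun Y => M.north.h Y A B) 1 (M.newsPotential A B X) X := fun A B =>
    ⟨(M.flat_north.smooth_h A B).differentiableWithinAt hX, fun _ => rfl⟩
  have hhU : ∀ A, HasPd (fun Y => M.north.h Y A 0 * M.north.U Y 0 +
      M.north.h Y A 1 * M.north.U Y 1) 1 0 X := fun A =>
    (((hh A 0).mul (hU 0)).add ((hh A 1).mul (hU 1))).congr_deriv (by simp [hU0])
  have he : HasPd (fun Y => Real.exp (2 * M.north.β Y) * M.north.W Y) 1 _ X :=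
    ⟨(((M.flat_north.smooth_β.differentiableWithinAt hX).const_mul 2).exp).mul
      (M.flat_north.smooth_W.differentiableWithinAt hX), fun _ => rfl⟩
  have h00 : HasPd (fun Y => Y 1 * Y 1 * (Real.exp (2 * M.north.β Y) * M.north.W Y) -
      (M.north.U Y 0 * (M.north.h Y 0 0 * M.north.U Y 0 + M.north.h Y 0 1 * M.north.U Y 1) +
       M.north.U Y 1 * (M.north.h Y 1 0 * M.north.U Y 0 + M.north.h Y 1 1 * M.north.U Y 1)))
      1 0 X :=
    ((((hasPd_coord 1 1 X).mul (hasPd_coord 1 1 X)).mul he).sub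
      (((hU 0).mul (hhU 0)).add ((hU 1).mul (hhU 1)))).congr_deriv (by simp [hU0, hX])
  fin_cases a <;> fin_cases b <;> first | exact absurd rfl ha | exact absurd rfl hb | skip
  · refine ⟨M.differentiableWithinAt_unphysicalMetric hX 0 0, fun h => ?_⟩
    rw [← h00.2 h]
    congr 1
    funext Y
    simp [unphysicalMetric, dotProduct, Fin.sum_univ_two]
    ring
  · simpa [unphysicalMetric] using hhU 0
  · simpa [unphysicalMetric] using hhU 1
  · simpa [unphysicalMetric] using hhU 0
  · exact (hh 0 0).neg
  · exact (hh 0 1).neg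
  · simpa [unphysicalMetric] using hhU 1
  · exact (hh 1 0).neg
  · exact (hh 1 1).neg

/-- The tangential derivatives, at null infinity, of the unphysical metric rescaled by a function
of `ζ`. -/
theorem SpaceTime.hasPd_rescaled (M : SpaceTime) {X : Fin 4 → ℝ} (hX : X 1 = 0) {k : ℂ → ℝ}
    (hk : DifferentiableAt ℝ k (zeta X)) {a : Fin 4} (ha : a ≠ 1) (b c : Fin 4) :
    HasPd (fun Y => (k (zeta Y) ^ 2 • M.unphysicalMetric Y) b c) a
      ((!![0, -fderiv ℝ (fun z => k z ^ 2) (zeta X) (planeDir a), 0, 0;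
        -fderiv ℝ (fun z => k z ^ 2) (zeta X) (planeDir a), 0, 0, 0;
        0, 0, -fderiv ℝ (fun z => k z ^ 2 * (P z ^ 2)⁻¹) (zeta X) (planeDir a), 0;
        0, 0, 0, -fderiv ℝ (fun z => k z ^ 2 * (P z ^ 2)⁻¹) (zeta X) (planeDir a)] :
          Matrix (Fin 4) (Fin 4) ℝ) b c) X := by
  have hP : DifferentiableAt ℝ (fun z => (P z ^ 2)⁻¹) (zeta X) := by
    have h1 : DifferentiableAt ℝ (fun z : ℂ => (1 + ‖z‖ ^ 2) / 2) (zeta X) := by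
      have : DifferentiableAt ℝ (fun z : ℂ => ‖z‖ ^ 2) (zeta X) :=
        (contDiff_norm_sq ℝ).differentiable one_ne_zero _
      exact (this.const_add 1).mul_const (2 : ℝ)⁻¹
    exact DifferentiableAt.inv (h1.pow 2) (pow_ne_zero 2 (P_pos _).ne')
  have hk2 : DifferentiableAt ℝ (fun z => k z ^ 2) (zeta X) := hk.pow 2
  have hF : ∀ b c, DifferentiableWithinAt ℝ (fun Y => (k (zeta Y) ^ 2 • M.unphysicalMetric Y) b c)
      halfSpace X := fun b c =>
    (hasFDerivAt_comp_zeta hk2).differentiableAt.differentiableWithinAt.mul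
      (M.differentiableWithinAt_unphysicalMetric hX b c)
  have e : ∀ b c, ∀ Y : Fin 4 → ℝ, Y 1 = 0 → (k (zeta Y) ^ 2 • M.unphysicalMetric Y) b c =
      k (zeta Y) ^ 2 * scriMetric (P (zeta Y) ^ 2)⁻¹ b c := fun b c Y hY => by
    rw [M.unphysicalMetric_eq hY]; rfl
  have h1 := (hasPd_comp_zeta hk2 a).neg
  have h2 := (hasPd_comp_zeta (hk2.mul hP) a).neg
  have h0 := hasPd_const 0 a X
  fin_cases b <;> fin_cases c <;>
    first
    | exact h0.congr_boundary (hF _ _) hX ha fun Y hY => by rw [e _ _ Y hY]; simp [scriMetric]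
    | exact h1.congr_boundary (hF _ _) hX ha fun Y hY => by rw [e _ _ Y hY]; simp [scriMetric]
    | exact h2.congr_boundary (hF _ _) hX ha fun Y hY => by rw [e _ _ Y hY]; simp [scriMetric]

theorem SpaceTime.hasPd_one_rescaled (M : SpaceTime) {X : Fin 4 → ℝ} (hX : X 1 = 0) {k : ℂ → ℝ}
    (hk : DifferentiableAt ℝ k (zeta X)) {a b : Fin 4} (ha : a ≠ 1) (hb : b ≠ 1) :
    HasPd (fun Y => (k (zeta Y) ^ 2 • M.unphysicalMetric Y) a b) 1 (k (zeta X) ^ 2 * (!![0, 0, 0, 0;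
      0, 0, 0, 0; 0, 0, -M.newsPotential 0 0 X, -M.newsPotential 0 1 X;
      0, 0, -M.newsPotential 1 0 X, -M.newsPotential 1 1 X] : Matrix (Fin 4) (Fin 4) ℝ) a b) X := by
  have hk2 : DifferentiableAt ℝ (fun z => k z ^ 2) (zeta X) := hk.pow 2
  refine ((hasPd_comp_zeta hk2 1).mul (M.hasPd_one_unphysicalMetric hX ha hb)).congr_deriv ?_
  simp [planeDir]

theorem SpaceTime.inv_rescaled (M : SpaceTime) {X : Fin 4 → ℝ} (hX : X 1 = 0) {k : ℝ}
    (hk : k ≠ 0) : (k ^ 2 • M.unphysicalMetric X)⁻¹ = (!![0, -1 / k ^ 2, 0, 0; -1 / k ^ 2, 0, 0, 0;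
      0, 0, -P (zeta X) ^ 2 / k ^ 2, 0; 0, 0, 0, -P (zeta X) ^ 2 / k ^ 2] :
        Matrix (Fin 4) (Fin 4) ℝ) := by
  have hP := (P_pos (zeta X)).ne'
  rw [M.unphysicalMetric_eq hX, scriMetric]
  apply Matrix.inv_eq_right_inv
  ext a b
  fin_cases a <;> fin_cases b <;> simp [Matrix.mul_apply, Fin.sum_univ_four] <;> field_simp

/-! ## The shear of a cut of null infinity -/

/-- As `m` is tangent to null infinity, only tangential derivatives of the boundary metric and the
`ℓ`-derivatives of `g_{ab}` with `a, b ≠ 1` enter. The component `l_1` drops out because `Γ^1_{ab}`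
vanishes for these indices. The names `E` and `W` keep the two derivatives folded during
simplification. -/
theorem SpaceTime.shear_rescaled (M : SpaceTime) {X : Fin 4 → ℝ} (hX : X 1 = 0) {k : ℂ → ℝ}
    (hk : DifferentiableAt ℝ k (zeta X)) (hk0 : k (zeta X) ≠ 0) (l : (Fin 4 → ℝ) → Fin 4 → ℝ)
    (m : Fin 4 → ℂ) (hm : m 1 = 0) {E W : ℂ → ℝ} (hE : E = fun z => k z ^ 2)
    (hW : W = fun z => k z ^ 2 * (P z ^ 2)⁻¹) :
    shear (fun Y => k (zeta Y) ^ 2 • M.unphysicalMetric Y) l m X =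
      m 0 * m 0 * pd halfSpace (fun Y => l Y 0) 0 X + m 0 * m 2 * pd halfSpace (fun Y => l Y 2) 0 X +
      m 0 * m 3 * pd halfSpace (fun Y => l Y 3) 0 X + m 2 * m 0 * pd halfSpace (fun Y => l Y 0) 2 X +
      m 2 * m 2 * pd halfSpace (fun Y => l Y 2) 2 X + m 2 * m 3 * pd halfSpace (fun Y => l Y 3) 2 X +
      m 3 * m 0 * pd halfSpace (fun Y => l Y 0) 3 X + m 3 * m 2 * pd halfSpace (fun Y => l Y 2) 3 X +
      m 3 * m 3 * pd halfSpace (fun Y => l Y 3) 3 X +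
      (l X 0 * (E (zeta X) * (M.newsPotential 0 0 X * m 2 * m 2 + M.newsPotential 0 1 X * m 2 * m 3 +
          M.newsPotential 1 0 X * m 3 * m 2 + M.newsPotential 1 1 X * m 3 * m 3) -
          2 * m 0 * (m 2 * fderiv ℝ E (zeta X) 1 + m 3 * fderiv ℝ E (zeta X) I)) +
        (P (zeta X) : ℂ) ^ 2 * l X 2 * ((m 2 ^ 2 + m 3 ^ 2) * fderiv ℝ W (zeta X) 1 -
          2 * m 2 * (m 2 * fderiv ℝ W (zeta X) 1 + m 3 * fderiv ℝ W (zeta X) I)) +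
        (P (zeta X) : ℂ) ^ 2 * l X 3 * ((m 2 ^ 2 + m 3 ^ 2) * fderiv ℝ W (zeta X) I -
          2 * m 3 * (m 2 * fderiv ℝ W (zeta X) 1 + m 3 * fderiv ℝ W (zeta X) I))) /
        (2 * E (zeta X)) := by
  have hXs : X ∈ halfSpace := hX.ge
  have h0 := fun b c => (M.hasPd_rescaled hX hk (a := 0) (by decide) b c).2 hXs
  have h2 := fun b c => (M.hasPd_rescaled hX hk (a := 2) (by decide) b c).2 hXs
  have h3 := fun b c => (M.hasPd_rescaled hX hk (a := 3) (by decide) b c).2 hXs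
  have h1 := fun (b c : Fin 4) (hb : b ≠ 1) (hc : c ≠ 1) =>
    (M.hasPd_one_rescaled hX hk hb hc).2 hXs
  have hi := M.inv_rescaled hX hk0
  have e0 : planeDir 0 = 0 := rfl
  have e2 : planeDir 2 = 1 := rfl
  have e3 : planeDir 3 = I := rfl
  rw [← hE, ← hW, e0] at h0
  rw [← hE, ← hW, e2] at h2
  rw [← hE, ← hW, e3] at h3
  simp only [map_zero, neg_zero] at h0
  have hEX : E (zeta X) = k (zeta X) ^ 2 := by rw [hE]
  rw [← hEX] at hi
  simp only [← hEX] at h1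
  have hE0 : E (zeta X) ≠ 0 := by rw [hEX]; exact pow_ne_zero 2 hk0
  rw [shear]
  simp only [Fin.sum_univ_four, hm, zero_mul, mul_zero, add_zero, christoffel, h0, h2, h3]
  rw [h1 0 0 (by decide) (by decide), h1 0 2 (by decide) (by decide), h1 0 3 (by decide) (by decide),
    h1 2 0 (by decide) (by decide), h1 2 2 (by decide) (by decide), h1 2 3 (by decide) (by decide),
    h1 3 0 (by decide) (by decide), h1 3 2 (by decide) (by decide), h1 3 3 (by decide) (by decide)]
  simp only [← hEX, hi]
  simp
  have hE0' : (E (zeta X) : ℂ) ≠ 0 := by exact_mod_cast hE0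
  field_simp
  ring

/-! ## The conformal factor as a function on the sphere -/

theorem ofReal_norm_sq (x : ℂ) : ((‖x‖ : ℝ) : ℂ) ^ 2 = x * (starRingEnd ℂ) x := by
  rw [Complex.mul_conj, Complex.normSq_eq_norm_sq]; push_cast; rfl

/-- The inverse factor `|gv|²/|v|²` is a Hermitian form in `(1, ζ)` over `1 + ζζ̄`. Hence `ð²(1/K) =
0`, the identity behind the transformation law of the shear. -/
theorem inv_mobiusFactor (g : SL2C) (p : OnePoint ℂ) : ((mobiusFactor g p : ℝ) : ℂ)⁻¹ =
    sesq (g 0 1 * (starRingEnd ℂ) (g 0 1) + g 1 1 * (starRingEnd ℂ) (g 1 1))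
      (g 0 0 * (starRingEnd ℂ) (g 0 1) + g 1 0 * (starRingEnd ℂ) (g 1 1))
      (g 0 1 * (starRingEnd ℂ) (g 0 0) + g 1 1 * (starRingEnd ℂ) (g 1 0))
      (g 0 0 * (starRingEnd ℂ) (g 0 0) + g 1 0 * (starRingEnd ℂ) (g 1 0)) p := by
  induction p using OnePoint.rec with
  | infty =>
    simp only [mobiusFactor, OnePoint.elim_infty, sesq_infty]
    push_cast
    rw [ofReal_norm_sq, ofReal_norm_sq, one_div, inv_inv]
  | coe z =>
    rw [sesq_coe]
    simp only [mobiusFactor, OnePoint.elim_some]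
    push_cast
    rw [ofReal_norm_sq, ofReal_norm_sq, ofReal_norm_sq, inv_div]
    simp only [map_add, map_mul]
    congr 1
    ring

theorem ethSq_inv_mobiusFactor (g : SL2C) (z : ℂ) :
    ethSq (fun p => ((mobiusFactor g p : ℝ) : ℂ)⁻¹) z = 0 := by
  simp only [inv_mobiusFactor]
  exact ethSq_sesq _ _ _ _ z

theorem smoothOnSphere_mobiusFactor (g : SL2C) : SmoothOnSphere (mobiusFactor g) := by
  intro i
  -- Any target chart serves, since the formula for the factor in `mobius_chart` holds at every `y`.
  obtain ⟨j, w, hw⟩ := exists_chart (mobius g (chart i 0))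
  obtain ⟨a, b, c, d, hdet, -, -, -, hK⟩ := mobius_chart g hw.symm
  simp only [hK]
  have hs : ∀ a b : ℂ, ContDiff ℝ ∞ fun y : ℂ => ‖a * y + b‖ ^ 2 := fun a b =>
    ((contDiff_const.mul contDiff_id).add contDiff_const).norm_sq ℝ
  refine ((contDiff_const.add (contDiff_id.norm_sq ℝ)).div ((hs a b).add (hs c d)) fun y => ?_)
  refine (norm_sq_add_norm_sq_pos ?_).ne'
  by_contra! h
  have : a * d - b * c = 0 := by
    linear_combination a * h.2 - c * h.1
  rw [this, norm_zero] at hdet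
  exact zero_ne_one hdet

theorem dzeta_ofReal {φ : ℂ → ℝ} {z : ℂ} (h : DifferentiableAt ℝ φ z) :
    HasDz (fun y => (φ y : ℂ)) ((fderiv ℝ φ z 1 - I * fderiv ℝ φ z I) / 2) z := by
  have h1 : HasFDerivAt (fun y => (φ y : ℂ)) _ z :=
    Complex.ofRealCLM.hasFDerivAt.comp z h.hasFDerivAt
  refine ⟨h1.differentiableAt, ?_⟩
  rw [dzeta, h1.fderiv]
  rfl

theorem contDiff_fderiv_apply {φ : ℂ → ℝ} (h : ContDiff ℝ ∞ φ) (v : ℂ) :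
    ContDiff ℝ ∞ fun y => fderiv ℝ φ y v :=
  (h.fderiv_right (by simp)).clm_apply contDiff_const

theorem dzeta_dzeta_ofReal {φ : ℂ → ℝ} (h : ContDiff ℝ ∞ φ) (z : ℂ) :
    dzeta (dzeta fun y => (φ y : ℂ)) z =
      (fderiv ℝ (fun y => fderiv ℝ φ y 1) z 1 - I * fderiv ℝ (fun y => fderiv ℝ φ y I) z 1 -
        I * fderiv ℝ (fun y => fderiv ℝ φ y 1) z I - fderiv ℝ (fun y => fderiv ℝ φ y I) z I) / 4 := by
  have h1 : (dzeta fun y => (φ y : ℂ)) =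
      fun y => ((fderiv ℝ φ y 1 : ℝ) - I * (fderiv ℝ φ y I : ℝ)) / 2 :=
    funext fun y => (dzeta_ofReal (h.differentiable (by simp) y)).2
  have hx := dzeta_ofReal ((contDiff_fderiv_apply h 1).differentiable (by simp) z)
  have hy := dzeta_ofReal ((contDiff_fderiv_apply h I).differentiable (by simp) z)
  rw [h1, ((hx.sub (hy.const_mul I)).div (hasDz_const 2 z) two_ne_zero).2]
  linear_combination (fderiv ℝ (fun y => fderiv ℝ φ y I) z I / 4 : ℂ) * Complex.I_sq

/-- The second-order equation satisfied by a conformal factor of the sphere. -/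
theorem mobiusFactor_dzeta (g : SL2C) (z : ℂ) :
    (mobiusFactor g z : ℂ) * ((P z : ℂ) ^ 2 * dzeta (dzeta fun y : ℂ => (mobiusFactor g y : ℂ)) z +
      (P z : ℂ) * (starRingEnd ℂ) z * dzeta (fun y : ℂ => (mobiusFactor g y : ℂ)) z) =
    2 * (P z : ℂ) ^ 2 * dzeta (fun y : ℂ => (mobiusFactor g y : ℂ)) z ^ 2 := by
  set k : ℂ → ℂ := fun y => (mobiusFactor g y : ℂ) with hk
  have hk0 : ∀ y, k y ≠ 0 := fun y => by
    simp only [hk]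
    exact_mod_cast (mobiusFactor_pos g y).ne'
  have hks : ContDiff ℝ ∞ k :=
    Complex.ofRealCLM.contDiff.comp (smoothOnSphere_mobiusFactor g).coe
  have h1 := fun y => hasDz_dzeta (hks.differentiable (by simp) y)
  have h2 := hasDz_dzeta ((ContDiff.dzeta hks).differentiable (by simp) z)
  -- The claim is `ð²(1/K) = 0`, expanded and cleared of denominators.
  have e := ethSq_inv_mobiusFactor g z
  rw [ethSq_eq_edthTwo, edthTwo_eq (.of_forall fun y => (h1 y).inv (hk0 y))
    ((hasDz_P z).pow.mul ((((hasDz_const 0 z).sub h2).congr (.of_forall fun y => by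
      simp)).div (h1 z).pow (pow_ne_zero 2 (hk0 z))))] at e
  have := hk0 z
  field_simp at e
  change k z * ((P z : ℂ) ^ 2 * dzeta (dzeta k) z + (P z : ℂ) * (starRingEnd ℂ) z * dzeta k z) = _
  linear_combination (-1 / 4) * e

/-! ## The transformation law of the asymptotic shear -/

theorem SpaceTime.asymptoticShear_eq (M : SpaceTime) (u : ℝ) (z : ℂ) :
    M.asymptoticShear u z = (P z : ℂ) ^ 2 / 4 *
      (M.newsPotential 0 0 (pt u 0 z) - I * M.newsPotential 0 1 (pt u 0 z) -
        I * M.newsPotential 1 0 (pt u 0 z) - M.newsPotential 1 1 (pt u 0 z)) := by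
  have hX : pt u 0 z 1 = 0 := rfl
  have h := M.shear_rescaled hX (k := fun _ => 1) (differentiableAt_const _) one_ne_zero
    (fun _ => ![1, 0, 0, 0]) ![0, 0, √2 * P z / 2, -I * (√2 * P z / 2)] rfl rfl rfl
  simp only [one_pow, one_smul] at h
  rw [asymptoticShear, show (fun Y => M.unphysicalMetric Y) = M.unphysicalMetric from rfl] at *
  rw [h]
  have hc : ∀ (c : ℝ) a, pd halfSpace (fun _ => c) a (pt u 0 z) = 0 := fun c a =>
    (hasPd_const c a _).2 hX.ge
  have h2 : ((√2 : ℝ) : ℂ) ^ 2 = 2 := by norm_cast; simp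
  simp [hc]
  linear_combination ((P z : ℂ) ^ 2 / 8 * (M.newsPotential 0 0 (pt u 0 z) -
    I * M.newsPotential 0 1 (pt u 0 z) - I * M.newsPotential 1 0 (pt u 0 z) +
    I ^ 2 * M.newsPotential 1 1 (pt u 0 z))) * h2 +
    ((P z : ℂ) ^ 2 / 4 * M.newsPotential 1 1 (pt u 0 z)) * Complex.I_sq

theorem differentiableAt_P (z : ℂ) : DifferentiableAt ℝ P z := by
  have h1 : DifferentiableAt ℝ (fun z : ℂ => (1 + ‖z‖ ^ 2) * (2 : ℝ)⁻¹) z :=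
    (((contDiff_norm_sq ℝ).differentiable one_ne_zero z).const_add 1).mul_const _
  exact h1

/-- The transformed shear in terms of the frame vector. -/
theorem SpaceTime.transformedShear_eq (M : SpaceTime) (b : BMS) (u : ℝ) (z : ℂ) :
    M.transformedShear b u z = b.K z * b.newFrame z ^ 2 / (2 * (P z : ℂ) ^ 2) *
      (M.asymptoticShear u z + 1 / 2 * ethSq (fun p => (b.α p : ℂ)) z) := by
  obtain ⟨g, -, hK⟩ := b.conformal.exists_mobius
  set k : ℂ → ℝ := fun y => b.K y with hk
  set α : ℂ → ℝ := fun y => b.α y with hα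
  have hks : ContDiff ℝ ∞ k := by
    rw [hk, hK]
    exact (smoothOnSphere_mobiusFactor g).coe
  have hαs : ContDiff ℝ ∞ α := b.smooth.coe
  have hkd := fun y => hks.differentiable (by simp) y
  have hαd := fun y => hαs.differentiable (by simp) y
  have hk0 : ∀ y, k y ≠ 0 := fun y => (b.conformal.1 _).ne'
  have hT : ∀ a Y, pd Set.univ b.newTime a Y = fderiv ℝ k (zeta Y) (planeDir a) *
      (Y 0 + α (zeta Y)) + k (zeta Y) * ((if a = 0 then 1 else 0) +
        fderiv ℝ α (zeta Y) (planeDir a)) := by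
    intro a Y
    have h1 : HasFDerivAt b.newTime _ Y := (hasFDerivAt_comp_zeta (hkd (zeta Y))).mul
      ((hasFDerivAt_apply 0 Y).add (hasFDerivAt_comp_zeta (hαd (zeta Y))))
    rw [pd, fderivWithin_univ, h1.fderiv]
    have hα' : ∀ y : ℂ, b.α y = α y := fun _ => rfl
    simp [zetaCLM_apply, zeta_single, Pi.single_apply, eq_comm, hα']
    split_ifs <;> ring
  have hX : pt u 0 z 1 = 0 := rfl
  have hXs : pt u 0 z ∈ halfSpace := hX.ge
  have hz : zeta (pt u 0 z) = z := rfl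
  have hX0 : pt u 0 z 0 = u := rfl
  have e0 : planeDir 0 = 0 := rfl
  have e2 : planeDir 2 = 1 := rfl
  have e3 : planeDir 3 = I := rfl
  have hl0 : ∀ Y, b.newCovector Y 0 = k (zeta Y) := fun Y => by
    simp [BMS.newCovector, hT, e0]
  have hl2 : ∀ Y, b.newCovector Y 2 = fderiv ℝ k (zeta Y) 1 * (Y 0 + α (zeta Y)) +
      k (zeta Y) * fderiv ℝ α (zeta Y) 1 := fun Y => by
    simp [BMS.newCovector, hT, e2]
  have hl3 : ∀ Y, b.newCovector Y 3 = fderiv ℝ k (zeta Y) I * (Y 0 + α (zeta Y)) +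
      k (zeta Y) * fderiv ℝ α (zeta Y) I := fun Y => by
    simp [BMS.newCovector, hT, e3]
  have hL := fun a => (hasPd_coord 0 a (pt u 0 z)).add (hasPd_comp_zeta (hαd z) a)
  have hp0 := fun a => (hasPd_comp_zeta (X := pt u 0 z) (hkd z) a).2 hXs
  have hp : ∀ v a, _ := fun v a => ((((hasPd_comp_zeta (X := pt u 0 z)
    ((contDiff_fderiv_apply hks v).differentiable (by simp) z) a).mul (hL a)).add
    ((hasPd_comp_zeta (X := pt u 0 z) (hkd z) a).mul (hasPd_comp_zeta (X := pt u 0 z)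
      ((contDiff_fderiv_apply hαs v).differentiable (by simp) z) a)))).2 hXs
  have hPz : (fderiv ℝ P z 1 : ℂ) - I * fderiv ℝ P z I = (starRingEnd ℂ) z := by
    have h1 := (dzeta_ofReal (differentiableAt_P z)).2.symm.trans (hasDz_P z).2
    linear_combination 2 * h1
  have hE : ∀ v, fderiv ℝ (fun z => k z ^ 2) z v = 2 * k z * fderiv ℝ k z v := fun v => by
    have h1 : HasFDerivAt (fun z => k z ^ 2) _ z := (hkd z).hasFDerivAt.pow 2
    rw [h1.fderiv]
    simp
  have hW : ∀ v, fderiv ℝ (fun z => k z ^ 2 * (P z ^ 2)⁻¹) z v =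
      2 * k z * fderiv ℝ k z v * (P z ^ 2)⁻¹ - 2 * k z ^ 2 * fderiv ℝ P z v * (P z ^ 3)⁻¹ := by
    intro v
    have h1 : HasFDerivAt (fun z => k z ^ 2 * (P z ^ 2)⁻¹) _ z :=
      ((hkd z).hasFDerivAt.pow 2).mul (((hasDerivAt_inv (pow_ne_zero 2 (P_pos z).ne')).comp_hasFDerivAt z
        ((differentiableAt_P z).hasFDerivAt.pow 2)))
    rw [h1.fderiv]
    have := (P_pos z).ne'
    simp
    field_simp
    ring
  -- This is where it matters that `K` is the conformal factor of a map of the whole sphere: a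
  -- general positive function does not satisfy this equation.
  have hJ : (k z : ℂ) * ((P z : ℂ) ^ 2 * dzeta (dzeta fun y => (k y : ℂ)) z + (P z : ℂ) *
      (starRingEnd ℂ) z * dzeta (fun y => (k y : ℂ)) z) = 2 * (P z : ℂ) ^ 2 *
      dzeta (fun y => (k y : ℂ)) z ^ 2 := by
    simp only [hk, hK]
    exact mobiusFactor_dzeta g z
  have hαe : edthTwo (fun z : ℂ => (b.α z : ℂ)) z = 4 * ((P z : ℂ) * (starRingEnd ℂ) z *
      dzeta (fun y => (α y : ℂ)) z + (P z : ℂ) ^ 2 * dzeta (dzeta fun y => (α y : ℂ)) z) :=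
    edthTwo_expand (Complex.ofRealCLM.contDiff.comp hαs).contDiffAt
  have hm0 : b.newVector (pt u 0 z) 0 = -(b.newFrame z / 2 * ((b.newCovector (pt u 0 z) 2 : ℂ) -
      I * b.newCovector (pt u 0 z) 3)) / (b.newCovector (pt u 0 z) 0 : ℂ) := rfl
  have hm2 : b.newVector (pt u 0 z) 2 = b.newFrame z / 2 := rfl
  have hm3 : b.newVector (pt u 0 z) 3 = -I * (b.newFrame z / 2) := rfl
  change _ = (k z : ℂ) * _ / _ * _
  rw [transformedShear, M.shear_rescaled hX (k := k) (hkd _) (hk0 _) b.newCovector _ rfl rfl rfl,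
    asymptoticShear_eq, ethSq_eq_edthTwo, hαe, hm0, hm2, hm3]
  simp only [hl0, hl2, hl3, hp0, hp, hz, hX0, e0, e2, e3, map_zero, hE, hW,
    dzeta_dzeta_ofReal hks, dzeta_dzeta_ofReal hαs, (dzeta_ofReal (hkd z)).2,
    (dzeta_ofReal (hαd z)).2, ← hPz] at hJ ⊢
  have hk0' : (k z : ℂ) ≠ 0 := by exact_mod_cast hk0 z
  have hP0' : (P z : ℂ) ≠ 0 := by exact_mod_cast (P_pos z).ne'
  generalize b.newFrame z = κ
  generalize M.newsPotential 0 0 (pt u 0 z) = c₀₀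
  generalize M.newsPotential 0 1 (pt u 0 z) = c₀₁
  generalize M.newsPotential 1 0 (pt u 0 z) = c₁₀
  generalize M.newsPotential 1 1 (pt u 0 z) = c₁₁
  generalize fderiv ℝ (fun y => fderiv ℝ k y 1) z 1 = kxx at *
  generalize fderiv ℝ (fun y => fderiv ℝ k y 1) z I = kxy at *
  generalize fderiv ℝ (fun y => fderiv ℝ k y I) z 1 = kyx at *
  generalize fderiv ℝ (fun y => fderiv ℝ k y I) z I = kyy at *
  generalize fderiv ℝ (fun y => fderiv ℝ α y 1) z 1 = axx at *
  generalize fderiv ℝ (fun y => fderiv ℝ α y 1) z I = axy at *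
  generalize fderiv ℝ (fun y => fderiv ℝ α y I) z 1 = ayx at *
  generalize fderiv ℝ (fun y => fderiv ℝ α y I) z I = ayy at *
  generalize fderiv ℝ k z 1 = kx at *
  generalize fderiv ℝ k z I = ky at *
  generalize fderiv ℝ α z 1 = ax at *
  generalize fderiv ℝ α z I = ay at *
  generalize fderiv ℝ P z 1 = Px at *
  generalize fderiv ℝ P z I = Py at *
  generalize P z = p at *
  generalize α z = a at *
  generalize k z = K at *
  clear * - hJ hk0' hP0'
  simp at hJ ⊢
  -- Everything free of `u + α` cancels identically; the remainder is a multiple of `hJ`.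
  linear_combination (norm := skip) (κ ^ 2 * (u + a) / (K * p ^ 2)) * hJ
  field_simp
  ring_nf
  simp only [Complex.I_sq]
  ring

/-! ## Pulling back conformal densities along Möbius transformations -/

/-- The pull-back of a conformal density `η` of weight `1` on the sphere. -/
noncomputable def pullback (g : SL2C) (η : OnePoint ℂ → ℂ) (p : OnePoint ℂ) : ℂ :=
  η (mobius g p) / mobiusFactor g p

theorem exists_smooth_chart_mobius (g : SL2C) (i : Bool) (z : ℂ) :
    ∃ (j : Bool) (h : ℂ → ℂ), ContDiffAt ℝ ∞ h z ∧
      ∀ᶠ y in 𝓝 z, mobius g (chart i y) = chart j (h y) := by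
  obtain ⟨j, w, hw⟩ := exists_chart (mobius g (chart i z))
  obtain ⟨h, h1, h2, -⟩ := (isConformal_mobius g).2 i j z w hw.symm
  exact ⟨j, h, h2, h1⟩

theorem SmoothOnSphere.pullback {η : OnePoint ℂ → ℂ} (hη : SmoothOnSphere η) (g : SL2C) :
    SmoothOnSphere (pullback g η) := by
  intro i
  rw [contDiff_iff_contDiffAt]
  intro z
  obtain ⟨j, h, hs, he⟩ := exists_smooth_chart_mobius g i z
  have h1 : ContDiffAt ℝ ∞ (fun y => η (mobius g (chart i y))) z :=
    ((hη j).contDiffAt.comp z hs).congr_of_eventuallyEq (he.mono fun y hy => by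
      simp only [hy, Function.comp])
  have h2 : ContDiffAt ℝ ∞ (fun y => ((mobiusFactor g (chart i y) : ℝ) : ℂ)) z :=
    (Complex.ofRealCLM.contDiff.comp (smoothOnSphere_mobiusFactor g i)).contDiffAt
  have h3 : ContDiffAt ℝ ∞ (fun y => ((mobiusFactor g (chart i y) : ℝ) : ℂ)⁻¹) z :=
    h2.inv (by exact_mod_cast (mobiusFactor_pos g (chart i z)).ne')
  simp only [BondiSachs.pullback, div_eq_mul_inv]
  exact h1.mul h3

/-- Both sides are conformal factors of the same map, and such a factor is unique. -/
theorem mobius_mul_factor (g h : SL2C) (p : OnePoint ℂ) :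
    mobiusFactor (g * h) p = mobiusFactor g (mobius h p) * mobiusFactor h p := by
  have h1 := (isConformal_mobius g).comp (isConformal_mobius h)
  rw [← map_mul] at h1
  exact congrFun ((isConformal_mobius (g * h)).factor_unique h1) p

theorem mobiusFactor_one (p : OnePoint ℂ) : mobiusFactor 1 p = 1 := by
  have h := mobius_mul_factor 1 1 p
  rw [mul_one, map_one, Equiv.Perm.one_apply] at h
  have := (mobiusFactor_pos 1 p).ne'
  field_simp at h
  exact h.symm

theorem pullback_mul (g h : SL2C) (η : OnePoint ℂ → ℂ) :
    pullback (g * h) η = pullback h (pullback g η) := by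
  funext p
  simp only [pullback, mobius_mul_factor, map_mul, Equiv.Perm.mul_apply]
  push_cast
  rw [div_div]

theorem pullback_one (η : OnePoint ℂ → ℂ) : pullback 1 η = η := by
  funext p
  simp [pullback, mobiusFactor_one]

theorem mobius_finite (g : SL2C) {z z' : ℂ} (h : mobius g z = z') :
    g 1 0 * z + g 1 1 ≠ 0 ∧ z' = (g 0 0 * z + g 0 1) / (g 1 0 * z + g 1 1) := by
  rw [mobius_coe] at h
  have h1 : g 1 0 * z + g 1 1 ≠ 0 := ne_zero_of_homPoint_eq_chart_false h
  rw [homPoint, if_neg h1] at h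
  exact ⟨h1, (OnePoint.coe_injective h).symm⟩

theorem mobius_eventually_finite (g : SL2C) {z : ℂ} (h : g 1 0 * z + g 1 1 ≠ 0) :
    ∀ᶠ y : ℂ in 𝓝 z, mobius g y = ((g 0 0 * y + g 0 1) / (g 1 0 * y + g 1 1) : ℂ) := by
  have hne : ∀ᶠ y in 𝓝 z, g 1 0 * y + g 1 1 ≠ 0 :=
    (Continuous.continuousAt (by fun_prop)).eventually_ne h
  filter_upwards [hne] with y hy
  rw [mobius_coe, homPoint, if_neg hy]

theorem mobiusFactor_coe (g : SL2C) (z : ℂ) : (mobiusFactor g z : ℂ) =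
    (1 + z * (starRingEnd ℂ) z) / ((g 0 0 * z + g 0 1) * (starRingEnd ℂ) (g 0 0 * z + g 0 1) +
      (g 1 0 * z + g 1 1) * (starRingEnd ℂ) (g 1 0 * z + g 1 1)) := by
  rw [mobiusFactor, OnePoint.elim_some]
  push_cast
  simp only [ofReal_norm_sq]

/-- The conformal covariance of `ð²` on densities. -/
theorem ethSq_pullback (g : SL2C) {η : OnePoint ℂ → ℂ} (hη : SmoothOnSphere η) {z z' : ℂ}
    (h : mobius g z = z') :
    ethSq η z' = (mobiusFactor g z : ℂ)⁻¹ * ((g 1 0 * z + g 1 1) /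
      (starRingEnd ℂ) (g 1 0 * z + g 1 1)) ^ 2 * ethSq (pullback g η) z := by
  obtain ⟨hq, hz'⟩ := mobius_finite g h
  have h1 := edthTwo_mobius (a := g 0 0) (b := g 0 1) (c := g 1 0) (d := g 1 1) g.det_eq
    (η := fun y : ℂ => η y) hq hη.coe.contDiffAt
  rw [ethSq_eq_edthTwo, ethSq_eq_edthTwo, hz', ← h1, mobiusFactor_coe, inv_div]
  congr 1
  apply edthTwo_congr
  filter_upwards [mobius_eventually_finite g hq] with y hy
  rw [pullback, hy, mobiusFactor_coe, div_eq_mul_inv (η _), inv_div, mul_comm]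

/-- At most one finite point is the image of `∞`, and its complement is dense. So identities known
only where `ζ` and `ζ'` are both finite extend by continuity. -/
theorem eq_of_eq_of_mobius_finite (g : SL2C) {F G : ℂ → ℂ} (hF : Continuous F) (hG : Continuous G)
    (h : ∀ z z' : ℂ, mobius g z = z' → F z' = G z') : F = G := by
  have hd : Dense {w : ℂ | (w : OnePoint ℂ) ≠ mobius g OnePoint.infty} := by
    induction mobius g OnePoint.infty using OnePoint.rec with
    | infty => simp
    | coe c => simpa [Set.compl_def] using dense_compl_singleton c
  refine hF.ext_on hd hG fun w hw => ?_
  obtain ⟨z, hz⟩ : ∃ z : ℂ, (mobius g).symm w = z := by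
    have : (mobius g).symm w ≠ OnePoint.infty := fun e => hw (by
      rw [← e, Equiv.apply_symm_apply])
    obtain ⟨z, hz⟩ := OnePoint.ne_infty_iff_exists.1 this
    exact ⟨z, hz.symm⟩
  exact h z w (by rw [← hz, Equiv.apply_symm_apply])

theorem ethSq_pullback_eq_zero (g : SL2C) {η : OnePoint ℂ → ℂ} (hη : SmoothOnSphere η)
    (h : ∀ z, ethSq η z = 0) (z : ℂ) : ethSq (pullback g η) z = 0 := by
  have h1 : ethSq (pullback g η) = fun _ => 0 := by
    refine eq_of_eq_of_mobius_finite g⁻¹ (contDiff_ethSq (hη.pullback g)).continuous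
      continuous_const fun z z' hz => ?_
    rw [ethSq_pullback g⁻¹ (hη.pullback g) hz, ← pullback_mul, mul_inv_cancel, pullback_one, h,
      mul_zero]
  exact congrFun h1 z

/-- Translations form a conformally invariant space of densities. -/
theorem isTranslation_pullback_iff (g : SL2C) {α β : OnePoint ℂ → ℝ}
    (h : ∀ p, β p = α (mobius g p) / mobiusFactor g p) : IsTranslation β ↔ IsTranslation α := by
  have key : ∀ (g : SL2C) (α β : OnePoint ℂ → ℝ),
      (∀ p, β p = α (mobius g p) / mobiusFactor g p) → IsTranslation α → IsTranslation β := by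
    intro g α β h hα
    have hs : SmoothOnSphere fun p => (α p : ℂ) := fun i =>
      Complex.ofRealCLM.contDiff.comp (hα.smooth i)
    have e : (fun p => (β p : ℂ)) = pullback g fun p => (α p : ℂ) := by
      funext p
      simp [h, pullback]
    have hβs : SmoothOnSphere β := fun i => by
      have h1 : ContDiff ℝ ∞ fun z => pullback g (fun p => (α p : ℂ)) (chart i z) :=
        hs.pullback g i
      rw [← e] at h1
      exact Complex.reCLM.contDiff.comp h1
    rw [isTranslation_iff_ethSq_eq_zero hβs, e]
    exact ethSq_pullback_eq_zero g hs hα.ethSq_eq_zero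
  refine ⟨key g⁻¹ β α fun p => ?_, key g α β h⟩
  have h1 := mobius_mul_factor g g⁻¹ p
  rw [mul_inv_cancel, mobiusFactor_one] at h1
  rw [h, ← Equiv.Perm.mul_apply, ← map_mul, mul_inv_cancel, map_one, Equiv.Perm.one_apply, div_div,
    ← h1, div_one]

/-! ## The frame factor -/

/-- The derivative of `f` is `(cζ + d)⁻²` and `K P(f ζ) = P(ζ)/|cζ + d|²`. The moduli cancel and
leave the phase of `(cζ + d)²`, which is `e^{iψ}`. -/
theorem BMS.factor_mul_newFrame (b : BMS) {g : SL2C} (hf : b.f = mobius g)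
    (hK : b.K = mobiusFactor g) {z z' : ℂ} (h : b.f z = z') :
    b.K z * b.newFrame z = (g 1 0 * z + g 1 1) / (starRingEnd ℂ) (g 1 0 * z + g 1 1) *
      (√2 * P z) := by
  rw [hf] at h
  obtain ⟨hq, hz'⟩ := mobius_finite g h
  have hd : deriv (fun y : ℂ => coord (b.f y)) z = 1 / (g 1 0 * z + g 1 1) ^ 2 := by
    refine HasDerivAt.deriv ?_
    have h1 := hasDerivAt_fractional (g 0 0) (g 0 1) hq
    rw [g.det_eq] at h1
    refine h1.congr_of_eventuallyEq ?_
    filter_upwards [mobius_eventually_finite g hq] with y hy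
    rw [hf, hy]
    rfl
  have hco : coord (b.f z) = z' := by rw [hf, h]; rfl
  have hq' : (starRingEnd ℂ) (g 1 0 * z + g 1 1) ≠ 0 := (map_ne_zero _).2 hq
  have hN : (g 0 0 * z + g 0 1) * (starRingEnd ℂ) (g 0 0 * z + g 0 1) +
      (g 1 0 * z + g 1 1) * (starRingEnd ℂ) (g 1 0 * z + g 1 1) ≠ 0 := by
    simp only [← ofReal_norm_sq]
    norm_cast
    exact (norm_sq_add_norm_sq_pos (.inr hq)).ne'
  rw [newFrame, hd, hco, hK, P_eq, P_eq, mobiusFactor_coe, hz']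
  simp only [map_div₀]
  generalize (starRingEnd ℂ) (g 1 0 * z + g 1 1) = qb at *
  generalize (starRingEnd ℂ) (g 0 0 * z + g 0 1) = ab at *
  generalize g 1 0 * z + g 1 1 = q at *
  generalize g 0 0 * z + g 0 1 = a at *
  field_simp
  ring

/-- The transformation law of the asymptotic shear. -/
theorem SpaceTime.transformedShear_eq_mobius (M : SpaceTime) (b : BMS) {g : SL2C}
    (hf : b.f = mobius g) (hK : b.K = mobiusFactor g) (u : ℝ) {z z' : ℂ} (h : b.f z = z') :
    M.transformedShear b u z = (mobiusFactor g z : ℂ)⁻¹ * ((g 1 0 * z + g 1 1) /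
      (starRingEnd ℂ) (g 1 0 * z + g 1 1)) ^ 2 *
      (M.asymptoticShear u z + 1 / 2 * ethSq (fun p => (b.α p : ℂ)) z) := by
  have h1 := b.factor_mul_newFrame hf hK h
  have hP : (P z : ℂ) ≠ 0 := by exact_mod_cast (P_pos z).ne'
  have hK0 : (b.K z : ℂ) ≠ 0 := by exact_mod_cast (b.conformal.1 z).ne'
  have h2 : ((√2 : ℝ) : ℂ) ^ 2 = 2 := by norm_cast; simp
  rw [M.transformedShear_eq, ← hK]
  congr 1
  have h3 := congrArg (· ^ 2) h1
  simp only [mul_pow, h2] at h3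
  field_simp
  rw [show (b.K z : ℂ) ^ 2 * b.newFrame z ^ 2 = _ from h3]
  ring

theorem SpaceTime.exists_transformedShear_eq (M : SpaceTime) (b : BMS) (u : ℝ) {z z' : ℂ}
    (h : b.f z = z') :
    ∃ ψ : ℝ, b.K z * b.newFrame z = Complex.exp (ψ * Complex.I) * (√2 * P z) ∧
      M.transformedShear b u z = (b.K z : ℂ)⁻¹ * Complex.exp (2 * ψ * Complex.I) *
        (M.asymptoticShear u z + 1 / 2 * ethSq (fun p => (b.α p : ℂ)) z) := by
  obtain ⟨g, hf, hK⟩ := b.conformal.exists_mobius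
  have hq := (mobius_finite g (hf ▸ h)).1
  set t : ℂ := (g 1 0 * z + g 1 1) / (starRingEnd ℂ) (g 1 0 * z + g 1 1) with ht
  have hn : ‖t‖ = 1 := by
    rw [ht, norm_div, RCLike.norm_conj, div_self (norm_ne_zero_iff.2 hq)]
  have he : Complex.exp (Complex.arg t * Complex.I) = t := by
    have := Complex.norm_mul_exp_arg_mul_I t
    rwa [hn, Complex.ofReal_one, one_mul] at this
  refine ⟨Complex.arg t, ?_, ?_⟩
  · rw [he, b.factor_mul_newFrame hf hK h]
  · rw [M.transformedShear_eq_mobius b hf hK u h, ← ht, hK, mul_assoc 2, two_mul, Complex.exp_add,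
      he, sq]

/-! ## The electric part of the past limit of the shear -/

theorem SmoothOnSphere.ofReal {α : OnePoint ℂ → ℝ} (h : SmoothOnSphere α) :
    SmoothOnSphere fun p => (α p : ℂ) := fun i => Complex.ofRealCLM.contDiff.comp (h i)

theorem SmoothOnSphere.re {ξ : OnePoint ℂ → ℂ} (h : SmoothOnSphere ξ) :
    SmoothOnSphere fun p => (ξ p).re := fun i => Complex.reCLM.contDiff.comp (h i)

theorem IsTranslation.add {α β : OnePoint ℂ → ℝ} (hα : IsTranslation α) (hβ : IsTranslation β) :
    IsTranslation fun p => α p + β p := by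
  obtain ⟨a, v, h⟩ := hα
  obtain ⟨b, w, k⟩ := hβ
  refine ⟨a + b, v + w, fun p => ?_⟩
  simp only [h, k, Pi.add_apply, add_mul, Finset.sum_add_distrib]
  ring

theorem IsTranslation.const_mul {α : OnePoint ℂ → ℝ} (c : ℝ) (hα : IsTranslation α) :
    IsTranslation fun p => c * α p := by
  obtain ⟨a, v, h⟩ := hα
  refine ⟨c * a, c • v, fun p => ?_⟩
  simp only [h, Pi.smul_apply, smul_eq_mul, mul_add, Finset.mul_sum, mul_assoc]

/-- The limit of the transformed shear is the image under `ð²` of the pull-back of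
`ξ + α / 2`, if the original limit is `ð² ξ`. -/
theorem SpaceTime.tendsto_transformedShear (M : SpaceTime) {ξ : OnePoint ℂ → ℂ}
    (hξ : SmoothOnSphere ξ)
    (hlim : ∀ z, Filter.Tendsto (fun u => M.asymptoticShear u z) Filter.atBot (𝓝 (ethSq ξ z)))
    (b : BMS) {g : SL2C} (hf : b.f = mobius g) (hK : b.K = mobiusFactor g) {z z' : ℂ}
    (h : b.f z = z') :
    Filter.Tendsto (fun u => M.transformedShear b u z) Filter.atBot
      (𝓝 (ethSq (pullback g⁻¹ fun p => ξ p + 1 / 2 * b.α p) z')) := by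
  have hα := b.smooth.ofReal
  have hη : SmoothOnSphere fun p => ξ p + 1 / 2 * (b.α p : ℂ) := fun i =>
    (hξ i).add (contDiff_const.mul (hα i))
  have h1 := fun u => M.transformedShear_eq_mobius b hf hK u h
  rw [hf] at h
  simp only [h1]
  rw [ethSq_pullback g (hη.pullback g⁻¹) h, ← pullback_mul, inv_mul_cancel, pullback_one,
    ethSq_add hξ (fun i => contDiff_const.mul (hα i)), ethSq_const_mul]
  exact ((hlim z).add_const _).const_mul _

/-- The limit is `ð²` of the pull-back of `ξ + α/2` under `f⁻¹`, and its electric part is `ð²` of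
the real part of that potential. Since the pull-back divides by a real factor, it commutes with
`Re`, and it preserves translations. -/
theorem SpaceTime.electricFree_iff (M : SpaceTime) {ξ : OnePoint ℂ → ℂ} (hξ : SmoothOnSphere ξ)
    (hlim : ∀ z, Filter.Tendsto (fun u => M.asymptoticShear u z) Filter.atBot (𝓝 (ethSq ξ z)))
    (b : BMS) : M.ElectricFree b ↔ IsTranslation fun p => (ξ p).re + 1 / 2 * b.α p := by
  obtain ⟨g, hf, hK⟩ := b.conformal.exists_mobius
  have hα := b.smooth.ofReal
  set η : OnePoint ℂ → ℂ := fun p => ξ p + 1 / 2 * (b.α p : ℂ) with hη'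
  have hη : SmoothOnSphere η := fun i => (hξ i).add (contDiff_const.mul (hα i))
  have hηb := hη.pullback g⁻¹
  have hT : ∀ z z' : ℂ, b.f z = z' → _ := fun z z' h =>
    M.tendsto_transformedShear hξ hlim b hf hK h
  have hre : IsTranslation (fun p => (pullback g⁻¹ η p).re) ↔
      IsTranslation fun p => (ξ p).re + 1 / 2 * b.α p :=
    isTranslation_pullback_iff g⁻¹ fun p => by
      rw [pullback, Complex.div_ofReal_re, hη']
      simp
  rw [← hre]
  constructor
  · rintro ⟨S', ⟨hS', hlim'⟩, χ, hχ, rfl, hχ0⟩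
    have he : ethSq χ = ethSq (pullback g⁻¹ η) :=
      eq_of_eq_of_mobius_finite g hS'.1.continuous (contDiff_ethSq hηb).continuous
        fun z z' h => tendsto_nhds_unique (hlim' z z' (hf ▸ h)) (hT z z' (hf ▸ h))
    have hχt : IsTranslation fun p => (χ p).re :=
      (isTranslation_iff_ethSq_eq_zero hχ.re).2 fun z => (congrFun hχ0 z).symm
    -- The potential `χ` supplied by the definition need not be the pull-back, but the two differ by
    -- an element of the kernel, whose real part is a translation.
    obtain ⟨a, b, c, d, hs⟩ := exists_sesq_of_ethSq_eq_zero
      (ξ := fun p => pullback g⁻¹ η p + (-1) * χ p)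
      (fun i => (hηb i).add (contDiff_const.mul (hχ i))) fun z => by
        rw [ethSq_add hηb (fun i => contDiff_const.mul (hχ i)), ethSq_const_mul, he]
        ring
    have := (isTranslation_re_sesq a b c d).add hχt
    convert this using 2 with p
    rw [← hs]
    simp
  · intro h
    refine ⟨ethSq (pullback g⁻¹ η), ⟨isSpinTwo_ethSq hηb, hT⟩, _, hηb, rfl, ?_⟩
    funext z
    exact (h.ethSq_eq_zero z).symm

/-! ## The spinor map `SL(2, ℂ) → L₊↑` -/

/-- The Hermitian matrix of a vector of Minkowski space. -/
def herm (v : Fin 4 → ℝ) : Matrix (Fin 2) (Fin 2) ℂ :=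
  !![(v 0 : ℂ) + v 3, v 1 + v 2 * I; v 1 - v 2 * I, v 0 - v 3]

/-- The vector of a Hermitian matrix. -/
noncomputable def unherm (H : Matrix (Fin 2) (Fin 2) ℂ) : Fin 4 → ℝ :=
  ![((H 0 0).re + (H 1 1).re) / 2, (H 0 1).re, (H 0 1).im, ((H 0 0).re - (H 1 1).re) / 2]

theorem unherm_herm (v : Fin 4 → ℝ) : unherm (herm v) = v := by
  funext i
  fin_cases i <;> simp [unherm, herm]

theorem herm_unherm {H : Matrix (Fin 2) (Fin 2) ℂ} (h : H.IsHermitian) : herm (unherm H) = H := by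
  have h00 := h.apply 0 0
  have h11 := h.apply 1 1
  have h01 := h.apply 1 0
  rw [← starRingEnd_apply, Complex.conj_eq_iff_re] at h00 h11
  ext i j
  fin_cases i <;> fin_cases j
  · simp [unherm, herm]
    linear_combination h00
  · simp [unherm, herm, Complex.re_add_im]
  · simp [unherm, herm, ← h01, Complex.ext_iff]
  · simp [unherm, herm]
    linear_combination h11

theorem isHermitian_herm (v : Fin 4 → ℝ) : (herm v).IsHermitian := by
  ext i j
  fin_cases i <;> fin_cases j <;> simp [herm, sub_eq_add_neg]

theorem herm_injective : Function.Injective herm :=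
  Function.LeftInverse.injective unherm_herm

/-- The Lorentz product. -/
def lorentzForm (v w : Fin 4 → ℝ) : ℝ := v 0 * w 0 - v 1 * w 1 - v 2 * w 2 - v 3 * w 3

theorem det_herm (v : Fin 4 → ℝ) : (herm v).det = (lorentzForm v v : ℝ) := by
  simp [herm, Matrix.det_fin_two_of, lorentzForm]
  linear_combination ((v 2 : ℂ) ^ 2) * Complex.I_sq

theorem dotProduct_minkowski (v w : Fin 4 → ℝ) : v ⬝ᵥ (minkowski *ᵥ w) = lorentzForm v w := by
  simp [minkowski, lorentzForm, Matrix.mulVec_diagonal, dotProduct, Fin.sum_univ_four]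
  ring

/-- The action of `g` on Minkowski space, as a linear map. -/
noncomputable def spinorMap (g : SL2C) : (Fin 4 → ℝ) →ₗ[ℝ] Fin 4 → ℝ where
  toFun v := unherm ((g : Matrix (Fin 2) (Fin 2) ℂ) * herm v * (g : Matrix (Fin 2) (Fin 2) ℂ)ᴴ)
  map_add' v w := by
    have : herm (v + w) = herm v + herm w := by
      ext i j
      fin_cases i <;> fin_cases j <;> simp [herm] <;> ring
    rw [this, Matrix.mul_add, Matrix.add_mul]
    funext i
    fin_cases i <;> simp [unherm] <;> ring
  map_smul' c v := by
    have : herm (c • v) = (c : ℂ) • herm v := by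
      ext i j
      fin_cases i <;> fin_cases j <;> simp [herm] <;> ring
    rw [this, Matrix.mul_smul, Matrix.smul_mul]
    funext i
    fin_cases i <;> simp [unherm] <;> ring

theorem herm_spinorMap (g : SL2C) (v : Fin 4 → ℝ) : herm (spinorMap g v) =
    (g : Matrix (Fin 2) (Fin 2) ℂ) * herm v * (g : Matrix (Fin 2) (Fin 2) ℂ)ᴴ :=
  herm_unherm (Matrix.isHermitian_mul_mul_conjTranspose _ (isHermitian_herm v))

/-- The action of `SL(2, ℂ)` on Minkowski space, as matrices. -/
noncomputable def spinorMatrix : SL2C →* Matrix (Fin 4) (Fin 4) ℝ where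
  toFun g := LinearMap.toMatrix' (spinorMap g)
  map_one' := by
    have : spinorMap 1 = LinearMap.id := by
      refine LinearMap.ext fun v => herm_injective ?_
      simp [herm_spinorMap]
    rw [this, LinearMap.toMatrix'_id]
  map_mul' g h := by
    have : spinorMap (g * h) = spinorMap g ∘ₗ spinorMap h := by
      refine LinearMap.ext fun v => herm_injective ?_
      simp [herm_spinorMap, Matrix.mul_assoc]
    rw [this, LinearMap.toMatrix'_comp]

theorem spinorMatrix_mulVec (g : SL2C) (v : Fin 4 → ℝ) : spinorMatrix g *ᵥ v = spinorMap g v :=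
  LinearMap.toMatrix'_mulVec _ _

theorem lorentzForm_spinorMap_self (g : SL2C) (v : Fin 4 → ℝ) :
    lorentzForm (spinorMap g v) (spinorMap g v) = lorentzForm v v := by
  have h := det_herm (spinorMap g v)
  rw [herm_spinorMap, Matrix.det_mul, Matrix.det_mul, Matrix.det_conjTranspose, g.det_coe, star_one,
    one_mul, mul_one, det_herm] at h
  exact_mod_cast h.symm

theorem lorentzForm_spinorMap (g : SL2C) (v w : Fin 4 → ℝ) :
    lorentzForm (spinorMap g v) (spinorMap g w) = lorentzForm v w := by
  have h := lorentzForm_spinorMap_self g (v + w)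
  have hv := lorentzForm_spinorMap_self g v
  have hw := lorentzForm_spinorMap_self g w
  rw [map_add] at h
  simp only [lorentzForm, Pi.add_apply] at *
  linarith

theorem isLorentz_iff (A : Matrix (Fin 4) (Fin 4) ℝ) : Aᵀ * minkowski * A = minkowski ↔
    ∀ v w, lorentzForm (A *ᵥ v) (A *ᵥ w) = lorentzForm v w := by
  have key : ∀ v w, lorentzForm (A *ᵥ v) (A *ᵥ w) = v ⬝ᵥ ((Aᵀ * minkowski * A) *ᵥ w) := by
    intro v w
    rw [← dotProduct_minkowski, ← Matrix.mulVec_mulVec, ← Matrix.mulVec_mulVec,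
      Matrix.dotProduct_mulVec v, Matrix.vecMul_transpose]
  constructor
  · intro h v w
    rw [key, h, dotProduct_minkowski]
  · intro h
    ext i j
    have := h (Pi.single i 1) (Pi.single j 1)
    rw [key, ← dotProduct_minkowski] at this
    simpa using this

/-- By Cayley-Hamilton `(g + 1)² = (tr g + 2) g`, so `(g + 1)/s` with `s² = tr g + 2` squares to `g`
unless `tr g = -2`; in that case `-g` has trace `2`. -/
theorem SL2C.exists_sq (g : SL2C) : ∃ h : SL2C, h * h = g ∨ h * h = -g := by
  have key : ∀ g : SL2C, g 0 0 + g 1 1 + 2 ≠ 0 → ∃ h : SL2C, h * h = g := by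
    intro g hg
    obtain ⟨s, hs⟩ := IsAlgClosed.exists_pow_nat_eq (g 0 0 + g 1 1 + 2) two_pos
    have hs0 : s ≠ 0 := by
      rintro rfl
      exact hg (by rw [← hs]; simp)
    have hd := g.det_eq
    obtain ⟨h, h00, h01, h10, h11⟩ := exists_SL2C (a := (g 0 0 + 1) / s) (b := g 0 1 / s)
      (c := g 1 0 / s) (d := (g 1 1 + 1) / s) (by
        field_simp
        linear_combination hd - hs)
    refine ⟨h, ?_⟩
    ext i j
    rw [Matrix.SpecialLinearGroup.coe_mul, Matrix.mul_apply, Fin.sum_univ_two]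
    fin_cases i <;> fin_cases j <;> simp only [Fin.zero_eta, Fin.mk_one, h00, h01, h10, h11] <;>
      field_simp
    · linear_combination g 0 0 * hs.symm - hd
    · linear_combination g 0 1 * hs.symm
    · linear_combination g 1 0 * hs.symm
    · linear_combination g 1 1 * hs.symm - hd
  by_cases hg : g 0 0 + g 1 1 + 2 = 0
  · obtain ⟨h, hh⟩ := key (-g) (by
      simp only [Matrix.SpecialLinearGroup.coe_neg, Matrix.neg_apply]
      intro h
      have : (4 : ℂ) = 0 := by linear_combination h + hg
      norm_num at this)
    exact ⟨h, .inr hh⟩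
  · obtain ⟨h, hh⟩ := key g hg
    exact ⟨h, .inl hh⟩

theorem isLorentz_spinorMatrix (g : SL2C) :
    (spinorMatrix g)ᵀ * minkowski * spinorMatrix g = minkowski := by
  rw [isLorentz_iff]
  intro v w
  simp only [spinorMatrix_mulVec, lorentzForm_spinorMap]

/-- The determinant is `±1`. Up to sign `g` is a square, and `g` and `-g` act alike, so the
determinant is a square of `±1`. This replaces a connectedness argument. -/
theorem det_spinorMatrix (g : SL2C) : (spinorMatrix g).det = 1 := by
  have hsq : ∀ g, (spinorMatrix g).det * (spinorMatrix g).det = 1 := fun g => by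
    have h := congrArg Matrix.det (isLorentz_spinorMatrix g)
    rw [Matrix.det_mul, Matrix.det_mul, Matrix.det_transpose] at h
    have hm : minkowski.det ≠ 0 := by
      simp [minkowski, Matrix.det_diagonal, Fin.prod_univ_four]
    apply mul_left_cancel₀ hm
    linear_combination h
  have hneg : spinorMatrix (-g) = spinorMatrix g := by
    have : spinorMap (-g) = spinorMap g := by
      refine LinearMap.ext fun v => herm_injective ?_
      simp [herm_spinorMap]
    change LinearMap.toMatrix' _ = LinearMap.toMatrix' _
    rw [this]
  obtain ⟨h, hh | hh⟩ := g.exists_sq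
  · rw [← hh, map_mul, Matrix.det_mul, hsq]
  · rw [← hneg, ← hh, map_mul, Matrix.det_mul, hsq]

/-! ## Null vectors -/

/-- The null vector of a spinor. -/
noncomputable def nullVec (x y : ℂ) : Fin 4 → ℝ :=
  ![Complex.normSq x + Complex.normSq y, 2 * (x * (starRingEnd ℂ) y).re,
    2 * (x * (starRingEnd ℂ) y).im, Complex.normSq x - Complex.normSq y]

theorem herm_nullVec (x y : ℂ) : herm (nullVec x y) =
    !![2 * (x * (starRingEnd ℂ) x), 2 * (x * (starRingEnd ℂ) y);
      2 * (y * (starRingEnd ℂ) x), 2 * (y * (starRingEnd ℂ) y)] := by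
  simp only [Complex.mul_conj x, Complex.mul_conj y]
  ext i j
  fin_cases i <;> fin_cases j <;> simp [herm, nullVec, Complex.ext_iff] <;> (try constructor) <;> ring

theorem spinorMap_nullVec (g : SL2C) (x y : ℂ) : spinorMap g (nullVec x y) =
    nullVec (g 0 0 * x + g 0 1 * y) (g 1 0 * x + g 1 1 * y) := by
  apply herm_injective
  rw [herm_spinorMap, herm_nullVec, herm_nullVec]
  ext i j
  fin_cases i <;> fin_cases j <;>
    simp [Matrix.mul_apply, Fin.sum_univ_two] <;> ring

theorem lorentzForm_nullVec (x y x' y' : ℂ) : lorentzForm (nullVec x y) (nullVec x' y') =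
    2 * Complex.normSq (x * y' - x' * y) := by
  simp [lorentzForm, nullVec, Complex.normSq_apply]
  ring

theorem nullVec_smul (c x y : ℂ) : nullVec (c * x) (c * y) = Complex.normSq c • nullVec x y := by
  funext i
  fin_cases i <;> simp [nullVec, Complex.normSq_apply] <;> ring

/-- The phase of the spinor is free, so `x` may be taken real: `x² = (n₀ + n₃)/2`, and then `x ȳ =
(n₁ + i n₂)/2` fixes `y`. When `n₀ + n₃ = 0` the spinor has `x = 0`. -/
theorem exists_nullVec {n : Fin 4 → ℝ} (h : lorentzForm n n = 0) (h0 : 0 < n 0) :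
    ∃ x y, n = nullVec x y := by
  have h' : n 0 ^ 2 = n 1 ^ 2 + n 2 ^ 2 + n 3 ^ 2 := by
    unfold lorentzForm at h
    linarith
  have hle : 0 ≤ n 0 + n 3 := by nlinarith [sq_nonneg (n 1), sq_nonneg (n 2)]
  rcases hle.eq_or_lt with h3 | h3
  · have h1 : n 1 = 0 := by nlinarith [sq_nonneg (n 1), sq_nonneg (n 2)]
    have h2 : n 2 = 0 := by nlinarith [sq_nonneg (n 1), sq_nonneg (n 2)]
    refine ⟨0, (√(n 0) : ℝ), ?_⟩
    have := Real.mul_self_sqrt h0.le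
    funext i
    fin_cases i <;> simp [nullVec, this, h1, h2]
    linarith
  · have hx := Real.mul_self_sqrt (show 0 ≤ (n 0 + n 3) / 2 by linarith)
    have hx0 : 0 < √((n 0 + n 3) / 2) := Real.sqrt_pos.2 (by linarith)
    set x := √((n 0 + n 3) / 2)
    refine ⟨x, ⟨n 1 / (2 * x), -n 2 / (2 * x)⟩, ?_⟩
    have hx2 : x ^ 2 = (n 0 + n 3) / 2 := by rw [sq, hx]
    funext i
    fin_cases i
    · simp [nullVec, Complex.normSq_apply]
      field_simp
      have h4 : x ^ 4 = ((n 0 + n 3) / 2) ^ 2 := by rw [← hx2]; ring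
      nlinarith
    · simp [nullVec, Complex.normSq_apply]
      field_simp
    · simp [nullVec, Complex.normSq_apply]
      field_simp
    · simp [nullVec, Complex.normSq_apply]
      field_simp
      have h4 : x ^ 4 = ((n 0 + n 3) / 2) ^ 2 := by rw [← hx2]; ring
      nlinarith

/-- Twice the unit time vector is a sum of two spinor null vectors. Their images are again of this
kind, with time components that are sums of squared moduli of entries of `g`. -/
theorem spinorMatrix_zero_zero_pos (g : SL2C) : 0 < spinorMatrix g 0 0 := by
  have h1 : (2 : ℝ) • Pi.single 0 1 = nullVec 1 0 + nullVec 0 1 := by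
    funext i
    fin_cases i <;> simp [nullVec, one_add_one_eq_two]
  have h2 : 2 * spinorMatrix g 0 0 = (spinorMatrix g *ᵥ ((2 : ℝ) • Pi.single 0 1)) 0 := by
    rw [Matrix.mulVec_smul, Matrix.mulVec_single_one, Pi.smul_apply, Matrix.col_apply, smul_eq_mul]
  rw [h1, Matrix.mulVec_add, spinorMatrix_mulVec, spinorMatrix_mulVec, spinorMap_nullVec,
    spinorMap_nullVec, Pi.add_apply] at h2
  simp only [mul_one, mul_zero, add_zero, zero_add, nullVec, Matrix.cons_val_zero,
    Complex.normSq_eq_norm_sq] at h2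
  have h3 : g 1 0 ≠ 0 ∨ g 1 1 ≠ 0 := by
    by_contra! h
    have := g.det_eq
    simp [h.1, h.2] at this
  have h4 := norm_sq_add_norm_sq_pos h3
  nlinarith [sq_nonneg ‖g 0 0‖, sq_nonneg ‖g 0 1‖]

/-- The spinor map onto the restricted Lorentz group. -/
noncomputable def spinorHom : SL2C →* lorentzGroup where
  toFun g := ⟨⟨spinorMatrix g, det_spinorMatrix g⟩, isLorentz_spinorMatrix g,
    spinorMatrix_zero_zero_pos g⟩
  map_one' := Subtype.ext (Subtype.ext (map_one _))
  map_mul' g h := Subtype.ext (Subtype.ext (map_mul _ g h))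

/-! ## Surjectivity of the spinor map -/

/-- The first row of `A` has Lorentz norm `1`, hence `|A₀₃| < A₀₀`. For `s = ±1` the quantity is the
time component of the image of `(1, 0, 0, s)`. -/
theorem lorentz_nullVec_pos {A : Matrix (Fin 4) (Fin 4) ℝ} (h : Aᵀ * minkowski * A = minkowski)
    (h0 : 0 < A 0 0) {s : ℝ} (hs : s ^ 2 = 1) : 0 < A 0 0 + s * A 0 3 := by
  have h1 := congrFun (congrFun (lorentz_transpose h) 0) 0
  simp [minkowski, Matrix.mul_apply, Fin.sum_univ_four, Matrix.diagonal] at h1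
  have h2 : (s * A 0 3) ^ 2 < A 0 0 ^ 2 := by
    rw [mul_pow, hs]
    nlinarith [sq_nonneg (A 0 1), sq_nonneg (A 0 2)]
  have := (abs_lt.1 (abs_lt_of_sq_lt_sq h2 h0.le)).1
  linarith

/-- A Lorentz transformation fixing two null directions pointwise is a rotation of the orthogonal
plane, and comes from a diagonal element of `SL(2, ℂ)`. -/
theorem exists_spinor_of_fix {A : Matrix (Fin 4) (Fin 4) ℝ} (h : Aᵀ * minkowski * A = minkowski)
    (hd : A.det = 1) (h1 : A *ᵥ nullVec 1 0 = nullVec 1 0) (h2 : A *ᵥ nullVec 0 1 = nullVec 0 1) :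
    ∃ g, spinorMatrix g = A := by
  have hn : nullVec 1 0 = ![1, 0, 0, 1] ∧ nullVec 0 1 = ![1, 0, 0, -1] := by
    constructor <;> funext i <;> fin_cases i <;> simp [nullVec]
  rw [hn.1] at h1
  rw [hn.2] at h2
  have c0 : ∀ i, A i 0 = if i = 0 then 1 else 0 := fun i => by
    have e1 := congrFun h1 i
    have e2 := congrFun h2 i
    simp [Matrix.mulVec, dotProduct, Fin.sum_univ_four] at e1 e2
    fin_cases i <;> simp at * <;> linarith
  have c3 : ∀ i, A i 3 = if i = 3 then 1 else 0 := fun i => by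
    have e1 := congrFun h1 i
    have e2 := congrFun h2 i
    simp [Matrix.mulVec, dotProduct, Fin.sum_univ_four] at e1 e2
    fin_cases i <;> simp at * <;> linarith
  have hij := fun i j => congrFun (congrFun h i) j
  simp only [minkowski, Matrix.mul_apply, Fin.sum_univ_four, Matrix.transpose_apply,
    Matrix.diagonal_apply] at hij
  have r01 := hij 0 1
  have r02 := hij 0 2
  have r31 := hij 3 1
  have r32 := hij 3 2
  have r11 := hij 1 1
  have r12 := hij 1 2
  have r22 := hij 2 2
  simp [c0, c3] at r01 r02 r31 r32 r11 r12 r22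
  simp only [r01, r02, r31, r32] at r11 r12 r22
  have hdet : A 1 1 * A 2 2 - A 1 2 * A 2 1 = 1 := by
    rw [← hd, Matrix.det_succ_row_zero]
    simp [Fin.sum_univ_succ, Matrix.det_fin_three, c0, c3, r31, r32, Fin.succAbove,
      Matrix.submatrix_apply]
  have e22 : A 2 2 = A 1 1 := by
    linear_combination A 2 2 * r11 - A 2 1 * r12 + A 1 1 * hdet
  have e12 : A 1 2 = -A 2 1 := by
    linear_combination A 1 2 * r11 - A 1 1 * r12 - A 2 1 * hdet
  -- The remaining block is a rotation. The matrix `diag(w, w̄)` rotates the plane by `w²`, so a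
  -- square root of `A₁₁ + i A₂₁` is needed.
  obtain ⟨w, hw⟩ := IsAlgClosed.exists_pow_nat_eq (⟨A 1 1, A 2 1⟩ : ℂ) two_pos
  have hwn : Complex.normSq w = 1 := by
    have h3 : Complex.normSq w ^ 2 = 1 := by
      rw [← map_pow, hw, Complex.normSq_mk]
      linarith
    nlinarith [Complex.normSq_nonneg w]
  have hwc : w * (starRingEnd ℂ) w = 1 := by rw [Complex.mul_conj, hwn, Complex.ofReal_one]
  obtain ⟨g, h00, h01, h10, h11⟩ := exists_SL2C (a := w) (b := 0) (c := 0) (d := (starRingEnd ℂ) w)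
    (by rw [hwc]; ring)
  have hw2 : ((starRingEnd ℂ) w) ^ 2 = ⟨A 1 1, -A 2 1⟩ := by
    rw [← map_pow, hw]
    rfl
  refine ⟨g, ?_⟩
  refine Matrix.toLin'.injective (LinearMap.ext fun v => herm_injective ?_)
  rw [Matrix.toLin'_apply, Matrix.toLin'_apply, spinorMatrix_mulVec, herm_spinorMap]
  have hA : A *ᵥ v = ![v 0, A 1 1 * v 1 - A 2 1 * v 2, A 2 1 * v 1 + A 1 1 * v 2, v 3] := by
    funext i
    fin_cases i <;>
      simp [Matrix.mulVec, dotProduct, Fin.sum_univ_four, c0, c3, r01, r02, r31, r32, e22, e12]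
    ring
  have hmk : ∀ a b : ℝ, (⟨a, b⟩ : ℂ) = a + b * I := Complex.mk_eq_add_mul_I
  rw [hmk] at hw hw2
  push_cast at hw2
  rw [hA]
  ext i j
  fin_cases i <;> fin_cases j <;>
    simp [Matrix.mul_apply, Fin.sum_univ_two, herm, h00, h01, h10, h11]
  · linear_combination ((v 0 : ℂ) + v 3) * hwc
  · linear_combination ((v 1 : ℂ) + v 2 * I) * hw + (A 2 1 * v 2 : ℂ) * Complex.I_sq
  · linear_combination ((v 1 : ℂ) - v 2 * I) * hw2 + (A 2 1 * v 2 : ℂ) * Complex.I_sq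
  · linear_combination ((v 0 : ℂ) - v 3) * hwc

/-- The images of the two basic null vectors come from spinors `(a, c)` and `(b, d)`, and invariance
of the Lorentz product gives `|ad - bc| = 1`. Changing the phase of the second spinor makes the
determinant `1` without moving its null vector. The resulting `g` reduces the problem to
`exists_spinor_of_fix`. -/
theorem spinorHom_surjective : Function.Surjective spinorHom := by
  rintro ⟨A, hA, hA0⟩
  have hL := (isLorentz_iff _).1 hA
  have hnull : ∀ x y : ℂ, 0 < ((A : Matrix (Fin 4) (Fin 4) ℝ) *ᵥ nullVec x y) 0 →
      ∃ x' y', (A : Matrix (Fin 4) (Fin 4) ℝ) *ᵥ nullVec x y = nullVec x' y' := fun x y h =>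
    exists_nullVec (by rw [hL, lorentzForm_nullVec]; simp [mul_comm]) h
  obtain ⟨a, c, h1⟩ := hnull 1 0 (by
    have := lorentz_nullVec_pos hA hA0 (s := 1) (by norm_num)
    simpa [Matrix.mulVec, dotProduct, Fin.sum_univ_four, nullVec] using this)
  obtain ⟨b, d, h2⟩ := hnull 0 1 (by
    have := lorentz_nullVec_pos hA hA0 (s := -1) (by norm_num)
    simpa [Matrix.mulVec, dotProduct, Fin.sum_univ_four, nullVec] using this)
  have hdet : Complex.normSq (a * d - b * c) = 1 := by
    have h3 := hL (nullVec 1 0) (nullVec 0 1)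
    rw [h1, h2, lorentzForm_nullVec, lorentzForm_nullVec] at h3
    simp at h3
    exact h3
  set e := a * d - b * c with he
  have he0 : e ≠ 0 := by
    intro h
    simp [h] at hdet
  have hen : Complex.normSq e⁻¹ = 1 := by rw [map_inv₀, hdet, inv_one]
  obtain ⟨g, h00, h01, h10, h11⟩ := exists_SL2C (a := a) (b := e⁻¹ * b) (c := c) (d := e⁻¹ * d)
    (by field_simp; rw [he])
  have hg1 : spinorMatrix g *ᵥ nullVec 1 0 = nullVec a c := by
    rw [spinorMatrix_mulVec, spinorMap_nullVec, h00, h10]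
    simp
  have hg2 : spinorMatrix g *ᵥ nullVec 0 1 = nullVec b d := by
    rw [spinorMatrix_mulVec, spinorMap_nullVec, h01, h11]
    simp [nullVec_smul, hen]
  have hinv : spinorMatrix g⁻¹ * spinorMatrix g = 1 := by rw [← map_mul, inv_mul_cancel, map_one]
  have hgA : ∀ x y x' y' : ℂ, spinorMatrix g *ᵥ nullVec x y = nullVec x' y' →
      (A : Matrix (Fin 4) (Fin 4) ℝ) *ᵥ nullVec x y = nullVec x' y' →
      (spinorMatrix g⁻¹ * (A : Matrix (Fin 4) (Fin 4) ℝ)) *ᵥ nullVec x y = nullVec x y := by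
    intro x y x' y' e1 e2
    rw [← Matrix.mulVec_mulVec, e2, ← e1, Matrix.mulVec_mulVec, hinv, Matrix.one_mulVec]
  obtain ⟨k, hk⟩ := exists_spinor_of_fix (A := spinorMatrix g⁻¹ * (A : Matrix (Fin 4) (Fin 4) ℝ))
    (by
      rw [isLorentz_iff]
      intro v w
      rw [← Matrix.mulVec_mulVec, ← Matrix.mulVec_mulVec,
        (isLorentz_iff _).1 (isLorentz_spinorMatrix g⁻¹), hL])
    (by rw [Matrix.det_mul, det_spinorMatrix, A.det_coe, one_mul])
    (hgA _ _ _ _ hg1 h1) (hgA _ _ _ _ hg2 h2)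
  refine ⟨g * k, Subtype.ext (Subtype.ext ?_)⟩
  change spinorMatrix (g * k) = _
  rw [map_mul, hk, ← mul_assoc, ← map_mul, mul_inv_cancel, map_one, one_mul]

/-! ## Null directions and translations -/

/-- The future null vector with time component `1` in a given direction. -/
noncomputable def nullDir (p : OnePoint ℂ) : Fin 4 → ℝ :=
  ![1, direction p 0, direction p 1, direction p 2]

theorem nullVec_eq_smul {x y : ℂ} (h : x ≠ 0 ∨ y ≠ 0) :
    nullVec x y = (‖x‖ ^ 2 + ‖y‖ ^ 2) • nullDir (homPoint x y) := by
  by_cases hy : y = 0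
  · subst hy
    have : homPoint x 0 = OnePoint.infty := by simp [homPoint]
    rw [this]
    funext i
    fin_cases i <;> simp [nullVec, nullDir, direction, Complex.normSq_eq_norm_sq]
  · have hy' : ‖y‖ ≠ 0 := norm_ne_zero_iff.2 hy
    have hp := norm_sq_add_norm_sq_pos h
    have hne : 1 + ‖x‖ ^ 2 / ‖y‖ ^ 2 = (‖x‖ ^ 2 + ‖y‖ ^ 2) / ‖y‖ ^ 2 := by
      field_simp
      ring
    have hz : x / y = (x * (starRingEnd ℂ) y) * ((‖y‖ ^ 2 : ℝ) : ℂ)⁻¹ := by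
      push_cast
      rw [ofReal_norm_sq]
      have : (starRingEnd ℂ) y ≠ 0 := (map_ne_zero _).2 hy
      field_simp
    have hre : (x / y).re = (x * (starRingEnd ℂ) y).re / ‖y‖ ^ 2 := by
      rw [hz, ← Complex.ofReal_inv, Complex.re_mul_ofReal, div_eq_mul_inv]
    have him : (x / y).im = (x * (starRingEnd ℂ) y).im / ‖y‖ ^ 2 := by
      rw [hz, ← Complex.ofReal_inv, Complex.im_mul_ofReal, div_eq_mul_inv]
    rw [homPoint, if_neg hy]
    funext i
    fin_cases i <;> simp only [nullVec, nullDir, direction, OnePoint.elim_some, hre, him, norm_div,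
      div_pow, hne, Complex.normSq_eq_norm_sq] <;> simp <;> field_simp

/-- A spinor `v` has null vector `|v|²` times the null direction of its point, and `g` acts linearly
on spinors, so the ratio of the two scales is `|v|²/|gv|² = K`. -/
theorem spinorMap_nullDir (g : SL2C) (p : OnePoint ℂ) :
    nullDir (mobius g p) = mobiusFactor g p • spinorMap g (nullDir p) := by
  obtain ⟨i, z, rfl⟩ := exists_chart p
  rw [chart_eq_homPoint]
  have h0 := chartVec_ne_zero i z
  generalize (chartVec i z).1 = x at *
  generalize (chartVec i z).2 = y at *
  have h := spinorMap_nullVec g x y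
  rw [nullVec_eq_smul h0, nullVec_eq_smul (g.image_ne_zero h0), map_smul] at h
  rw [mobius_homPoint g h0, mobiusFactor_homPoint g h0, div_eq_inv_mul, mul_smul, h, smul_smul,
    inv_mul_cancel₀ (norm_sq_add_norm_sq_pos (g.image_ne_zero h0)).ne', one_smul]

theorem nullDir_values : nullDir OnePoint.infty = ![1, 0, 0, 1] ∧
    nullDir ((0 : ℂ) : OnePoint ℂ) = ![1, 0, 0, -1] ∧
    nullDir ((1 : ℂ) : OnePoint ℂ) = ![1, 1, 0, 0] ∧
    nullDir ((I : ℂ) : OnePoint ℂ) = ![1, 0, 1, 0] := by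
  refine ⟨?_, ?_, ?_, ?_⟩ <;> funext i <;> fin_cases i <;> norm_num [nullDir, direction] <;> rfl

/-- The null directions at `∞, 0, 1, i` form a basis of Minkowski space. -/
theorem linearMap_ext_nullDir {E : Type*} [AddCommGroup E] [Module ℝ E]
    {A B : (Fin 4 → ℝ) →ₗ[ℝ] E} (h : ∀ p, A (nullDir p) = B (nullDir p)) : A = B := by
  obtain ⟨h1, h2, h3, h4⟩ := nullDir_values
  refine LinearMap.ext fun v => ?_
  have hv : v = ((v 0 + v 3 - v 1 - v 2) / 2) • nullDir OnePoint.infty +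
      ((v 0 - v 3 - v 1 - v 2) / 2) • nullDir ((0 : ℂ) : OnePoint ℂ) +
      v 1 • nullDir ((1 : ℂ) : OnePoint ℂ) + v 2 • nullDir ((I : ℂ) : OnePoint ℂ) := by
    rw [h1, h2, h3, h4]
    funext i
    fin_cases i <;> simp <;> ring
  rw [hv]
  simp only [map_add, map_smul, h]

theorem nullDir_injective : Function.Injective nullDir := by
  have hfin : ∀ z : ℂ, nullDir (z : OnePoint ℂ) 3 = 1 - 2 / (1 + ‖z‖ ^ 2) := fun z => by
    have : 1 + ‖z‖ ^ 2 ≠ 0 := by positivity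
    simp [nullDir, direction]
    field_simp
    ring
  have hne : ∀ z : ℂ, nullDir (z : OnePoint ℂ) ≠ nullDir OnePoint.infty := fun z h => by
    have h3 := congrFun h 3
    rw [hfin, nullDir_values.1] at h3
    have : 0 < 2 / (1 + ‖z‖ ^ 2) := by positivity
    change 1 - 2 / (1 + ‖z‖ ^ 2) = 1 at h3
    linarith
  intro p q h
  induction p using OnePoint.rec with
  | infty =>
    induction q using OnePoint.rec with
    | infty => rfl
    | coe w => exact absurd h.symm (hne w)
  | coe z =>
    induction q using OnePoint.rec with
    | infty => exact absurd h (hne z)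
    | coe w =>
      have h3 := congrFun h 3
      rw [hfin, hfin] at h3
      have hz : 1 + ‖z‖ ^ 2 ≠ 0 := by positivity
      have hw : 1 + ‖w‖ ^ 2 ≠ 0 := by positivity
      have hn : 1 + ‖z‖ ^ 2 = 1 + ‖w‖ ^ 2 := by
        field_simp at h3
        linarith
      have h1 := congrFun h 1
      have h2 := congrFun h 2
      simp only [nullDir, direction, OnePoint.elim_some, hn] at h1 h2
      simp at h1 h2
      field_simp at h1 h2
      rw [Complex.ext h1 h2]

theorem lorentzForm_smul_right (c : ℝ) (v w : Fin 4 → ℝ) :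
    lorentzForm v (c • w) = c * lorentzForm v w := by
  simp only [lorentzForm, Pi.smul_apply, smul_eq_mul]
  ring

theorem lorentzForm_add_left (v v' w : Fin 4 → ℝ) :
    lorentzForm (v + v') w = lorentzForm v w + lorentzForm v' w := by
  simp only [lorentzForm, Pi.add_apply]
  ring

/-- The translation functions are covariant under the Lorentz group. -/
theorem lorentzForm_nullDir_mobius (g : SL2C) (v : Fin 4 → ℝ) (p : OnePoint ℂ) :
    lorentzForm (spinorMap g v) (nullDir (mobius g p)) =
      mobiusFactor g p * lorentzForm v (nullDir p) := by
  rw [spinorMap_nullDir, lorentzForm_smul_right, lorentzForm_spinorMap]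

theorem isTranslation_iff_exists_lorentzForm {α : OnePoint ℂ → ℝ} :
    IsTranslation α ↔ ∃ v, ∀ p, α p = lorentzForm v (nullDir p) := by
  constructor
  · rintro ⟨a, w, h⟩
    refine ⟨![a, -w 0, -w 1, -w 2], fun p => ?_⟩
    rw [h]
    simp [lorentzForm, nullDir, Fin.sum_univ_three]
    ring
  · rintro ⟨v, h⟩
    refine ⟨v 0, ![-v 1, -v 2, -v 3], fun p => ?_⟩
    rw [h]
    simp [lorentzForm, nullDir, Fin.sum_univ_three]
    ring

theorem eq_zero_of_lorentzForm_nullDir {v : Fin 4 → ℝ} (h : ∀ p, lorentzForm v (nullDir p) = 0) :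
    v = 0 := by
  have h1 := h OnePoint.infty
  have h2 := h ((0 : ℂ) : OnePoint ℂ)
  have h3 := h ((1 : ℂ) : OnePoint ℂ)
  have h4 := h ((I : ℂ) : OnePoint ℂ)
  obtain ⟨e1, e2, e3, e4⟩ := nullDir_values
  rw [e1] at h1
  rw [e2] at h2
  rw [e3] at h3
  rw [e4] at h4
  simp [lorentzForm] at h1 h2 h3 h4
  funext i
  fin_cases i <;> simp <;> linarith

/-- The two actions determine each other through `spinorMap_nullDir`: the null directions span, and
distinct points have distinct ones. So the kernels need not be computed. -/
theorem mobius_eq_one_iff (g : SL2C) : mobius g = 1 ↔ spinorHom g = 1 := by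
  have hs : spinorHom g = 1 ↔ spinorMap g = LinearMap.id := by
    rw [← LinearMap.toMatrix'.injective.eq_iff, LinearMap.toMatrix'_id]
    exact Subtype.ext_iff.trans Subtype.ext_iff
  rw [hs]
  constructor
  · intro h
    refine linearMap_ext_nullDir fun p => ?_
    have h1 := isConformal_mobius g
    rw [h] at h1
    have h2 := isConformal_mobius 1
    rw [map_one] at h2
    have h3 := spinorMap_nullDir g p
    rwa [h1.factor_unique h2, mobiusFactor_one, one_smul, h, Equiv.Perm.one_apply, eq_comm] at h3
  · intro h
    refine Equiv.ext fun p => nullDir_injective ?_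
    have h1 := spinorMap_nullDir g p
    rw [h, LinearMap.id_apply] at h1
    have h2 := congrFun h1 0
    simp [nullDir] at h2
    rw [h1, ← h2, one_smul, Equiv.Perm.one_apply]

/-! ## Composition of BMS transformations -/

theorem BMS.toPerm_apply (b : BMS) (q : ℝ × OnePoint ℂ) :
    b.toPerm q = (b.K q.2 * (q.1 + b.α q.2), b.f q.2) := rfl

theorem BMS.eq_of_toPerm_eq {b c : BMS} (h : c.toPerm = b.toPerm) :
    c.f = b.f ∧ c.K = b.K ∧ c.α = b.α := by
  have e : ∀ u p, (c.K p * (u + c.α p), c.f p) = (b.K p * (u + b.α p), b.f p) := fun u p =>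
    Equiv.congr_fun h (u, p)
  have hf : c.f = b.f := Equiv.ext fun p => congrArg Prod.snd (e 0 p)
  have hK : c.K = b.K := IsConformal.factor_unique (hf ▸ c.conformal) b.conformal
  refine ⟨hf, hK, funext fun p => ?_⟩
  have h1 := congrArg Prod.fst (e 0 p)
  rw [hK] at h1
  simpa using mul_left_cancel₀ (b.conformal.1 p).ne' h1

/-- The composition of two BMS transformations. -/
noncomputable def BMS.comp (b b₀ : BMS) : BMS where
  f := b.f * b₀.f
  K p := b.K (b₀.f p) * b₀.K p
  -- From `K (K₀ (u + α₀) + α ∘ f₀) = K K₀ (u + α₀ + (α ∘ f₀)/K₀)`; the last term is a pull-back of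
  -- weight 1.
  α p := b₀.α p + b.α (b₀.f p) / b₀.K p
  conformal := b.conformal.comp b₀.conformal
  smooth i := by
    obtain ⟨g, hf, hK⟩ := b₀.conformal.exists_mobius
    have h1 := b.smooth.ofReal.pullback g i
    have h2 : ContDiff ℝ ∞ fun z => (BondiSachs.pullback g (fun p => (b.α p : ℂ)) (chart i z)).re :=
      Complex.reCLM.contDiff.comp h1
    simp only [BondiSachs.pullback, ← Complex.ofReal_div, Complex.ofReal_re, ← hf, ← hK] at h2
    exact (b₀.smooth i).add h2

theorem BMS.toPerm_comp (b b₀ : BMS) : (b.comp b₀).toPerm = b.toPerm * b₀.toPerm := by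
  refine Equiv.ext fun q => ?_
  have := (b₀.conformal.1 q.2).ne'
  rw [Equiv.Perm.mul_apply]
  simp only [toPerm_apply, comp, Equiv.Perm.mul_apply, Prod.mk.injEq, and_true]
  field_simp
  ring

/-- By hypothesis `Re ξ + α₀/2` is a translation, so for `b ∘ b₀` the condition reduces to `(α ∘
f₀)/K₀` being one. Pull-back preserves translations in both directions. -/
theorem SpaceTime.electricFree_congr (M : SpaceTime) {ξ : OnePoint ℂ → ℂ} (hξ : SmoothOnSphere ξ)
    (hlim : ∀ z, Filter.Tendsto (fun u => M.asymptoticShear u z) Filter.atBot (𝓝 (ethSq ξ z)))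
    {b₀ : BMS} (h₀ : M.ElectricFree b₀) (b : BMS) :
    (∃ c : BMS, c.toPerm = b.toPerm * b₀.toPerm ∧ M.ElectricFree c) ↔ IsTranslation b.α := by
  obtain ⟨g, hf, hK⟩ := b₀.conformal.exists_mobius
  rw [M.electricFree_iff hξ hlim] at h₀
  have h1 : M.ElectricFree (b.comp b₀) ↔ IsTranslation b.α := by
    rw [M.electricFree_iff hξ hlim, ← isTranslation_pullback_iff (α := b.α) g
      (β := fun p => b.α (b₀.f p) / b₀.K p) fun p => by rw [hf, hK]]
    constructor
    · intro h
      convert (h.add (h₀.const_mul (-1))).const_mul 2 using 2 with p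
      simp only [BMS.comp]
      ring
    · intro h
      convert h₀.add (h.const_mul (1 / 2)) using 2 with p
      simp only [BMS.comp]
      ring
  rw [← h1]
  refine ⟨?_, fun h => ⟨_, b.toPerm_comp b₀, h⟩⟩
  rintro ⟨c, hc, hce⟩
  obtain ⟨-, -, hα⟩ := BMS.eq_of_toPerm_eq (hc.trans (b.toPerm_comp b₀).symm)
  rw [M.electricFree_iff hξ hlim] at hce ⊢
  rwa [← hα]

/-! ## The Poincaré group as a group of BMS transformations -/

/-- The double cover of the Poincaré group. -/
abbrev SpinPoincareGroup : Type :=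
  Multiplicative (Fin 4 → ℝ) ⋊[lorentzAction.comp spinorHom] SL2C

theorem lorentzAction_spinorHom (g : SL2C) (v : Multiplicative (Fin 4 → ℝ)) :
    (lorentzAction.comp spinorHom g v).toAdd = spinorMap g v.toAdd :=
  spinorMatrix_mulVec g _

/-- The action of the double cover of the Poincaré group on null infinity. -/
noncomputable def poincareAction : SpinPoincareGroup →* Equiv.Perm (ℝ × OnePoint ℂ) :=
  MonoidHom.toHomPerm
    -- The translation acts after the Lorentz transformation, so its function is evaluated at the
    -- image point.
    { toFun := fun x q => (mobiusFactor x.right q.2 * q.1 +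
        lorentzForm x.left.toAdd (nullDir (mobius x.right q.2)), mobius x.right q.2)
      map_one' := by
        funext q
        simp [mobiusFactor_one, lorentzForm]
        rfl
      map_mul' := fun x y => by
        funext q
        change _ = (_, _)
        ext
        · simp only [SemidirectProduct.mul_left, SemidirectProduct.mul_right, toAdd_mul,
            lorentzAction_spinorHom, lorentzForm_add_left, map_mul, Equiv.Perm.mul_apply,
            mobius_mul_factor, lorentzForm_nullDir_mobius]
          ring
        · simp }

theorem poincareAction_apply (x : SpinPoincareGroup) (q : ℝ × OnePoint ℂ) :
    poincareAction x q = (mobiusFactor x.right q.2 * q.1 +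
      lorentzForm x.left.toAdd (nullDir (mobius x.right q.2)), mobius x.right q.2) := rfl

theorem mem_range_poincareAction {T : Equiv.Perm (ℝ × OnePoint ℂ)} :
    T ∈ poincareAction.range ↔ ∃ b : BMS, b.toPerm = T ∧ IsTranslation b.α := by
  constructor
  · rintro ⟨x, rfl⟩
    have ht : IsTranslation fun p => lorentzForm x.left.toAdd (nullDir (mobius x.right p)) /
        mobiusFactor x.right p :=
      (isTranslation_pullback_iff x.right fun p => rfl).2
        (isTranslation_iff_exists_lorentzForm.2 ⟨x.left.toAdd, fun p => rfl⟩)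
    refine ⟨⟨mobius x.right, mobiusFactor x.right, _, isConformal_mobius _, ht.smooth⟩, ?_, ht⟩
    refine Equiv.ext fun q => ?_
    have := (mobiusFactor_pos x.right q.2).ne'
    rw [poincareAction_apply, BMS.toPerm_apply]
    ext
    · simp only
      field_simp
    · rfl
  · rintro ⟨b, rfl, hb⟩
    obtain ⟨g, hf, hK⟩ := b.conformal.exists_mobius
    obtain ⟨v, hv⟩ := isTranslation_iff_exists_lorentzForm.1 hb
    -- In a BMS transformation `α` is added before the factor `K`, and `K ⟨v, n(p)⟩ = ⟨g v, n(f
    -- p)⟩`; hence the translation vector is `g v`.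
    refine ⟨⟨.ofAdd (spinorMap g v), g⟩, Equiv.ext fun q => ?_⟩
    rw [poincareAction_apply, BMS.toPerm_apply, hf, hK, hv, toAdd_ofAdd,
      lorentzForm_nullDir_mobius, mul_add]

/-- The covering map of the Poincaré group. -/
noncomputable def poincareCover : SpinPoincareGroup →* PoincareGroup :=
  SemidirectProduct.map (MonoidHom.id _) spinorHom fun g => by ext; rfl

theorem poincareCover_surjective : Function.Surjective poincareCover := by
  rintro ⟨v, Λ⟩
  obtain ⟨g, rfl⟩ := spinorHom_surjective Λ
  exact ⟨⟨v, g⟩, rfl⟩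

/-- Both kernels consist of the pairs with zero translation and with `g` acting trivially, on the
sphere or equivalently on Minkowski space. -/
theorem ker_poincareAction : poincareAction.ker = poincareCover.ker := by
  ext x
  have h2 : poincareCover x = 1 ↔ x.left = 1 ∧ spinorHom x.right = 1 :=
    SemidirectProduct.ext_iff
  rw [MonoidHom.mem_ker, MonoidHom.mem_ker, h2, ← mobius_eq_one_iff]
  constructor
  · intro h
    have e := fun q => (poincareAction_apply x q).symm.trans (Equiv.congr_fun h q)
    have h1 : mobius x.right = 1 := Equiv.ext fun p => congrArg Prod.snd (e (0, p))
    refine ⟨?_, h1⟩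
    have h3 : x.left.toAdd = 0 := eq_zero_of_lorentzForm_nullDir fun p => by
      have := congrArg Prod.fst (e (0, p))
      simpa [h1] using this
    exact h3
  · rintro ⟨h, h1⟩
    have h3 := isConformal_mobius x.right
    have h4 := isConformal_mobius 1
    rw [map_one] at h4
    rw [h1] at h3
    refine Equiv.ext fun q => ?_
    rw [poincareAction_apply, h, h1, h3.factor_unique h4, mobiusFactor_one]
    simp [lorentzForm]

theorem nonempty_range_mulEquiv : Nonempty (poincareAction.range ≃* PoincareGroup) :=
  ⟨(QuotientGroup.quotientKerEquivRange poincareAction).symm.trans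
    ((QuotientGroup.quotientMulEquivOfEq ker_poincareAction).trans
      (QuotientGroup.quotientKerEquivOfSurjective _ poincareCover_surjective))⟩

/-- The supertranslation by `α`. -/
noncomputable def BMS.supertranslation (α : OnePoint ℂ → ℝ) (hα : SmoothOnSphere α) : BMS where
  f := 1
  K _ := 1
  α := α
  conformal := by
    have h := isConformal_mobius 1
    rwa [map_one, funext mobiusFactor_one] at h
  smooth := hα

end BondiSachs

open BondiSachs in
theorem mainTheorem5 (M : SpaceTime) :
    -- the transformation law of the asymptotic shear
    (∀ (b : BMS) (u : ℝ) (z z' : ℂ), b.f z = z' →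
      ∃ ψ : ℝ, b.K z * b.newFrame z = Complex.exp (ψ * Complex.I) * (√2 * P z) ∧
        M.transformedShear b u z =
          (b.K z : ℂ)⁻¹ * Complex.exp (2 * ψ * Complex.I) *
            (M.asymptoticShear u z + 1 / 2 * ethSq (fun p => (b.α p : ℂ)) z)) ∧
    ∀ S : ℂ → ℂ, IsSpinTwo S →
      (∀ z, Filter.Tendsto (fun u => M.asymptoticShear u z) Filter.atBot (nhds (S z))) →
      -- a supertranslation removes the electric part of the limit
      (∃ s : BMS, s.IsSupertranslation ∧ M.ElectricFree s) ∧
      -- the BMS transformations preserving the condition form the Poincaré group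
      ∀ b₀ : BMS, M.ElectricFree b₀ →
        ∃ G : Subgroup (Equiv.Perm (ℝ × OnePoint ℂ)),
          (∀ T, T ∈ G ↔ (∃ b : BMS, b.toPerm = T) ∧
            ∃ c : BMS, c.toPerm = T * b₀.toPerm ∧ M.ElectricFree c) ∧
          (∀ b : BMS, b.toPerm ∈ G ↔ ∀ z, ethSq (fun p => (b.α p : ℂ)) z = 0) ∧
          (∀ b : BMS, b.toPerm ∈ G ↔ IsTranslation b.α) ∧
          Nonempty (G ≃* PoincareGroup) := by
  refine ⟨fun b u z z' h => M.exists_transformedShear_eq b u h, fun S hS hlim => ?_⟩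
  obtain ⟨ξ, hξ, rfl⟩ := hS.exists_ethSq_eq
  -- With this `α` the function `Re ξ + α/2` is identically zero.
  refine ⟨⟨BMS.supertranslation (fun p => -2 * (ξ p).re) fun i => contDiff_const.mul (hξ.re i),
    ⟨rfl, fun p => rfl⟩, ?_⟩, fun b₀ h₀ => ⟨poincareAction.range, ?_, ?_, ?_,
      nonempty_range_mulEquiv⟩⟩
  · rw [M.electricFree_iff hξ hlim]
    exact ⟨0, 0, fun p => by simp [BMS.supertranslation]⟩
  · intro T
    rw [mem_range_poincareAction]
    constructor
    · rintro ⟨b, rfl, hb⟩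
      exact ⟨⟨b, rfl⟩, (M.electricFree_congr hξ hlim h₀ b).2 hb⟩
    · rintro ⟨⟨b, rfl⟩, hc⟩
      exact ⟨b, rfl, (M.electricFree_congr hξ hlim h₀ b).1 hc⟩
  all_goals
    -- A bijection of null infinity determines `f`, `K` and `α`, so any other BMS transformation
    -- inducing it has the same `α`.
    have key : ∀ b : BMS, b.toPerm ∈ poincareAction.range ↔ IsTranslation b.α := fun b => by
      rw [mem_range_poincareAction]
      refine ⟨?_, fun h => ⟨b, rfl, h⟩⟩
      rintro ⟨c, hc, hα⟩
      rwa [← (BMS.eq_of_toPerm_eq hc).2.2]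
  · exact fun b => (key b).trans (isTranslation_iff_ethSq_eq_zero b.smooth)
  · exact key
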